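/- Write $R(x)=(1+|x|^2)^{1/2}$ for $x\in\mathbb R^3$, $\|r\|_\infty=\sup_x|r(x)|$ and $\|r\|_q=\sup_x|r(x)|R(x)^q$ (values in $[0,\infty]$). Fix $p\in(3,4)$ and $T>0$, and let $F:\mathbb R^3\to[0,\infty)$, $f_0:\mathbb R^3\times\mathbb R^3\to[0,\infty)$ and $A:[0,\infty)\times\mathbb R^3\to\mathbb R^3$ satisfy the following conditions. (I) $F(v)=F_R(|v|)$ is $C^2$ and nonnegative, $F_R''(0)<0$, and there is $W\in(0,\infty)$ with $F_R'(u)<0$ for $u\in(0,W)$ and $F_R(u)=0$ for $u\ge W$. (II) $f_0$ is $C^1$ and nonnegative. (III) $A$ is $C^1$, and for some constant $c$ and all $t\ge0$, $x\in\mathbb R^3$, $i=1,2,3$: $|A(t,x)|\le cR(x)^{-2}$, $|\partial_{x_i}A(t,x)|\le cR(x)^{-3}$ and $\nabla_x\cdot A(t,x)=0$. Moreover there are a continuous $\alpha:[0,T]\to\mathbb R$ and a constant $c$ with $|A(t,x)-\alpha(t)x/|x|^3|\le cR(x)^{1-p}$ for $t\in[0,T]$, $|x|\ge1$. (IV) There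 is $M$ with $f_0(x,v)=F(v)$ for all $x$ and all $|v|>M$, and there are $N>0$ and $c$ with $|F(v)-f_0(x,v)|\le cR(x)^{-6}$ for all $|x|>N$ and all $v$. Let $q>0$ and $a\in[0,1)$ with $a\le 3/q$, and let $M_0,M_1\ge0$. Then there is a constant $C$, depending only on $p,T,F,f_0,A,q,a,M_0,M_1$, such that the following holds. Let $f\ge0$ be any $C^1$ solution on $[0,T]\times\mathbb R^3\times\mathbb R^3$ of $$\partial_tf+v\cdot\nabla_xf-(E+A)\cdot\nabla_vf=0,\qquad f(0,x,v)=f_0(x,v),$$ $$\rho(t,x)=\int_{\mathbb R^3}(F(v)-f(t,x,v))\,dv,\qquad E(t,x)=\int_{\mathbb R^3}\rho(t,y)\frac{x-y}{|x-y|^3}\,dy$$ (both integrals absolutely convergent) for which $\|\rho(t)\|_p$ is bounded on $[0,T]$, and let $t\in[0,T]$ be such that $\|\rho(t)\|_\infty\le M_0$ and $\|\nabla\rho(t)\|_\infty\le M_1$. Then for every $|x|\ge1$ the field $E(t,\cdot)$ is differentiable at $x$ and $$|\nabla E(t,x)|\le C\left(\|\rho(t)\|_q\,R(x)^{-q}\right)^a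 ,$$ with the convention $s^0=1$ for all $s\in[0,\infty]$. -/

import Mathlib

open MeasureTheory Set
open scoped ENNReal NNReal

noncomputable section

namespace VlasovPoisson

/-- Three-dimensional Euclidean space. -/
abbrev E3 : Type := EuclideanSpace ℝ (Fin 3)

/-- The weight `R(x) = (1 + |x|²)^{1/2}`. -/
def R (x : E3) : ℝ := (1 + ‖x‖ ^ 2) ^ (1 / 2 : ℝ)

/-- The supremum norm `sup_z |g(z)|`, with value `∞` if `g` is unbounded. -/
def supNorm {α V : Type*} [NormedAddCommGroup V] (g : α → V) : ℝ≥0∞ := ⨆ z, ‖g z‖ₑ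

/-- The weighted norm `‖r‖_q = sup_x |r(x)| R(x)^q`, with value `∞` if the supremum is infinite. -/
def weightedNorm (q : ℝ) (r : E3 → ℝ) : ℝ≥0∞ := supNorm fun x => r x * R x ^ q

/-- The charge density `ρ(t,x) = ∫ (F(v) - f(t,x,v)) dv`. -/
def density (F : E3 → ℝ) (f : ℝ → E3 → E3 → ℝ) (t : ℝ) (x : E3) : ℝ :=
  ∫ v, (F v - f t x v)

/-- The field `E(t,x) = ∫ ρ(t,y) (x - y) / |x - y|³ dy`. -/
def field (F : E3 → ℝ) (f : ℝ → E3 → E3 → ℝ) (t : ℝ) (x : E3) : E3 :=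
  ∫ y, (density F f t y / ‖x - y‖ ^ 3) • (x - y)

/-- Assumptions on the background `F(v) = F_R(|v|)`. -/
structure BackgroundCond (F : E3 → ℝ) : Prop where
  contDiff : ContDiff ℝ 2 F
  nonneg : ∀ v, 0 ≤ F v
  radial : ∃ FR : ℝ → ℝ, (∀ v, F v = FR ‖v‖) ∧
    iteratedDerivWithin 2 FR (Ici 0) 0 < 0 ∧
    ∃ W : ℝ, 0 < W ∧ (∀ u ∈ Ioo 0 W, deriv FR u < 0) ∧ ∀ u, W ≤ u → FR u = 0

/-- Assumptions on the initial datum `f₀`. -/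
structure InitialCond (f₀ : E3 → E3 → ℝ) : Prop where
  contDiff : ContDiff ℝ 1 fun z : E3 × E3 => f₀ z.1 z.2
  nonneg : ∀ x v, 0 ≤ f₀ x v

/-- Assumptions on the external field `A`. -/
structure ExternalFieldCond (p T : ℝ) (A : ℝ → E3 → E3) : Prop where
  contDiffOn : ContDiffOn ℝ 1 (fun z : ℝ × E3 => A z.1 z.2) (Ici 0 ×ˢ univ)
  decay : ∃ C₀ : ℝ, ∀ t, 0 ≤ t → ∀ x, ‖A t x‖ ≤ C₀ * R x ^ (-2 : ℝ)
  decay_deriv : ∃ C : ℝ, ∀ t, 0 ≤ t → ∀ x, ∀ i : Fin 3,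
    ‖fderiv ℝ (A t) x (EuclideanSpace.single i 1)‖ ≤ C * R x ^ (-3 : ℝ)
  div_free : ∀ t, 0 ≤ t → ∀ x,
    ∑ i : Fin 3, (fderiv ℝ (A t) x (EuclideanSpace.single i 1)) i = 0
  asymptotics : ∃ a : ℝ → ℝ, ContinuousOn a (Icc 0 T) ∧ ∃ C : ℝ,
    ∀ t ∈ Icc 0 T, ∀ x : E3, 1 ≤ ‖x‖ →
      ‖A t x - (a t / ‖x‖ ^ 3) • x‖ ≤ C * R x ^ (1 - p)

/-- Assumptions on the difference `F - f₀`. -/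
structure PerturbationCond (F : E3 → ℝ) (f₀ : E3 → E3 → ℝ) : Prop where
  compact_support : ∃ M : ℝ, ∀ x v : E3, M < ‖v‖ → F v - f₀ x v = 0
  decay : ∃ N : ℝ, 0 < N ∧ ∃ C : ℝ, ∀ x v : E3, N < ‖x‖ →
    |F v - f₀ x v| ≤ C * R x ^ (-6 : ℝ)

/-- `f` is a nonnegative `C¹` solution on `[0,T] × ℝ³ × ℝ³` of
`∂ₜf + v·∇ₓf - (E + A)·∇ᵥf = 0`, `f(0) = f₀`, with `ρ` and `E` given by convergent integrals. -/
structure IsSolution (T : ℝ) (F : E3 → ℝ) (f₀ : E3 → E3 → ℝ) (A : ℝ → E3 → E3)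
    (f : ℝ → E3 → E3 → ℝ) : Prop where
  contDiffOn : ContDiffOn ℝ 1 (fun z : ℝ × E3 × E3 => f z.1 z.2.1 z.2.2) (Icc 0 T ×ˢ univ)
  nonneg : ∀ t ∈ Icc 0 T, ∀ x v, 0 ≤ f t x v
  integrable_density : ∀ t ∈ Icc 0 T, ∀ x, Integrable fun v => F v - f t x v
  integrable_field : ∀ t ∈ Icc 0 T, ∀ x : E3,
    Integrable fun y => (density F f t y / ‖x - y‖ ^ 3) • (x - y)
  vlasov : ∀ t ∈ Icc 0 T, ∀ x v : E3,
    derivWithin (fun s => f s x v) (Icc 0 T) t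
      + fderiv ℝ (fun y => f t y v) x v
      - fderiv ℝ (fun w => f t x w) v (field F f t x + A t x) = 0
  initial : ∀ x v, f 0 x v = f₀ x v

end VlasovPoisson

end

open VlasovPoisson

namespace VlasovPoisson

open Metric Module Filter Topology

/-! ### The weight `R` -/

/-! The constant may depend on sup bounds for ρ and ∇ρ at the given time, but not on the size of
‖ρ‖_p. Write S = ‖ρ(t)‖_q R(x)^{-q}. Subtracting the softened kernel `plummerField d` from the
Coulomb kernel leaves `coulombDefect d`, whose L¹ norm is proportional to d. In the convolution with
the defect the derivative falls on ρ and costs M₁ d; in the convolution with the softened kernel it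
falls on the kernel and costs ∫ |ρ(y)| (|x-y|² + d²)^{-3/2} dy (`differentiableAt_coulomb`).

For S < 1 take d = S, so that d ≤ S^a; for S ≥ 1 a uniform bound with d = 1 suffices. The integral
is treated in three regions (`exists_softened_bound`). For |y| < |x|/2 the kernel is of size
R(x)^{-3} and the mass of ρ in the ball is estimated from |ρ| ≤ M₀ and the weighted bound, which is
where a ≤ 3/q enters. Elsewhere |ρ(y)| ≤ 2^q S. For |x-y| < 1 the kernel times S is at most S^a
|x-y|^{-2-a}. For |x-y| ≥ 1 the kernel |x-y|^{-3} just fails to be integrable; extracting (2^q S)^a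
from |ρ| and applying Young's inequality leaves ρ² and |x-y|^{-6/(1+a)}, the latter integrable at
infinity because a < 1. So an L² bound for ρ(t) in terms of the data and M₀ is needed.

That bound is `exists_density_sq_bound`. An increasing function equal to -|v|²/2 at the value F(v)
on the support of F (`BackgroundCond.exists_entropy`) yields a relative entropy of f with respect to
F that dominates (f-F)², and |v|² f at large velocities. Its sum with the Coulomb energy, which is
nonnegative (`plummer_energy_nonneg`), changes only through the work of A. This work is bounded by
the entropy plus a multiple of R^{-4}, which is integrable, so Gronwall's inequality bounds the
entropy, and the entropy together with |ρ| ≤ M₀ bounds ∫ ρ².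

Integrability of the entropy over all of phase space is not available beforehand: the decay obtained
for F - f is only R^{-2}. Hence the functional is cut off at distance 1/δ and its kernel softened at
length δ. The cutoff recedes faster than every particle, so its effect on the entropy has a
favourable sign; the remaining errors carry constants depending on the solution, but they vanish as
δ → 0. -/

theorem R_eq_sqrt (x : E3) : R x = √(1 + ‖x‖ ^ 2) := by
  rw [R, Real.sqrt_eq_rpow]

theorem R_sq (x : E3) : R x ^ 2 = 1 + ‖x‖ ^ 2 := by
  rw [R_eq_sqrt, Real.sq_sqrt (by positivity)]

theorem R_pos (x : E3) : 0 < R x := by rw [R_eq_sqrt]; positivity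

theorem one_le_R (x : E3) : 1 ≤ R x := by
  rw [R_eq_sqrt]; exact Real.one_le_sqrt.2 (by nlinarith [sq_nonneg ‖x‖])

theorem norm_le_R (x : E3) : ‖x‖ ≤ R x := by
  rw [R_eq_sqrt]; exact Real.le_sqrt_of_sq_le (by linarith)

theorem R_le_one_add_norm (x : E3) : R x ≤ 1 + ‖x‖ := by
  rw [R_eq_sqrt]; exact sqrt_one_add_norm_sq_le x

theorem R_le_two_mul_norm {x : E3} (hx : 1 ≤ ‖x‖) : R x ≤ 2 * ‖x‖ := by
  linarith [R_le_one_add_norm x]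

theorem contDiff_R {n : WithTop ℕ∞} : ContDiff ℝ n R := by
  have : R = fun x => √(1 + ‖x‖ ^ 2) := funext R_eq_sqrt
  rw [this]
  exact (contDiff_const.add (contDiff_norm_sq ℝ)).sqrt fun x => by positivity

theorem continuous_R : Continuous R := (contDiff_R (n := 0)).continuous

theorem R_le_add (x y : E3) : R x ≤ R y + ‖x - y‖ := by
  have h1 : ‖x‖ ≤ ‖y‖ + ‖x - y‖ := by
    simpa using norm_add_le y (x - y)
  have h2 := norm_le_R y
  have h3 := R_sq y
  rw [R_eq_sqrt x]
  apply Real.sqrt_le_iff.2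
  refine ⟨by have := R_pos y; positivity, ?_⟩
  nlinarith [norm_nonneg x, norm_nonneg y, norm_nonneg (x - y), R_pos y]

theorem lipschitzWith_R : LipschitzWith 1 R := by
  refine LipschitzWith.of_le_add fun x y => ?_
  rw [dist_eq_norm]; exact R_le_add x y

theorem norm_fderiv_R_le (x : E3) : ‖fderiv ℝ R x‖ ≤ 1 := by
  simpa using norm_fderiv_le_of_lipschitz ℝ lipschitzWith_R (x₀ := x)

theorem R_rpow_neg_le_one (x : E3) {s : ℝ} (hs : 0 ≤ s) : R x ^ (-s) ≤ 1 :=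
  Real.rpow_le_one_of_one_le_of_nonpos (one_le_R x) (by linarith)

theorem R_rpow_pos (x : E3) (s : ℝ) : 0 < R x ^ s := Real.rpow_pos_of_pos (R_pos x) s

theorem continuous_R_rpow (s : ℝ) : Continuous fun x : E3 => R x ^ s :=
  continuous_R.rpow_const fun x => Or.inl (R_pos x).ne'

theorem R_rpow_neg_mono (x : E3) {s r : ℝ} (h : s ≤ r) : R x ^ (-r) ≤ R x ^ (-s) :=
  Real.rpow_le_rpow_of_exponent_le (one_le_R x) (by linarith)

theorem integrable_R_rpow {s : ℝ} (hs : 3 < s) : Integrable fun x : E3 => R x ^ (-s) := by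
  have h := integrable_rpow_neg_one_add_norm_sq (E := E3) (μ := volume) (r := s) (by simpa using hs)
  refine h.congr (Filter.Eventually.of_forall fun x => ?_)
  simp only [R]
  rw [← Real.rpow_mul (by positivity)]
  congr 1; ring

/-! ### Powers of the norm -/

theorem integrableOn_ball_norm_rpow {s : ℝ} (hs : s < 3) (r : ℝ) :
    IntegrableOn (fun z : E3 => ‖z‖ ^ (-s)) (ball 0 r) := by
  refine integrableOn_ball_of_norm_le_rpow (C := 1) (α := s) (by simp) (by simpa using hs) ?_ ?_
  · refine Filter.Eventually.of_forall fun z => ?_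
    rw [one_mul, Real.norm_of_nonneg (by positivity)]
  · exact (measurable_norm.pow_const _).aestronglyMeasurable

theorem setIntegral_ball_norm_rpow (s : ℝ) {r : ℝ} (hr : 0 < r) :
    ∫ z in ball (0 : E3) r, ‖z‖ ^ (-s) = r ^ (3 - s) * ∫ z in ball (0 : E3) 1, ‖z‖ ^ (-s) := by
  have h := Measure.setIntegral_comp_smul (μ := (volume : Measure E3)) (fun z : E3 => ‖z‖ ^ (-s))
    (ball 0 1) hr.ne'
  rw [_root_.smul_ball hr.ne', smul_zero, Real.norm_of_nonneg hr.le, mul_one] at h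
  have h2 : ∀ z : E3, ‖r • z‖ ^ (-s) = r ^ (-s) * ‖z‖ ^ (-s) := fun z => by
    rw [norm_smul, Real.norm_of_nonneg hr.le, Real.mul_rpow hr.le (norm_nonneg z)]
  simp only [h2, integral_const_mul] at h
  simp only [finrank_euclideanSpace, Fintype.card_fin, smul_eq_mul] at h
  rw [abs_of_pos (by positivity)] at h
  have h3 : r ^ (3 - s) = r ^ 3 * r ^ (-s) := by
    rw [sub_eq_add_neg, Real.rpow_add hr]; norm_cast
  rw [h3, mul_assoc, h]
  field_simp

theorem integrableOn_compl_ball_norm_rpow {s : ℝ} (hs : 3 < s) :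
    IntegrableOn (fun z : E3 => ‖z‖ ^ (-s)) (ball 0 1)ᶜ := by
  refine Integrable.mono' ((integrable_R_rpow hs).const_mul (2 ^ s)).integrableOn
    (measurable_norm.pow_const _).aestronglyMeasurable ?_
  refine (ae_restrict_iff' measurableSet_ball.compl).2 (Filter.Eventually.of_forall fun z hz => ?_)
  have hz' : 1 ≤ ‖z‖ := by simpa using hz
  have h2 := R_le_two_mul_norm hz'
  rw [Real.norm_of_nonneg (by positivity)]
  have h3 : ‖z‖ ^ (-s) = 2 ^ s * (2 * ‖z‖) ^ (-s) := by
    rw [Real.mul_rpow (by norm_num) (by positivity), ← mul_assoc, ← Real.rpow_add (by norm_num)]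
    simp
  rw [h3]
  exact mul_le_mul_of_nonneg_left
    (Real.rpow_le_rpow_of_nonpos (R_pos z) h2 (by linarith)) (by positivity)

/-- Weighted bound for Riesz-type potentials of densities decaying faster than `|x|⁻³`. -/
theorem exists_riesz_bound {p b : ℝ} (hp : 3 < p) (hb0 : 0 < b) (hb : b < 3) :
    ∃ C : ℝ, 0 ≤ C ∧ ∀ x : E3, Integrable (fun y : E3 => R y ^ (-p) * ‖x - y‖ ^ (-b)) ∧
      ∫ y : E3, R y ^ (-p) * ‖x - y‖ ^ (-b) ≤ C * R x ^ (-b) := by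
  set I := ∫ y : E3, R y ^ (-p)
  set J := ∫ z in ball (0 : E3) 1, ‖z‖ ^ (-b)
  have hI : 0 ≤ I := integral_nonneg fun y => (R_rpow_pos y _).le
  have hJ : 0 ≤ J := integral_nonneg fun y => by positivity
  refine ⟨4 ^ b * I + (3 / 4) ^ (-p) * ((1 / 4) ^ (3 - b) * J), by positivity, fun x => ?_⟩
  have hRx := R_pos x
  -- Majorant split at |x - y| = R x / 4. Outside, the kernel is at most (R x / 4)^{-b} against an
  -- integrable weight. Inside, R y ≥ 3/4 R x freezes the weight, and b < 3 makes the kernel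
  -- integrable.
  set g : E3 → ℝ := fun y => R y ^ (-p) * (R x / 4) ^ (-b) +
    (3 / 4 * R x) ^ (-p) * (ball (0 : E3) (R x / 4)).indicator (fun z => ‖z‖ ^ (-b)) (x - y) with hg
  have hle : ∀ y : E3, R y ^ (-p) * ‖x - y‖ ^ (-b) ≤ g y := by
    intro y
    by_cases hy : x - y ∈ ball (0 : E3) (R x / 4)
    · have h1 : ‖x - y‖ < R x / 4 := by simpa using hy
      have h2 : 3 / 4 * R x ≤ R y := by linarith [R_le_add x y]
      simp only [hg, indicator_of_mem hy]
      have h3 : R y ^ (-p) ≤ (3 / 4 * R x) ^ (-p) :=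
        Real.rpow_le_rpow_of_nonpos (by positivity) h2 (by linarith)
      have h4 : 0 ≤ R y ^ (-p) * (R x / 4) ^ (-b) := by
        have := R_pos y; positivity
      have := mul_le_mul_of_nonneg_right h3 (by positivity : 0 ≤ ‖x - y‖ ^ (-b))
      linarith
    · have h1 : R x / 4 ≤ ‖x - y‖ := by simpa using hy
      simp only [hg, indicator_of_notMem hy, mul_zero, add_zero]
      exact mul_le_mul_of_nonneg_left
        (Real.rpow_le_rpow_of_nonpos (by positivity) h1 (by linarith)) (R_rpow_pos y _).le
  have hi2 : Integrable (fun z : E3 => (ball (0 : E3) (R x / 4)).indicator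
      (fun z => ‖z‖ ^ (-b)) z) :=
    (integrableOn_ball_norm_rpow hb _).integrable_indicator measurableSet_ball
  have hgi : Integrable g :=
    ((integrable_R_rpow hp).mul_const _).add ((hi2.comp_sub_left x).const_mul _)
  have hfi : Integrable (fun y : E3 => R y ^ (-p) * ‖x - y‖ ^ (-b)) := by
    refine hgi.mono' ?_ (Filter.Eventually.of_forall fun y => ?_)
    · exact ((continuous_R_rpow _).measurable.mul
        ((measurable_const.sub measurable_id).norm.pow_const _)).aestronglyMeasurable
    · rw [Real.norm_of_nonneg (by have := R_pos y; positivity)]; exact hle y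
  refine ⟨hfi, (integral_mono hfi hgi hle).trans ?_⟩
  have e1 : ∫ y, g y = I * (R x / 4) ^ (-b) + (3 / 4 * R x) ^ (-p) * ((R x / 4) ^ (3 - b) * J) := by
    simp only [hg]
    rw [integral_add ((integrable_R_rpow hp).mul_const _) ((hi2.comp_sub_left x).const_mul _),
      integral_mul_const, integral_const_mul,
      integral_sub_left_eq_self (fun z : E3 => (ball (0 : E3) (R x / 4)).indicator
        (fun z => ‖z‖ ^ (-b)) z) volume x, integral_indicator measurableSet_ball,
      setIntegral_ball_norm_rpow b (by positivity)]
  rw [e1]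
  have e2 : (R x / 4) ^ (-b) = 4 ^ b * R x ^ (-b) := by
    rw [Real.div_rpow hRx.le (by norm_num), Real.rpow_neg (by norm_num : (0:ℝ) ≤ 4), div_inv_eq_mul,
      mul_comm]
  have e3 : (3 / 4 * R x) ^ (-p) * (R x / 4) ^ (3 - b) ≤
      (3 / 4) ^ (-p) * (1 / 4) ^ (3 - b) * R x ^ (-b) := by
    rw [Real.mul_rpow (by norm_num) hRx.le, div_eq_mul_one_div (R x) 4, mul_comm (R x) (1 / 4),
      Real.mul_rpow (by norm_num) hRx.le]
    -- The inner region gains the factor R^{3-p}, which is at most 1.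
    have : R x ^ (-p) * R x ^ (3 - b) ≤ R x ^ (-b) := by
      rw [← Real.rpow_add hRx]
      exact Real.rpow_le_rpow_of_exponent_le (one_le_R x) (by linarith)
    calc _ = (3 / 4) ^ (-p) * (1 / 4) ^ (3 - b) * (R x ^ (-p) * R x ^ (3 - b)) := by ring
      _ ≤ _ := mul_le_mul_of_nonneg_left this (by positivity)
  rw [e2]
  have := mul_le_mul_of_nonneg_right e3 hJ
  nlinarith

/-! ### A maximum principle on backward cones -/

/-- Compactness replaces the characteristic flow. On the backward cone maximize u - (m + ε)s. At a
maximum with s > 0, following the characteristic direction backwards stays in the cone, so the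
transport derivative would be at least m + ε, contradicting the bound m; the maximum therefore lies
at s = 0. No characteristics are constructed, hence G needs a bound but no continuity. -/
theorem le_of_transport_le {T t : ℝ} (ht : t ∈ Ioo 0 T) {u : ℝ × E3 × E3 → ℝ} {G : ℝ → E3 → E3}
    (hc : ContinuousOn u (Icc 0 T ×ˢ univ))
    (hd : ∀ z ∈ Ioo 0 T ×ˢ (univ : Set (E3 × E3)), DifferentiableAt ℝ u z)
    {x v : E3} {B L m c : ℝ} (hB0 : 0 ≤ B) (hL : ‖v‖ + B * t ≤ L)
    (hB : ∀ s ∈ Ioc 0 t, ∀ y, ‖y - x‖ ≤ L * (t - s) → ‖G s y‖ ≤ B)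
    (hm : ∀ s ∈ Ioc 0 t, ∀ y w, ‖y - x‖ ≤ L * (t - s) → ‖w - v‖ ≤ B * (t - s) →
      fderiv ℝ u (s, y, w) (1, w, -G s y) ≤ m)
    (hbase : ∀ y w, ‖y - x‖ ≤ L * t → ‖w - v‖ ≤ B * t → u (0, y, w) ≤ c) :
    u (t, x, v) ≤ c + m * t := by
  have ht0 := ht.1
  have hL0 : 0 ≤ L := le_trans (by positivity) hL
  suffices H : ∀ ε > 0, u (t, x, v) ≤ c + m * t + ε * t by
    refine le_of_forall_pos_le_add fun ε hε => ?_
    have := H (ε / t) (by positivity)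
    rwa [div_mul_cancel₀ _ ht0.ne'] at this
  intro ε hε
  set K : Set (ℝ × E3 × E3) := {z | z.1 ∈ Icc 0 t ∧ ‖z.2.1 - x‖ ≤ L * (t - z.1) ∧
    ‖z.2.2 - v‖ ≤ B * (t - z.1)} with hK
  have hKc : IsCompact K := by
    refine IsCompact.of_isClosed_subset
      ((isCompact_Icc (a := 0) (b := t)).prod ((isCompact_closedBall x (L * t)).prod
        (isCompact_closedBall v (B * t)))) ?_ ?_
    · exact (isClosed_Icc.preimage continuous_fst).inter
        ((isClosed_le (f := fun z : ℝ × E3 × E3 => ‖z.2.1 - x‖) (g := fun z => L * (t - z.1))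
          (by fun_prop) (by fun_prop)).inter
        (isClosed_le (f := fun z : ℝ × E3 × E3 => ‖z.2.2 - v‖) (g := fun z => B * (t - z.1))
          (by fun_prop) (by fun_prop)))
    · rintro ⟨s, y, w⟩ ⟨hs, hy, hw⟩
      refine ⟨hs, ?_, ?_⟩
      · rw [mem_closedBall, dist_eq_norm]; exact hy.trans (by gcongr; simp at hs; linarith)
      · rw [mem_closedBall, dist_eq_norm]; exact hw.trans (by gcongr; simp at hs; linarith)
  have hmem : (t, x, v) ∈ K := by simp [hK, ht0.le]
  have hcont : ContinuousOn (fun z : ℝ × E3 × E3 => u z - (m + ε) * z.1) K :=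
    (hc.mono fun z hz => ⟨⟨hz.1.1, hz.1.2.trans ht.2.le⟩, mem_univ _⟩).sub (by fun_prop)
  obtain ⟨⟨s, y, w⟩, hz, hmax⟩ := hKc.exists_isMaxOn ⟨_, hmem⟩ hcont
  have hle := hmax hmem
  simp only [mem_ofPred_eq] at hle
  obtain ⟨hs, hy, hw⟩ := hz
  simp only at hs hy hw
  rcases hs.1.eq_or_lt with h0 | h0
  · subst h0
    have := hbase y w (by simpa using hy) (by simpa using hw)
    linarith
  · exfalso
    have hsI : s ∈ Ioc 0 t := ⟨h0, hs.2⟩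
    have hdz : DifferentiableAt ℝ u (s, y, w) := hd _ ⟨⟨h0, hs.2.trans_lt ht.2⟩, mem_univ _⟩
    have hG := hB s hsI y hy
    have hder := hdz.hasFDerivAt.sub
      (((ContinuousLinearMap.fst ℝ ℝ (E3 × E3)).hasFDerivAt (x := (s, y, w))).const_mul (m + ε))
    -- Velocities in the cone stay below L, the rate at which the spatial radius grows backwards in
    -- time.
    have hw' : ‖w‖ ≤ L := by
      have : ‖w‖ ≤ ‖v‖ + ‖w - v‖ := by simpa using norm_add_le v (w - v)
      have : B * (t - s) ≤ B * t := by gcongr; linarith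
      linarith
    -- The factor s makes the segment end exactly at time 0, so that the whole of it remains in K.
    have htan : (-s) • ((1 : ℝ), w, -G s y) ∈ posTangentConeAt K (s, y, w) := by
      refine mem_posTangentConeAt_of_segment_subset ?_
      rw [segment_eq_image']
      rintro _ ⟨θ, hθ, rfl⟩
      have e : (s, y, w) + θ • ((s, y, w) + (-s) • ((1 : ℝ), w, -G s y) - (s, y, w)) =
          (s - θ * s, y - (θ * s) • w, w + (θ * s) • G s y) := by
        rw [add_sub_cancel_left]
        ext1
        · simp; ring
        · ext1
          · simp only [Prod.snd_add, Prod.fst_add, Prod.smul_snd, Prod.smul_fst]; module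
          · simp only [Prod.snd_add, Prod.smul_snd]; module
      simp only [e]
      have h1 : 0 ≤ θ * s := mul_nonneg hθ.1 h0.le
      have h2 : θ * s ≤ s := mul_le_of_le_one_left h0.le hθ.2
      refine ⟨⟨by linarith, by linarith [hs.2]⟩, ?_, ?_⟩
      · have : y - (θ * s) • w - x = (y - x) - (θ * s) • w := by module
        simp only [this]
        refine (norm_sub_le _ _).trans ?_
        rw [norm_smul, Real.norm_of_nonneg h1]
        nlinarith
      · have : w + (θ * s) • G s y - v = (w - v) + (θ * s) • G s y := by module
        simp only [this]
        refine (norm_add_le _ _).trans ?_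
        rw [norm_smul, Real.norm_of_nonneg h1]
        nlinarith
    have hneg := (hmax.localize).hasFDerivWithinAt_nonpos hder.hasFDerivWithinAt htan
    have hmm := hm s hsI y w hy hw
    rw [map_smul] at hneg
    simp only [sub_apply, smul_apply,
      ContinuousLinearMap.coe_fst', smul_eq_mul, mul_one] at hneg
    nlinarith

/-! ### Consequences of the assumptions on the data -/

theorem BackgroundCond.exists_eq_zero {F : E3 → ℝ} (hF : BackgroundCond F) :
    ∃ W : ℝ, 0 < W ∧ ∀ v, W ≤ ‖v‖ → F v = 0 := by
  obtain ⟨FR, h1, -, W, hW, -, h2⟩ := hF.radial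
  exact ⟨W, hW, fun v hv => by rw [h1]; exact h2 _ hv⟩

theorem BackgroundCond.hasCompactSupport {F : E3 → ℝ} (hF : BackgroundCond F) :
    HasCompactSupport F := by
  obtain ⟨W, -, h⟩ := hF.exists_eq_zero
  refine HasCompactSupport.intro (isCompact_closedBall 0 W) fun v hv => h v ?_
  simp at hv; exact hv.le

/-- A radial function is even, so its derivative at the origin equals its own negative. -/
theorem BackgroundCond.fderiv_zero {F : E3 → ℝ} (hF : BackgroundCond F) : fderiv ℝ F 0 = 0 := by
  obtain ⟨FR, h1, -⟩ := hF.radial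
  have hd : DifferentiableAt ℝ F 0 := (hF.contDiff.differentiable (by norm_num)) 0
  have he : F ∘ (fun v : E3 => -v) = F := by ext v; simp [h1]
  have h2 : HasFDerivAt (F ∘ fun v : E3 => -v) ((fderiv ℝ F 0).comp (-ContinuousLinearMap.id ℝ E3))
      0 := by
    refine HasFDerivAt.comp (0 : E3) ?_ (hasFDerivAt_id (0 : E3)).fun_neg
    simpa using hd.hasFDerivAt
  rw [he] at h2
  have h3 := hd.hasFDerivAt.unique h2
  ext w
  have := congrArg (fun l => l w) h3
  simp at this
  simp; linarith

/-- The gradient is Lipschitz, by compact support and C² regularity, and vanishes at 0. The linear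
bound makes F Lipschitz as a function of |v|², which gives the entropy its uniform convexity. -/
theorem BackgroundCond.exists_norm_fderiv_le {F : E3 → ℝ} (hF : BackgroundCond F) :
    ∃ C : ℝ, 0 ≤ C ∧ ∀ v, ‖fderiv ℝ F v‖ ≤ C * ‖v‖ := by
  have hc : ContDiff ℝ 1 (fderiv ℝ F) := hF.contDiff.fderiv_right (by norm_num)
  obtain ⟨C, hC⟩ := hc.lipschitzWith_of_hasCompactSupport (hF.hasCompactSupport.fderiv ℝ) (by norm_num)
  refine ⟨C, C.2, fun v => ?_⟩
  have := hC.norm_sub_le v 0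
  simpa [hF.fderiv_zero] using this

theorem BackgroundCond.exists_norm_fderiv_le_const {F : E3 → ℝ} (hF : BackgroundCond F) :
    ∃ C : ℝ, 0 ≤ C ∧ ∀ v, ‖fderiv ℝ F v‖ ≤ C := by
  obtain ⟨C, hC⟩ := (hF.hasCompactSupport.fderiv ℝ).exists_bound_of_continuous
    (hF.contDiff.continuous_fderiv (by norm_num))
  exact ⟨C, (norm_nonneg _).trans (hC 0), hC⟩

/-- The decay is assumed only for |x| > N. On the remaining set the difference vanishes for |v| > M
and is bounded by compactness otherwise; the factor (1 + N)^6 compensates the weight there. -/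
theorem exists_initial_bounds {F : E3 → ℝ} {f₀ : E3 → E3 → ℝ} (hF : BackgroundCond F)
    (hf₀ : InitialCond f₀) (h : PerturbationCond F f₀) :
    ∃ C P : ℝ, 0 ≤ C ∧ 0 < P ∧ (∀ x v, |F v - f₀ x v| ≤ C * R x ^ (-6 : ℝ)) ∧
      ∀ x v, P < ‖v‖ → F v = 0 ∧ f₀ x v = 0 := by
  obtain ⟨M, hM⟩ := h.compact_support
  obtain ⟨N, hN, C, hC⟩ := h.decay
  obtain ⟨W, hW, hFW⟩ := hF.exists_eq_zero
  have hcont : Continuous fun z : E3 × E3 => F z.2 - f₀ z.1 z.2 :=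
    (hF.contDiff.continuous.comp continuous_snd).sub hf₀.contDiff.continuous
  obtain ⟨C', hC'⟩ := ((isCompact_closedBall (0 : E3) N).prod
    (isCompact_closedBall (0 : E3) M)).exists_bound_of_continuousOn hcont.continuousOn
  refine ⟨max (max C C') 0 * (1 + N) ^ (6 : ℝ), max W M, by positivity, by positivity, ?_, ?_⟩
  · intro x v
    have hR := R_rpow_pos x (-6)
    have h1N : 1 ≤ (1 + N) ^ (6 : ℝ) := Real.one_le_rpow (by linarith) (by norm_num)
    have hm : 0 ≤ max (max C C') 0 := le_max_right _ _
    rcases lt_or_ge N ‖x‖ with hx | hx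
    · refine (hC x v hx).trans ?_
      refine mul_le_mul_of_nonneg_right ?_ hR.le
      have : C ≤ max (max C C') 0 := (le_max_left _ _).trans (le_max_left _ _)
      nlinarith
    · rcases lt_or_ge M ‖v‖ with hv | hv
      · rw [hM x v hv]; simp only [abs_zero]; positivity
      · have h1 : |F v - f₀ x v| ≤ C' :=
          hC' (x, v) ⟨by simpa using hx, by simpa using hv⟩
        have h2 : R x ≤ 1 + N := (R_le_one_add_norm x).trans (by linarith)
        have h3 : (1 + N) ^ (-6 : ℝ) ≤ R x ^ (-6 : ℝ) :=
          Real.rpow_le_rpow_of_nonpos (R_pos x) h2 (by norm_num)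
        have h4 : 1 ≤ (1 + N) ^ (6 : ℝ) * R x ^ (-6 : ℝ) := by
          calc (1 : ℝ) = (1 + N) ^ (6 : ℝ) * (1 + N) ^ (-6 : ℝ) := by
                rw [← Real.rpow_add (by linarith)]; norm_num
            _ ≤ _ := by gcongr
        have h5 : C' ≤ max (max C C') 0 := (le_max_right _ _).trans (le_max_left _ _)
        rw [mul_assoc]
        nlinarith
  · intro x v hv
    have h1 := hFW v ((le_max_left _ _).trans hv.le)
    have h2 := hM x v ((le_max_right _ _).trans_lt hv)
    exact ⟨h1, by linarith⟩

theorem ExternalFieldCond.exists_bound {p T : ℝ} {A : ℝ → E3 → E3} (hA : ExternalFieldCond p T A) :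
    ∃ C : ℝ, 0 ≤ C ∧ ∀ t, 0 ≤ t → ∀ x, ‖A t x‖ ≤ C * R x ^ (-2 : ℝ) := by
  obtain ⟨C, hC⟩ := hA.decay
  refine ⟨max C 0, le_max_right _ _, fun t ht x => (hC t ht x).trans ?_⟩
  exact mul_le_mul_of_nonneg_right (le_max_left _ _) (R_rpow_pos x _).le

/-! ### Regularity and decay of solutions -/

theorem abs_le_of_weightedNorm_le {p : ℝ} {r : E3 → ℝ} {K : ℝ≥0} (h : weightedNorm p r ≤ K)
    (x : E3) : |r x| ≤ K * R x ^ (-p) := by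
  have h1 : ‖r x * R x ^ p‖ₑ ≤ K := (le_iSup (fun x => ‖r x * R x ^ p‖ₑ) x).trans h
  rw [← ofReal_norm, ENNReal.ofReal_le_iff_le_toReal ENNReal.coe_ne_top, norm_mul,
    Real.norm_of_nonneg (R_rpow_pos x p).le] at h1
  rw [Real.rpow_neg (R_pos x).le, ← div_eq_mul_inv, le_div_iff₀ (R_rpow_pos x p)]
  simpa using h1

theorem norm_le_of_supNorm_le {α V : Type*} [NormedAddCommGroup V] {g : α → V} {M : ℝ≥0}
    (h : supNorm g ≤ M) (x : α) : ‖g x‖ ≤ M := by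
  have h1 : ‖g x‖ₑ ≤ M := (le_iSup (fun x => ‖g x‖ₑ) x).trans h
  rwa [← ofReal_norm, ENNReal.ofReal_le_iff_le_toReal ENNReal.coe_ne_top] at h1

section Solution

variable {T : ℝ} {F : E3 → ℝ} {f₀ : E3 → E3 → ℝ} {A : ℝ → E3 → E3} {f : ℝ → E3 → E3 → ℝ}

/-- The solution as a function of `(t, x, v)`. -/
def uncurry3 (f : ℝ → E3 → E3 → ℝ) (z : ℝ × E3 × E3) : ℝ := f z.1 z.2.1 z.2.2

theorem IsSolution.contDiffAt (hf : IsSolution T F f₀ A f) {z : ℝ × E3 × E3}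
    (hz : z.1 ∈ Ioo 0 T) : ContDiffAt ℝ 1 (uncurry3 f) z :=
  hf.contDiffOn.contDiffAt (prod_mem_nhds (Icc_mem_nhds hz.1 hz.2) univ_mem)

theorem IsSolution.continuousOn (hf : IsSolution T F f₀ A f) :
    ContinuousOn (uncurry3 f) (Icc 0 T ×ˢ univ) :=
  hf.contDiffOn.continuousOn

theorem IsSolution.contDiff_slice (hf : IsSolution T F f₀ A f) {t : ℝ} (ht : t ∈ Icc 0 T) :
    ContDiff ℝ 1 fun z : E3 × E3 => f t z.1 z.2 := by
  have := hf.contDiffOn.comp (s := univ) (f := fun z : E3 × E3 => (t, z))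
    (contDiff_const.prodMk contDiff_id).contDiffOn (fun z _ => ⟨ht, mem_univ _⟩)
  exact contDiffOn_univ.1 this

/-- The three partial derivatives of the Vlasov equation become one directional derivative on
space-time-velocity, the form required by `le_of_transport_le` and by the entropy identities. At
interior times the one-sided time derivative is the ordinary one. -/
theorem IsSolution.fderiv_transport (hf : IsSolution T F f₀ A f) {t : ℝ} (ht : t ∈ Ioo 0 T)
    (x v : E3) :
    fderiv ℝ (uncurry3 f) (t, x, v) (1, v, -(field F f t x + A t x)) = 0 := by
  have hd : HasFDerivAt (uncurry3 f) (fderiv ℝ (uncurry3 f) (t, x, v)) (t, x, v) :=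
    ((hf.contDiffAt (z := (t, x, v)) ht).differentiableAt (by norm_num)).hasFDerivAt
  have h := hf.vlasov t (Ioo_subset_Icc_self ht) x v
  rw [derivWithin_of_mem_nhds (Icc_mem_nhds ht.1 ht.2)] at h
  have e1 : deriv (fun s => f s x v) t = fderiv ℝ (uncurry3 f) (t, x, v) (1, 0, 0) := by
    have : HasDerivAt (fun s : ℝ => (s, x, v)) (1, 0, 0) t :=
      (hasDerivAt_id t).prodMk ((hasDerivAt_const t x).prodMk (hasDerivAt_const t v))
    exact (HasFDerivAt.comp_hasDerivAt t hd this).deriv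
  have e2 : ∀ w, fderiv ℝ (fun y => f t y v) x w = fderiv ℝ (uncurry3 f) (t, x, v) (0, w, 0) := by
    intro w
    have : HasFDerivAt (fun y : E3 => (t, y, v))
      ((0 : E3 →L[ℝ] ℝ).prod ((ContinuousLinearMap.id ℝ E3).prod 0)) x :=
      (hasFDerivAt_const t x).prodMk ((hasFDerivAt_id x).prodMk (hasFDerivAt_const v x))
    rw [show (fun y => f t y v) = uncurry3 f ∘ fun y : E3 => (t, y, v) from rfl,
      (HasFDerivAt.comp x hd this).fderiv]
    simp
  have e3 : ∀ w, fderiv ℝ (fun y => f t x y) v w = fderiv ℝ (uncurry3 f) (t, x, v) (0, 0, w) := by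
    intro w
    have : HasFDerivAt (fun y : E3 => (t, x, y))
      ((0 : E3 →L[ℝ] ℝ).prod ((0 : E3 →L[ℝ] E3).prod (ContinuousLinearMap.id ℝ E3))) v :=
      (hasFDerivAt_const t v).prodMk ((hasFDerivAt_const x v).prodMk (hasFDerivAt_id v))
    rw [show (fun y => f t x y) = uncurry3 f ∘ fun y : E3 => (t, x, y) from rfl,
      (HasFDerivAt.comp v hd this).fderiv]
    simp
  rw [e1, e2, e3, ← map_add, ← map_sub] at h
  simpa using h

theorem measurable_density (hf : IsSolution T F f₀ A f) (hF : BackgroundCond F) {t : ℝ}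
    (ht : t ∈ Icc 0 T) : StronglyMeasurable (density F f t) := by
  have : Continuous fun z : E3 × E3 => F z.2 - f t z.1 z.2 :=
    (hF.contDiff.continuous.comp continuous_snd).sub (hf.contDiff_slice ht).continuous
  exact this.stronglyMeasurable.integral_prod_right (ν := (volume : Measure E3))

theorem measurable_field (hf : IsSolution T F f₀ A f) (hF : BackgroundCond F) {t : ℝ}
    (ht : t ∈ Icc 0 T) : StronglyMeasurable (field F f t) := by
  have h1 : Measurable fun z : E3 × E3 =>
      (density F f t z.2 / ‖z.1 - z.2‖ ^ 3) • (z.1 - z.2) :=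
    (((measurable_density hf hF ht).measurable.comp measurable_snd).div
      ((measurable_fst.sub measurable_snd).norm.pow_const 3)).smul (measurable_fst.sub measurable_snd)
  exact h1.stronglyMeasurable.integral_prod_right (ν := (volume : Measure E3))

theorem norm_coulomb_le (r : ℝ) (z : E3) : ‖(r / ‖z‖ ^ 3) • z‖ ≤ |r| * ‖z‖ ^ (-2 : ℝ) := by
  rcases eq_or_ne z 0 with rfl | hz
  · simp
  have hz' : 0 < ‖z‖ := norm_pos_iff.2 hz
  rw [norm_smul, norm_div, norm_pow, norm_norm, Real.norm_eq_abs, Real.rpow_neg hz'.le]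
  norm_cast
  apply le_of_eq; field_simp

/-- Bound of the self-consistent field by the decay of the density. -/
theorem exists_field_bound {p : ℝ} (hp : 3 < p) : ∃ C : ℝ, 0 ≤ C ∧
    ∀ (F : E3 → ℝ) (f : ℝ → E3 → E3 → ℝ) (t : ℝ) (K : ℝ), 0 ≤ K →
      (∀ x, |density F f t x| ≤ K * R x ^ (-p)) → ∀ x, ‖field F f t x‖ ≤ K * C * R x ^ (-2 : ℝ) := by
  obtain ⟨C, hC, h⟩ := exists_riesz_bound (b := 2) hp (by norm_num) (by norm_num)
  refine ⟨C, hC, fun F f t K hK hρ x => ?_⟩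
  obtain ⟨hi, hle⟩ := h x
  have h1 : ‖field F f t x‖ ≤ ∫ y, K * (R y ^ (-p) * ‖x - y‖ ^ (-2 : ℝ)) := by
    refine norm_integral_le_of_norm_le (hi.const_mul K) (Eventually.of_forall fun y => ?_)
    refine (norm_coulomb_le _ _).trans ?_
    rw [← mul_assoc]
    exact mul_le_mul_of_nonneg_right (hρ y) (by positivity)
  rw [integral_const_mul] at h1
  calc _ ≤ _ := h1
    _ ≤ K * (C * R x ^ (-2 : ℝ)) := by gcongr
    _ = _ := by ring

end Solution

/-! ### Propagation of velocity support and spatial decay -/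

section Solution

variable {T : ℝ} {F : E3 → ℝ} {f₀ : E3 → E3 → ℝ} {A : ℝ → E3 → E3} {f : ℝ → E3 → E3 → ℝ}

theorem le_Icc_of_le_Ioo (hT : 0 < T) {u : ℝ × E3 × E3 → ℝ}
    (hu : ContinuousOn u (Icc 0 T ×ˢ univ)) {z : E3 × E3} {c : ℝ}
    (h : ∀ t ∈ Ioo 0 T, u (t, z) ≤ c) : ∀ t ∈ Icc 0 T, u (t, z) ≤ c := by
  intro t ht
  rw [← closure_Ioo hT.ne] at ht
  refine le_on_closure (f := fun t => u (t, z)) (g := fun _ => c) h ?_ continuousOn_const ht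
  rw [closure_Ioo hT.ne]
  exact hu.comp (by fun_prop) fun s hs => ⟨hs, mem_univ _⟩

/-- A force bounded by B changes the velocity by at most B T, so the backward cone of a point with
|v| > P₀ + B T meets time 0 only where the datum vanishes. The maximum principle with m = c = 0
gives f ≤ 0 there. -/
theorem IsSolution.exists_velocity_support (hT : 0 < T) (hf : IsSolution T F f₀ A f) {P₀ B : ℝ}
    (hP₀ : 0 < P₀) (h₀ : ∀ x v, P₀ < ‖v‖ → F v = 0 ∧ f₀ x v = 0) (hB0 : 0 ≤ B)
    (hB : ∀ t ∈ Icc 0 T, ∀ x, ‖field F f t x + A t x‖ ≤ B) :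
    ∃ P : ℝ, 0 < P ∧ ∀ t ∈ Icc 0 T, ∀ x v, P < ‖v‖ → F v = 0 ∧ f t x v = 0 := by
  refine ⟨P₀ + B * T, by positivity, fun t ht x v hv => ?_⟩
  have hBT : 0 ≤ B * T := by positivity
  refine ⟨(h₀ x v (by linarith)).1, le_antisymm ?_ (hf.nonneg t ht x v)⟩
  refine le_Icc_of_le_Ioo (u := uncurry3 f) (z := (x, v)) hT hf.continuousOn (fun t ht => ?_) t ht
  have htI := Ioo_subset_Icc_self ht
  have := le_of_transport_le (G := fun t x => field F f t x + A t x) (x := x) (v := v)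
    (L := ‖v‖ + B * t) (m := 0) (c := 0) ht hf.continuousOn
    (fun z hz => (hf.contDiffAt hz.1).differentiableAt (by norm_num)) hB0 le_rfl
    (fun s hs y _ => hB s ⟨hs.1.le, hs.2.trans ht.2.le⟩ y)
    (fun s hs y w _ _ => (hf.fderiv_transport ⟨hs.1, hs.2.trans_lt ht.2⟩ y w).le) ?_
  · simpa using this
  · intro y w _ hw
    have h1 : ‖v‖ ≤ ‖w‖ + ‖w - v‖ := by
      rw [norm_sub_rev]; simpa using norm_add_le w (v - w)
    have h2 : B * t ≤ B * T := by have := ht.2; gcongr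
    have h3 : P₀ < ‖w‖ := by linarith
    have : uncurry3 f (0, y, w) = 0 := by
      simp only [uncurry3]; rw [hf.initial]; exact (h₀ y w h3).2
    exact this.le

theorem R_rpow_neg_two_le {x y : E3} {D : ℝ} (h : ‖y - x‖ ≤ D) :
    R y ^ (-2 : ℝ) ≤ (1 + D) ^ 2 * R x ^ (-2 : ℝ) := by
  have hD : 0 ≤ D := (norm_nonneg _).trans h
  have h1 : R x ≤ (1 + D) * R y := by
    have := R_le_add x y
    rw [norm_sub_rev] at this
    nlinarith [one_le_R y]
  have h2 : ((1 + D) * R y) ^ (-2 : ℝ) ≤ R x ^ (-2 : ℝ) :=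
    Real.rpow_le_rpow_of_nonpos (R_pos x) h1 (by norm_num)
  have h3 : R y ^ (-2 : ℝ) = (1 + D) ^ 2 * ((1 + D) * R y) ^ (-2 : ℝ) := by
    rw [Real.mul_rpow (by positivity) (R_pos y).le, ← mul_assoc]
    rw [Real.rpow_neg (by positivity : 0 ≤ 1 + D)]
    norm_cast
    rw [mul_inv_cancel₀ (by positivity), one_mul]
  rw [h3]
  exact mul_le_mul_of_nonneg_left h2 (by positivity)

theorem IsSolution.hasFDerivAt_perturbation (hf : IsSolution T F f₀ A f) (hF : BackgroundCond F)
    {z : ℝ × E3 × E3} (hz : z.1 ∈ Ioo 0 T) :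
    HasFDerivAt (fun z : ℝ × E3 × E3 => F z.2.2 - uncurry3 f z)
      ((fderiv ℝ F z.2.2).comp ((ContinuousLinearMap.snd ℝ E3 E3).comp
        (ContinuousLinearMap.snd ℝ ℝ (E3 × E3))) - fderiv ℝ (uncurry3 f) z) z := by
  have h1 : HasFDerivAt F (fderiv ℝ F z.2.2) z.2.2 :=
    (hF.contDiff.differentiable (by norm_num) _).hasFDerivAt
  have h2 : HasFDerivAt (fun z : ℝ × E3 × E3 => z.2.2) ((ContinuousLinearMap.snd ℝ E3 E3).comp
        (ContinuousLinearMap.snd ℝ ℝ (E3 × E3))) z :=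
    ((ContinuousLinearMap.snd ℝ E3 E3).comp (ContinuousLinearMap.snd ℝ ℝ (E3 × E3))).hasFDerivAt
  exact (HasFDerivAt.comp z h1 h2).sub
    ((hf.contDiffAt hz).differentiableAt (by norm_num)).hasFDerivAt

theorem continuousOn_perturbation (hf : IsSolution T F f₀ A f) (hF : BackgroundCond F) :
    ContinuousOn (fun z : ℝ × E3 × E3 => F z.2.2 - uncurry3 f z) (Icc 0 T ×ˢ univ) :=
  (hF.contDiff.continuous.comp (continuous_snd.comp continuous_snd)).continuousOn.sub
    hf.continuousOn

/-- The perturbation `F - f` decays like `R⁻²` uniformly in time. -/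
theorem IsSolution.exists_perturbation_decay (hT : 0 < T) (hf : IsSolution T F f₀ A f)
    (hF : BackgroundCond F) {C₀ CG P : ℝ} (hC₀ : 0 ≤ C₀) (hCG : 0 ≤ CG) (hP0 : 0 < P)
    (h₀ : ∀ x v, |F v - f₀ x v| ≤ C₀ * R x ^ (-6 : ℝ))
    (hG : ∀ t ∈ Icc 0 T, ∀ x, ‖field F f t x + A t x‖ ≤ CG * R x ^ (-2 : ℝ))
    (hP : ∀ t ∈ Icc 0 T, ∀ x v, P < ‖v‖ → F v = 0 ∧ f t x v = 0) :
    ∃ C : ℝ, 0 ≤ C ∧ ∀ t ∈ Icc 0 T, ∀ x v, |F v - f t x v| ≤ C * R x ^ (-2 : ℝ) := by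
  obtain ⟨CF, hCF, hF'⟩ := hF.exists_norm_fderiv_le_const
  set L := P + CG * T
  set D := L * T
  have hL : 0 ≤ L := by positivity
  have hD : 0 ≤ D := by positivity
  refine ⟨C₀ * (1 + D) ^ 2 + CF * CG * (1 + D) ^ 2 * T, by positivity, fun t ht x v => ?_⟩
  have hR2 := R_rpow_pos x (-2)
  rcases lt_or_ge P ‖v‖ with hv | hv
  · rw [(hP t ht x v hv).1, (hP t ht x v hv).2, sub_zero, abs_zero]; positivity
  -- The maximum principle is one-sided, so it is applied to F - f and to f - F.
  have key : ∀ σ : ℝ, |σ| = 1 → σ * (F v - f t x v) ≤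
      (C₀ * (1 + D) ^ 2 + CF * CG * (1 + D) ^ 2 * T) * R x ^ (-2 : ℝ) := by
    intro σ hσ
    set u : ℝ × E3 × E3 → ℝ := fun z => σ * (F z.2.2 - uncurry3 f z)
    have huc : ContinuousOn u (Icc 0 T ×ˢ univ) :=
      continuousOn_const.mul (continuousOn_perturbation hf hF)
    refine le_Icc_of_le_Ioo (u := u) (z := (x, v)) hT huc (fun t ht => ?_) t ht
    have hder : ∀ z : ℝ × E3 × E3, z.1 ∈ Ioo 0 T → HasFDerivAt u _ z :=
      fun z hz => (hf.hasFDerivAt_perturbation hF hz).const_mul σ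
    have hnear : ∀ s, 0 ≤ s → ∀ y, ‖y - x‖ ≤ L * (t - s) → ‖y - x‖ ≤ D := by
      intro s hs y hy
      refine hy.trans ?_
      have := ht.2
      simp only [D]
      gcongr; linarith
    have h := le_of_transport_le (u := u) (G := fun t x => field F f t x + A t x) (x := x) (v := v)
      (B := CG) (L := L) (m := CF * CG * (1 + D) ^ 2 * R x ^ (-2 : ℝ))
      (c := C₀ * (1 + D) ^ 2 * R x ^ (-2 : ℝ)) ht huc
      (fun z hz => (hder z hz.1).differentiableAt) hCG ?_ ?_ ?_ ?_
    · refine h.trans ?_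
      have h1 : CF * CG * (1 + D) ^ 2 * R x ^ (-2 : ℝ) * t ≤
        CF * CG * (1 + D) ^ 2 * R x ^ (-2 : ℝ) * T := by have := ht.2; gcongr
      linarith
    · have : CG * t ≤ CG * T := by have := ht.2; gcongr
      simp only [L]; linarith
    · intro s hs y _
      refine (hG s ⟨hs.1.le, hs.2.trans ht.2.le⟩ y).trans ?_
      exact mul_le_of_le_one_right hCG (R_rpow_neg_le_one y (by norm_num))
    · intro s hs y w hy hw
      have hsI : s ∈ Ioo 0 T := ⟨hs.1, hs.2.trans_lt ht.2⟩
      rw [(hder (s, y, w) hsI).fderiv]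
      simp only [smul_apply, sub_apply, ContinuousLinearMap.comp_apply,
        ContinuousLinearMap.coe_snd', smul_eq_mul]
      -- Since f is transported, only the derivative of F along the force remains. It is of size
      -- R^{-2}, and R varies by a bounded factor over the cone, whose spatial radius is at most D.
      rw [hf.fderiv_transport hsI, sub_zero]
      refine (le_abs_self _).trans ?_
      rw [abs_mul, hσ, one_mul, map_neg, abs_neg, ← Real.norm_eq_abs]
      refine ((fderiv ℝ F w).le_opNorm _).trans ?_
      have h1 := hG s (Ioo_subset_Icc_self hsI) y
      have h2 := R_rpow_neg_two_le (hnear s hs.1.le y hy)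
      calc _ ≤ CF * (CG * ((1 + D) ^ 2 * R x ^ (-2 : ℝ))) := by
            gcongr
            · exact hF' w
            · exact h1.trans (by gcongr)
        _ = _ := by ring
    · intro y w hy _
      have h2 := R_rpow_neg_two_le (hnear 0 le_rfl y (by simpa using hy))
      simp only [u, uncurry3, hf.initial]
      refine (le_abs_self _).trans ?_
      rw [abs_mul, hσ, one_mul]
      calc _ ≤ C₀ * R y ^ (-6 : ℝ) := h₀ y w
        _ ≤ C₀ * R y ^ (-2 : ℝ) := by
            exact mul_le_mul_of_nonneg_left (R_rpow_neg_mono y (by norm_num)) hC₀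
        _ ≤ C₀ * ((1 + D) ^ 2 * R x ^ (-2 : ℝ)) := by gcongr
        _ = _ := by ring
  rw [abs_le']
  constructor
  · simpa using key 1 (by simp)
  · simpa using key (-1) (by simp)

end Solution

/-! ### The entropy associated with the background -/

/-- On the support, F is a strictly increasing function of τ = -|v|²/2 ∈ [-W²/2, 0]; q is the
inverse of this function after extending it to a homeomorphism of the line. Since |∇F| ≤ C|v|, the
extended function is Lipschitz in τ, so its inverse increases at rate at least κ. With this q, F is
a critical point of the entropy plus kinetic energy, and the functional is uniformly convex. -/
theorem BackgroundCond.exists_entropy {F : E3 → ℝ} (hF : BackgroundCond F) :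
    ∃ (q : ℝ → ℝ) (W κ : ℝ), Continuous q ∧ 0 < W ∧ 0 < κ ∧
      (∀ s r, s ≤ r → κ * (r - s) ≤ q r - q s) ∧
      (∀ v, ‖v‖ ≤ W → q (F v) = -(‖v‖ ^ 2 / 2)) ∧ ∀ v, W ≤ ‖v‖ → F v = 0 := by
  obtain ⟨C, hC, hC'⟩ := hF.exists_norm_fderiv_le
  obtain ⟨FR, hFR, -, W, hW, hder, hzero⟩ := hF.radial
  have hdiff : Differentiable ℝ F := hF.contDiff.differentiable (by norm_num)
  set e : E3 := EuclideanSpace.single 0 1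
  have he : ‖e‖ = 1 := by simp [e]
  have hFe : ∀ u : ℝ, 0 ≤ u → F (u • e) = FR u := fun u hu => by
    rw [hFR, norm_smul, he, mul_one, Real.norm_of_nonneg hu]
  have hanti : StrictAntiOn (fun u : ℝ => F (u • e)) (Icc 0 W) := by
    refine strictAntiOn_of_deriv_neg (convex_Icc 0 W) ?_ ?_
    · exact (hdiff.continuous.comp (by fun_prop)).continuousOn
    · intro u hu
      rw [interior_Icc] at hu
      have : (fun u : ℝ => F (u • e)) =ᶠ[𝓝 u] FR := by
        filter_upwards [Ioi_mem_nhds hu.1] with w hw using hFe w (le_of_lt hw)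
      rw [this.deriv_eq]
      exact hder u hu
  have hlip : ∀ a b : ℝ, 0 ≤ a → a ≤ b → |F (a • e) - F (b • e)| ≤ C * (b ^ 2 - a ^ 2) := by
    intro a b ha hab
    have := (convex_closedBall (0 : E3) b).norm_image_sub_le_of_norm_fderiv_le (𝕜 := ℝ) (f := F)
      (C := C * b) (x := b • e) (y := a • e) (fun x _ => hdiff x) (fun x hx => ?_) ?_ ?_
    · rw [Real.norm_eq_abs, ← sub_smul, norm_smul, he, mul_one, Real.norm_eq_abs,
        abs_of_nonpos (by linarith : a - b ≤ 0)] at this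
      refine this.trans ?_
      have : 0 ≤ C * a * (b - a) := by have := sub_nonneg.2 hab; positivity
      nlinarith
    · refine (hC' x).trans ?_
      gcongr
      simpa using hx
    · simp [norm_smul, he, abs_of_nonneg (ha.trans hab)]
    · simp [norm_smul, he, abs_of_nonneg ha, hab]
  -- The squared speed -2τ, clamped to [0, W²], so that `φ` below is defined for every τ.
  set w : ℝ → ℝ := fun τ => max 0 (min (-2 * τ) (W ^ 2)) with hw
  have hw0 : ∀ τ, 0 ≤ w τ := fun τ => le_max_left _ _
  have hwanti : ∀ τ σ, τ ≤ σ → w σ ≤ w τ := fun τ σ h => by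
    exact max_le_max le_rfl (min_le_min (by linarith) le_rfl)
  have hwlip : ∀ τ σ, τ ≤ σ → w τ - w σ ≤ 2 * (σ - τ) := by
    intro τ σ h
    simp only [hw]
    rcases max_cases 0 (min (-2 * τ) (W ^ 2)) with h1 | h1 <;>
    rcases max_cases 0 (min (-2 * σ) (W ^ 2)) with h2 | h2 <;>
    rcases min_cases (-2 * τ) (W ^ 2) with h3 | h3 <;>
    rcases min_cases (-2 * σ) (W ^ 2) with h4 | h4 <;> linarith
  have hwW : ∀ τ, √(w τ) ≤ W := fun τ => by
    rw [Real.sqrt_le_left hW.le]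
    exact max_le (by positivity) (min_le_right _ _)
  have hwmem : ∀ τ, √(w τ) ∈ Icc 0 W := fun τ => ⟨Real.sqrt_nonneg _, hwW τ⟩
  set φ : ℝ → ℝ := fun τ => F (√(w τ) • e) with hφ
  have hφmono : Monotone φ := fun τ σ h =>
    hanti.antitoneOn (hwmem σ) (hwmem τ) (Real.sqrt_le_sqrt (hwanti τ σ h))
  have hφlip : ∀ τ σ, τ ≤ σ → φ σ - φ τ ≤ 2 * C * (σ - τ) := by
    intro τ σ h
    have := hlip _ _ (Real.sqrt_nonneg (w σ)) (Real.sqrt_le_sqrt (hwanti τ σ h))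
    rw [Real.sq_sqrt (hw0 _), Real.sq_sqrt (hw0 _)] at this
    have h2 := hwlip τ σ h
    have h3 := le_abs_self (F (√(w σ) • e) - F (√(w τ) • e))
    have h4 := mul_le_mul_of_nonneg_left h2 hC
    simp only [hφ]; linarith
  -- The two added terms vanish on [-W²/2, 0] and have slope one outside. They make g strictly
  -- increasing and onto, and each raises the Lipschitz constant by at most 1.
  set g : ℝ → ℝ := fun τ => φ τ + max τ 0 + min (τ + W ^ 2 / 2) 0 with hg
  have hgmono : StrictMono g := by
    intro τ σ h
    have h1 := hφmono h.le
    have h2 : max τ 0 ≤ max σ 0 := max_le_max h.le le_rfl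
    have h3 : min (τ + W ^ 2 / 2) 0 ≤ min (σ + W ^ 2 / 2) 0 := min_le_min (by linarith) le_rfl
    by_cases hσ : 0 < σ
    · have : max τ 0 < max σ 0 := by
        rw [max_eq_left hσ.le]; exact max_lt h hσ
      simp only [hg]; linarith
    by_cases hτ : τ < -(W ^ 2 / 2)
    · have : min (τ + W ^ 2 / 2) 0 < min (σ + W ^ 2 / 2) 0 := by
        rw [min_eq_left (by linarith : τ + W ^ 2 / 2 ≤ 0)]
        exact lt_min (by linarith) (by linarith)
      simp only [hg]; linarith
    · have : w σ < w τ := by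
        simp only [hw]
        rw [min_eq_left (by linarith), min_eq_left (by linarith), max_eq_right (by linarith),
          max_eq_right (by linarith)]
        linarith
      have := hanti (hwmem σ) (hwmem τ) (Real.sqrt_lt_sqrt (hw0 _) this)
      simp only [hg, hφ] at *; linarith
  have hφcont : Continuous φ := by
    have : Continuous fun τ => √(w τ) • e := by fun_prop
    exact hdiff.continuous.comp this
  have hgcont : Continuous g := by fun_prop
  have hφ0 : ∀ τ, 0 ≤ φ τ := fun τ => hF.nonneg _
  have hgsurj : Function.Surjective g := by
    refine hgcont.surjective ?_ ?_
    · refine tendsto_atTop_mono' _ ?_ tendsto_id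
      filter_upwards [eventually_ge_atTop 0] with τ hτ
      have : min (τ + W ^ 2 / 2) 0 = 0 := min_eq_right (by positivity)
      simp only [hg, this, id]
      linarith [hφ0 τ, le_max_left τ 0]
    · refine tendsto_atBot_mono' _ ?_ (tendsto_atBot_add_const_left _ (φ 0 + W ^ 2 / 2) tendsto_id)
      filter_upwards [eventually_le_atBot 0] with τ hτ
      simp only [hg, id]
      rw [max_eq_right hτ]
      linarith [hφmono hτ, min_le_left (τ + W ^ 2 / 2) 0]
  set E : ℝ ≃o ℝ := hgmono.orderIsoOfSurjective g hgsurj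
  have hE : ∀ τ, E τ = g τ := fun τ => rfl
  have hq : ∀ τ, E.symm (g τ) = τ := fun τ => by rw [← hE, E.symm_apply_apply]
  have hglip : ∀ τ σ, τ ≤ σ → g σ - g τ ≤ (2 * C + 2) * (σ - τ) := by
    intro τ σ h
    have h1 := hφlip τ σ h
    have h2 : max σ 0 - max τ 0 ≤ σ - τ := by
      rcases max_cases σ 0 with h1 | h1 <;> rcases max_cases τ 0 with h2 | h2 <;> linarith
    have h3 : min (σ + W ^ 2 / 2) 0 - min (τ + W ^ 2 / 2) 0 ≤ σ - τ := by
      rcases min_cases (σ + W ^ 2 / 2) 0 with h1 | h1 <;>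
        rcases min_cases (τ + W ^ 2 / 2) 0 with h2 | h2 <;> linarith
    simp only [hg]; linarith
  refine ⟨E.symm, W, (2 * C + 2)⁻¹, E.symm.continuous, hW, by positivity, ?_, ?_, ?_⟩
  · intro s r h
    have := hglip _ _ (E.symm.monotone h)
    rw [← hE, ← hE, E.apply_symm_apply, E.apply_symm_apply] at this
    rw [inv_mul_le_iff₀ (by positivity)]
    exact this
  · intro v hv
    have h2 : ‖v‖ ^ 2 ≤ W ^ 2 := by gcongr
    have h3 : w (-(‖v‖ ^ 2 / 2)) = ‖v‖ ^ 2 := by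
      simp only [hw]
      rw [min_eq_left (by linarith), max_eq_right (by nlinarith [sq_nonneg ‖v‖])]; ring
    have h1 : g (-(‖v‖ ^ 2 / 2)) = F v := by
      simp only [hg, hφ]
      rw [h3, Real.sqrt_sq (norm_nonneg _), max_eq_right (by nlinarith [sq_nonneg ‖v‖]),
        min_eq_right (by linarith), hFe _ (norm_nonneg _), hFR]
      simp
    rw [← h1, hq]
  · intro v hv
    rw [hFR]; exact hzero _ hv

/-- The relative entropy density of the value `s` at velocity `v` with respect to `F`. -/
noncomputable def relEntropy (q : ℝ → ℝ) (F : E3 → ℝ) (s : ℝ) (v : E3) : ℝ :=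
  (∫ σ in (0 : ℝ)..s, q σ) - (∫ σ in (0 : ℝ)..F v, q σ) + ‖v‖ ^ 2 / 2 * (s - F v)

section Entropy

variable {F : E3 → ℝ} {q : ℝ → ℝ} {W κ : ℝ}

theorem relEntropy_eq (hq : Continuous q) (s : ℝ) (v : E3) :
    relEntropy q F s v = ∫ σ in (F v)..s, (q σ + ‖v‖ ^ 2 / 2) := by
  rw [intervalIntegral.integral_add (hq.intervalIntegrable _ _) (by simp),
    intervalIntegral.integral_const, relEntropy,
    intervalIntegral.integral_interval_sub_left (hq.intervalIntegrable _ _)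
      (hq.intervalIntegrable _ _), smul_eq_mul]
  ring

/-- The integrand q(σ) + |v|²/2 vanishes at σ = F v when |v| ≤ W and increases at rate at least κ;
integrating gives the quadratic lower bound. For |v| > W it is nonnegative at F v = 0, because q 0 =
-W²/2, and only s ≥ 0 occurs. -/
theorem sq_le_relEntropy (hq : Continuous q) (hW : 0 < W)
    (hmono : ∀ s r, s ≤ r → κ * (r - s) ≤ q r - q s)
    (hqF : ∀ v, ‖v‖ ≤ W → q (F v) = -(‖v‖ ^ 2 / 2)) (hFW : ∀ v, W ≤ ‖v‖ → F v = 0)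
    {s : ℝ} (hs : 0 ≤ s) (v : E3) : κ / 2 * (s - F v) ^ 2 ≤ relEntropy q F s v := by
  have hkey : ∫ σ in (F v)..s, κ * (σ - F v) = κ / 2 * (s - F v) ^ 2 := by
    rw [intervalIntegral.integral_const_mul, intervalIntegral.integral_sub (by simp) (by simp),
      integral_id, intervalIntegral.integral_const, smul_eq_mul]
    ring
  have hlow : -(‖v‖ ^ 2 / 2) ≤ q (F v) := by
    rcases le_total ‖v‖ W with h | h
    · rw [hqF v h]
    · have h1 : q (F (W • EuclideanSpace.single 0 1)) = -(W ^ 2 / 2) := by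
        rw [hqF _ (by simp [norm_smul, abs_of_pos hW])]; simp [norm_smul, abs_of_pos hW]
      rw [hFW _ (by simp [norm_smul, abs_of_pos hW])] at h1
      rw [hFW v h, h1]
      have : W ^ 2 ≤ ‖v‖ ^ 2 := by gcongr
      linarith
  rw [relEntropy_eq hq, ← hkey]
  rcases le_total (F v) s with h | h
  · refine intervalIntegral.integral_mono_on h (Continuous.intervalIntegrable (by fun_prop) _ _)
      (Continuous.intervalIntegrable (by fun_prop) _ _) fun σ hσ => ?_
    have := hmono _ _ hσ.1
    linarith
  -- Below F v the integrand must be nonpositive at F v. Outside the support this case degenerates: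
  -- F v = 0 and s ≥ 0 force s = F v.
  · have hup : q (F v) ≤ -(‖v‖ ^ 2 / 2) ∨ s = F v := by
      rcases le_total ‖v‖ W with h1 | h1
      · left; rw [hqF v h1]
      · right; rw [hFW v h1] at h ⊢; exact le_antisymm h hs
    rcases hup with hup | hup
    · rw [intervalIntegral.integral_symm, intervalIntegral.integral_symm s (F v), neg_le_neg_iff]
      refine intervalIntegral.integral_mono_on h (Continuous.intervalIntegrable (by fun_prop) _ _)
        (Continuous.intervalIntegrable (by fun_prop) _ _) fun σ hσ => ?_
      have := hmono _ _ hσ.2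
      linarith
    · rw [hup]; simp

/-- For |v| ≥ 2W the integrand is at least (|v|² - W²)/2, and W² ≤ |v|²/4 leaves 3/8 |v|². This
linear control handles fast particles, where the quadratic bound cannot be integrated over an
unbounded velocity range. -/
theorem mul_le_relEntropy (hq : Continuous q) (hW : 0 < W) (hκ : 0 < κ)
    (hmono : ∀ s r, s ≤ r → κ * (r - s) ≤ q r - q s)
    (hqF : ∀ v, ‖v‖ ≤ W → q (F v) = -(‖v‖ ^ 2 / 2)) (hFW : ∀ v, W ≤ ‖v‖ → F v = 0)
    {s : ℝ} (hs : 0 ≤ s) {v : E3} (hv : 2 * W ≤ ‖v‖) :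
    3 / 8 * ‖v‖ ^ 2 * s ≤ relEntropy q F s v := by
  have h0 : q 0 = -(W ^ 2 / 2) := by
    have h1 : q (F (W • EuclideanSpace.single 0 1)) = -(W ^ 2 / 2) := by
      rw [hqF _ (by simp [norm_smul, abs_of_pos hW])]; simp [norm_smul, abs_of_pos hW]
    rwa [hFW _ (by simp [norm_smul, abs_of_pos hW])] at h1
  have hconst : ∫ σ in (0 : ℝ)..s, 3 / 8 * ‖v‖ ^ 2 = 3 / 8 * ‖v‖ ^ 2 * s := by
    rw [intervalIntegral.integral_const, smul_eq_mul]; ring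
  rw [relEntropy_eq hq, hFW v (by linarith), ← hconst]
  refine intervalIntegral.integral_mono_on hs (by simp)
    (Continuous.intervalIntegrable (by fun_prop) _ _) fun σ hσ => ?_
  have h1 := hmono _ _ hσ.1
  have h2 : 0 ≤ κ * (σ - 0) := by have := hσ.1; simp; positivity
  nlinarith

theorem relEntropy_nonneg (hq : Continuous q) (hW : 0 < W) (hκ : 0 < κ)
    (hmono : ∀ s r, s ≤ r → κ * (r - s) ≤ q r - q s)
    (hqF : ∀ v, ‖v‖ ≤ W → q (F v) = -(‖v‖ ^ 2 / 2)) (hFW : ∀ v, W ≤ ‖v‖ → F v = 0)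
    {s : ℝ} (hs : 0 ≤ s) (v : E3) : 0 ≤ relEntropy q F s v :=
  le_trans (by positivity) (sq_le_relEntropy hq hW hmono hqF hFW hs v)

theorem exists_relEntropy_le (hq : Continuous q) (m P : ℝ) :
    ∃ C : ℝ, 0 ≤ C ∧ ∀ s v, s ∈ Icc 0 m → F v ∈ Icc 0 m → ‖v‖ ≤ P →
      relEntropy q F s v ≤ C * |s - F v| := by
  obtain ⟨C, hC⟩ := (isCompact_Icc (a := (0 : ℝ)) (b := m)).exists_bound_of_continuousOn
    hq.continuousOn
  refine ⟨max C 0 + P ^ 2 / 2, by positivity, fun s v hs hFv hv => ?_⟩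
  rw [relEntropy_eq hq]
  refine (le_abs_self _).trans ?_
  rw [← Real.norm_eq_abs]
  refine intervalIntegral.norm_integral_le_of_norm_le_const fun σ hσ => ?_
  have hσ' : σ ∈ Icc 0 m := by
    have := uIoc_subset_uIcc hσ
    exact (ordConnected_Icc.uIcc_subset hFv hs) this
  refine (norm_add_le _ _).trans ?_
  have h1 := (hC σ hσ').trans (le_max_left C 0)
  have h2 : ‖‖v‖ ^ 2 / 2‖ ≤ P ^ 2 / 2 := by
    rw [Real.norm_of_nonneg (by positivity)]; gcongr
  linarith

theorem hasDerivAt_primitive (hq : Continuous q) (s : ℝ) :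
    HasDerivAt (fun s => ∫ σ in (0 : ℝ)..s, q σ) (q s) s :=
  intervalIntegral.integral_hasDerivAt_right (hq.intervalIntegrable _ _)
    (hq.stronglyMeasurableAtFilter _ _) hq.continuousAt

theorem contDiff_primitive (hq : Continuous q) :
    ContDiff ℝ 1 (fun s => ∫ σ in (0 : ℝ)..s, q σ) := by
  rw [contDiff_one_iff_deriv]
  refine ⟨fun s => (hasDerivAt_primitive hq s).differentiableAt, ?_⟩
  rw [show deriv (fun s => ∫ σ in (0 : ℝ)..s, q σ) = q from
    funext fun s => (hasDerivAt_primitive hq s).deriv]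
  exact hq

end Entropy

/-! ### Differentiation of integrals with compact support -/

section Generic

variable {X : Type*} [NormedAddCommGroup X] [NormedSpace ℝ X]

theorem hasDerivAt_slice {Φ : ℝ × X → ℝ} {t : ℝ} {x : X} (h : DifferentiableAt ℝ Φ (t, x)) :
    HasDerivAt (fun s => Φ (s, x)) (fderiv ℝ Φ (t, x) (1, 0)) t := by
  have : HasDerivAt (fun s : ℝ => (s, x)) (1, 0) t := (hasDerivAt_id t).prodMk (hasDerivAt_const t x)
  exact HasFDerivAt.comp_hasDerivAt t h.hasFDerivAt this

theorem fderiv_slice {Φ : ℝ × X → ℝ} {t : ℝ} {x : X} (h : DifferentiableAt ℝ Φ (t, x)) (w : X) :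
    fderiv ℝ (fun y => Φ (t, y)) x w = fderiv ℝ Φ (t, x) (0, w) := by
  have : HasFDerivAt (fun y : X => (t, y)) ((0 : X →L[ℝ] ℝ).prod (ContinuousLinearMap.id ℝ X)) x :=
    (hasFDerivAt_const t x).prodMk (hasFDerivAt_id x)
  rw [show (fun y => Φ (t, y)) = Φ ∘ fun y : X => (t, y) from rfl,
    (HasFDerivAt.comp x h.hasFDerivAt this).fderiv]
  simp

theorem contDiff_slice {Φ : ℝ × X → ℝ} {a b t : ℝ} (hΦ : ContDiffOn ℝ 1 Φ (Ioo a b ×ˢ univ))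
    (ht : t ∈ Ioo a b) : ContDiff ℝ 1 fun x => Φ (t, x) := by
  have := hΦ.comp (s := univ) (f := fun z : X => (t, z))
    (contDiff_const.prodMk contDiff_id).contDiffOn (fun z _ => ⟨ht, mem_univ _⟩)
  exact contDiffOn_univ.1 this

theorem differentiableAt_of_contDiffOn {Φ : ℝ × X → ℝ} {a b t : ℝ}
    (hΦ : ContDiffOn ℝ 1 Φ (Ioo a b ×ˢ univ)) (ht : t ∈ Ioo a b) (x : X) :
    DifferentiableAt ℝ Φ (t, x) :=
  (hΦ.contDiffAt (prod_mem_nhds (Ioo_mem_nhds ht.1 ht.2) univ_mem)).differentiableAt (by norm_num)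

theorem continuousOn_fderiv_apply {Φ : ℝ × X → ℝ} {a b : ℝ}
    (hΦ : ContDiffOn ℝ 1 Φ (Ioo a b ×ˢ univ)) (w : ℝ × X) :
    ContinuousOn (fun z => fderiv ℝ Φ z w) (Ioo a b ×ˢ univ) :=
  (hΦ.continuousOn_fderiv_of_isOpen (isOpen_Ioo.prod isOpen_univ) (by norm_num)).clm_apply
    continuousOn_const

theorem continuous_fderiv_slice {Φ : ℝ × X → ℝ} {a b t : ℝ}
    (hΦ : ContDiffOn ℝ 1 Φ (Ioo a b ×ˢ univ)) (ht : t ∈ Ioo a b) :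
    Continuous fun x => fderiv ℝ Φ (t, x) (1, 0) := by
  rw [← continuousOn_univ]
  exact (continuousOn_fderiv_apply hΦ (1, 0)).comp (by fun_prop) fun x _ => ⟨ht, mem_univ _⟩

theorem fderiv_time_eq_zero {Φ : ℝ × X → ℝ} {a b t : ℝ} {S : Set X}
    (hΦ : ContDiffOn ℝ 1 Φ (Ioo a b ×ˢ univ)) (hsupp : ∀ t ∈ Ioo a b, ∀ x ∉ S, Φ (t, x) = 0)
    (ht : t ∈ Ioo a b) {x : X} (hx : x ∉ S) : fderiv ℝ Φ (t, x) (1, 0) = 0 := by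
  have h1 := hasDerivAt_slice (differentiableAt_of_contDiffOn hΦ ht x)
  have h2 : HasDerivAt (fun s => Φ (s, x)) 0 t := by
    refine (hasDerivAt_const t (0 : ℝ)).congr_of_eventuallyEq ?_
    filter_upwards [Ioo_mem_nhds ht.1 ht.2] with s hs using hsupp s hs x hx
  exact h1.unique h2

variable [MeasurableSpace X] [BorelSpace X]

theorem hasDerivAt_integral_of_compact [SecondCountableTopology X] {μ : Measure X} [IsFiniteMeasureOnCompacts μ]
    {Φ : ℝ × X → ℝ} {a b t : ℝ} {S : Set X} (hS : IsCompact S)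
    (hΦ : ContDiffOn ℝ 1 Φ (Ioo a b ×ˢ univ)) (hsupp : ∀ t ∈ Ioo a b, ∀ x ∉ S, Φ (t, x) = 0)
    (ht : t ∈ Ioo a b) :
    HasDerivAt (fun t => ∫ x, Φ (t, x) ∂μ) (∫ x, fderiv ℝ Φ (t, x) (1, 0) ∂μ) t := by
  obtain ⟨η, hη, hsub⟩ := Metric.nhds_basis_closedBall.mem_iff.1 (Ioo_mem_nhds ht.1 ht.2)
  have hK : IsCompact (closedBall t η ×ˢ S) := (isCompact_closedBall t η).prod hS
  obtain ⟨C, hC⟩ := hK.exists_bound_of_continuousOn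
    ((continuousOn_fderiv_apply hΦ (1, 0)).mono (prod_mono hsub (subset_univ _)))
  refine (hasDerivAt_integral_of_dominated_loc_of_deriv_le (s := closedBall t η)
    (bound := S.indicator fun _ => C) (F' := fun s x => fderiv ℝ Φ (s, x) (1, 0))
    (closedBall_mem_nhds t hη) ?_ ?_ ?_ ?_ ?_ ?_).2
  · filter_upwards [Ioo_mem_nhds ht.1 ht.2] with s hs
    exact (contDiff_slice hΦ hs).continuous.aestronglyMeasurable
  · exact (contDiff_slice hΦ ht).continuous.integrable_of_hasCompactSupport
      (HasCompactSupport.intro hS (hsupp t ht))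
  · exact (continuous_fderiv_slice hΦ ht).aestronglyMeasurable
  · refine Eventually.of_forall fun x s hs => ?_
    by_cases hx : x ∈ S
    · rw [indicator_of_mem hx]; exact hC (s, x) ⟨hs, hx⟩
    · rw [fderiv_time_eq_zero hΦ hsupp (hsub hs) hx, indicator_of_notMem hx, norm_zero]
  · rw [integrable_indicator_iff hS.measurableSet]
    exact integrableOn_const hS.measure_lt_top.ne
  · exact Eventually.of_forall fun x s hs =>
      hasDerivAt_slice (differentiableAt_of_contDiffOn hΦ (hsub hs) x)

theorem integral_fderiv_eq_zero [FiniteDimensional ℝ X] {μ : Measure X} [μ.IsAddHaarMeasure]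
    {h : X → ℝ} (hh : ContDiff ℝ 1 h) (hc : HasCompactSupport h) (w : X) :
    ∫ x, fderiv ℝ h x w ∂μ = 0 := by
  have h1 : Integrable (fun x => fderiv ℝ h x w) μ :=
    ((hh.continuous_fderiv (by norm_num)).clm_apply continuous_const).integrable_of_hasCompactSupport
      (hc.fderiv_apply ℝ w)
  have h2 : Integrable h μ := hh.continuous.integrable_of_hasCompactSupport hc
  have := integral_mul_fderiv_eq_neg_fderiv_mul_of_integrable (μ := μ) (f := fun _ : X => (1 : ℝ))
    (g := h) (v := w) (by simp) (by simpa using h1) (by simpa using h2)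
    (fun x _ => differentiableAt_const _)
    (fun x _ => hh.differentiable (by norm_num) x)
  simpa using this

end Generic

/-! ### Transport of integrals over phase space -/

theorem integrable_fderiv_apply {h : E3 × E3 → ℝ} (hh : ContDiff ℝ 1 h) (hc : HasCompactSupport h)
    {b : E3 × E3 → E3 × E3} (hb : StronglyMeasurable b) (hbd : ∀ r, ∃ B, ∀ z, ‖z‖ ≤ r → ‖b z‖ ≤ B) :
    Integrable fun z => fderiv ℝ h z (b z) := by
  have hcont := hh.continuous_fderiv (by norm_num)
  obtain ⟨r, hr⟩ := (hc.fderiv ℝ).isCompact.isBounded.subset_closedBall 0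
  obtain ⟨B, hB⟩ := hbd r
  have h1 : Integrable fun z => fderiv ℝ h z :=
    hcont.integrable_of_hasCompactSupport (hc.fderiv ℝ)
  refine (h1.norm.mul_const B).mono' ?_ (Eventually.of_forall fun z => ?_)
  · exact (isBoundedBilinearMap_apply (𝕜 := ℝ) (E := E3 × E3) (F := ℝ)).continuous.comp_stronglyMeasurable
      (hcont.stronglyMeasurable.prodMk hb) |>.aestronglyMeasurable
  · by_cases hz : z ∈ tsupport (fderiv ℝ h)
    · refine ((fderiv ℝ h z).le_opNorm _).trans ?_
      have := hB z (by simpa using hr hz)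
      gcongr
    · rw [image_eq_zero_of_notMem_tsupport hz]; simp

theorem integrable_fderiv_velocity {h : E3 × E3 → ℝ} (hh : ContDiff ℝ 1 h)
    (hc : HasCompactSupport h) : Integrable fun z : E3 × E3 => fderiv ℝ h z (z.2, 0) := by
  refine integrable_fderiv_apply hh hc (b := fun z => (z.2, 0)) ?_ fun r => ⟨r, fun z hz => ?_⟩
  · exact (by fun_prop : Continuous fun z : E3 × E3 => (z.2, (0 : E3))).stronglyMeasurable
  · simp only [Prod.norm_def, norm_zero] at hz ⊢
    exact max_le ((le_max_right _ _).trans hz) ((norm_nonneg z.1).trans ((le_max_left _ _).trans hz))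

theorem integrable_fderiv_force {h : E3 × E3 → ℝ} (hh : ContDiff ℝ 1 h)
    (hc : HasCompactSupport h) {b : E3 → E3} (hb : StronglyMeasurable b) {B : ℝ}
    (hB : ∀ x, ‖b x‖ ≤ B) : Integrable fun z : E3 × E3 => fderiv ℝ h z (0, b z.1) := by
  refine integrable_fderiv_apply hh hc (b := fun z => (0, b z.1)) ?_ fun r => ⟨B, fun z _ => ?_⟩
  · exact stronglyMeasurable_const.prodMk (hb.comp_measurable measurable_fst)
  · simp only [Prod.norm_def, norm_zero]
    exact max_le ((norm_nonneg _).trans (hB 0)) (hB _)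

/-- For fixed v the direction of differentiation is constant in x, so the inner integral of a
compactly supported derivative vanishes. -/
theorem integral_fderiv_velocity {h : E3 × E3 → ℝ} (hh : ContDiff ℝ 1 h)
    (hc : HasCompactSupport h) : ∫ z : E3 × E3, fderiv ℝ h z (z.2, 0) = 0 := by
  have hi := integrable_fderiv_velocity hh hc
  rw [Measure.volume_eq_prod] at hi ⊢
  rw [integral_prod_symm _ hi]
  refine integral_eq_zero_of_ae (Eventually.of_forall fun v => ?_)
  have h1 : ContDiff ℝ 1 fun x => h (x, v) := hh.comp (contDiff_id.prodMk contDiff_const)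
  have h2 : HasCompactSupport fun x => h (x, v) :=
    HasCompactSupport.intro (hc.isCompact.image continuous_fst) fun x hx => by
      by_contra h0
      exact hx ⟨(x, v), subset_tsupport h h0, rfl⟩
  have h3 : ∀ x, fderiv ℝ (fun x => h (x, v)) x v = fderiv ℝ h (x, v) (v, 0) := fun x => by
    have : HasFDerivAt (fun y : E3 => (y, v)) ((ContinuousLinearMap.id ℝ E3).prod 0) x :=
      (hasFDerivAt_id x).prodMk (hasFDerivAt_const v x)
    rw [show (fun y => h (y, v)) = h ∘ fun y : E3 => (y, v) from rfl,
      (HasFDerivAt.comp x (hh.differentiable (by norm_num) _).hasFDerivAt this).fderiv]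
    simp
  have := integral_fderiv_eq_zero (μ := volume) h1 h2 v
  simpa only [h3, Pi.zero_apply] using this

/-- Integrating in v first, the force at fixed x is a constant direction. Hence b may be merely
measurable and bounded, and no regularity of the field is needed in the energy identity. -/
theorem integral_fderiv_force {h : E3 × E3 → ℝ} (hh : ContDiff ℝ 1 h)
    (hc : HasCompactSupport h) {b : E3 → E3} (hb : StronglyMeasurable b) {B : ℝ}
    (hB : ∀ x, ‖b x‖ ≤ B) : ∫ z : E3 × E3, fderiv ℝ h z (0, b z.1) = 0 := by
  have hi := integrable_fderiv_force hh hc hb hB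
  rw [Measure.volume_eq_prod] at hi ⊢
  rw [integral_prod _ hi]
  refine integral_eq_zero_of_ae (Eventually.of_forall fun x => ?_)
  have h1 : ContDiff ℝ 1 fun v => h (x, v) := hh.comp (contDiff_const.prodMk contDiff_id)
  have h2 : HasCompactSupport fun v => h (x, v) :=
    HasCompactSupport.intro (hc.isCompact.image continuous_snd) fun v hv => by
      by_contra h0
      exact hv ⟨(x, v), subset_tsupport h h0, rfl⟩
  have h3 : ∀ v, fderiv ℝ (fun v => h (x, v)) v (b x) = fderiv ℝ h (x, v) (0, b x) := fun v => by
    have : HasFDerivAt (fun y : E3 => (x, y)) ((0 : E3 →L[ℝ] E3).prod (ContinuousLinearMap.id ℝ E3))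
      v := (hasFDerivAt_const x v).prodMk (hasFDerivAt_id v)
    rw [show (fun y => h (x, y)) = h ∘ fun y : E3 => (x, y) from rfl,
      (HasFDerivAt.comp v (hh.differentiable (by norm_num) _).hasFDerivAt this).fderiv]
    simp
  have := integral_fderiv_eq_zero (μ := volume) h1 h2 (b x)
  simpa only [h3, Pi.zero_apply] using this

/-- The integral of a time derivative over phase space equals the integral of the derivative
along the characteristic directions. -/
theorem integral_time_deriv_eq {T t : ℝ} {Φ : ℝ × E3 × E3 → ℝ} {S : Set (E3 × E3)}
    (hS : IsCompact S) (hΦ : ContDiffOn ℝ 1 Φ (Ioo 0 T ×ˢ univ))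
    (hsupp : ∀ t ∈ Ioo 0 T, ∀ z ∉ S, Φ (t, z) = 0) (ht : t ∈ Ioo 0 T)
    {b : E3 → E3} (hb : StronglyMeasurable b) {B : ℝ} (hB : ∀ x, ‖b x‖ ≤ B) :
    Integrable (fun z : E3 × E3 => fderiv ℝ Φ (t, z) (1, z.2, -b z.1)) ∧
    ∫ z : E3 × E3, fderiv ℝ Φ (t, z) (1, 0) = ∫ z : E3 × E3, fderiv ℝ Φ (t, z) (1, z.2, -b z.1) := by
  have hs := contDiff_slice hΦ ht
  have hc : HasCompactSupport fun z => Φ (t, z) :=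
    HasCompactSupport.intro hS (hsupp t ht)
  have hsl : ∀ z w, fderiv ℝ (fun y => Φ (t, y)) z w = fderiv ℝ Φ (t, z) (0, w) := fun z w =>
    fderiv_slice (differentiableAt_of_contDiffOn hΦ ht z) w
  have i1 : Integrable fun z : E3 × E3 => fderiv ℝ Φ (t, z) (1, 0) :=
    (continuous_fderiv_slice hΦ ht).integrable_of_hasCompactSupport
      (HasCompactSupport.intro hS fun z hz => fderiv_time_eq_zero hΦ hsupp ht hz)
  have i2 := integrable_fderiv_velocity hs hc
  have i3 := integrable_fderiv_force hs hc hb.neg (B := B) (fun x => by simpa using hB x)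
  have e2 := integral_fderiv_velocity hs hc
  have e3 := integral_fderiv_force hs hc hb.neg (B := B) (fun x => by simpa using hB x)
  simp only [hsl, Pi.neg_apply] at i2 i3 e2 e3
  have hsum : (fun z : E3 × E3 => fderiv ℝ Φ (t, z) (1, z.2, -b z.1)) = fun z =>
      fderiv ℝ Φ (t, z) (1, 0) + fderiv ℝ Φ (t, z) (0, z.2, 0) +
        fderiv ℝ Φ (t, z) (0, 0, -b z.1) := by
    funext z
    rw [← map_add, ← map_add]; simp
  rw [hsum]
  refine ⟨(i1.add i2).add i3, ?_⟩
  have e12 : ∫ z : E3 × E3, (fderiv ℝ Φ (t, z) (1, 0) + fderiv ℝ Φ (t, z) (0, z.2, 0)) =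
      ∫ z : E3 × E3, fderiv ℝ Φ (t, z) (1, 0) := by rw [integral_add i1 i2, e2, add_zero]
  rw [← e12, integral_add (f := fun z : E3 × E3 => fderiv ℝ Φ (t, z) (1, 0) +
    fderiv ℝ Φ (t, z) (0, z.2, 0)) (i1.add i2) i3, e3, add_zero]

/-- Time derivative of a symmetric quadratic functional. -/
theorem hasDerivAt_quadratic {X : Type*} [NormedAddCommGroup X] [NormedSpace ℝ X]
    [MeasurableSpace X] [BorelSpace X] [SecondCountableTopology X] {μ : Measure X} [SFinite μ]
    [IsFiniteMeasureOnCompacts μ] {T t : ℝ} {Φ : ℝ × X → ℝ} {S : Set X} (hS : IsCompact S)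
    (hΦ : ContDiffOn ℝ 1 Φ (Ioo 0 T ×ˢ univ)) (hsupp : ∀ t ∈ Ioo 0 T, ∀ z ∉ S, Φ (t, z) = 0)
    (ht : t ∈ Ioo 0 T) {k : X × X → ℝ} (hk : ContDiff ℝ 1 k) (hsymm : ∀ z w, k (z, w) = k (w, z)) :
    HasDerivAt (fun t => ∫ z : X × X, Φ (t, z.1) * Φ (t, z.2) * k z ∂(μ.prod μ))
      (2 * ∫ z, fderiv ℝ Φ (t, z) (1, 0) * ∫ w, Φ (t, w) * k (z, w) ∂μ ∂μ) t := by
  set Ψ : ℝ × X × X → ℝ := fun p => Φ (p.1, p.2.1) * Φ (p.1, p.2.2) * k p.2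
  have hΨ : ContDiffOn ℝ 1 Ψ (Ioo 0 T ×ˢ univ) := by
    refine ((hΦ.comp (f := fun p : ℝ × X × X => (p.1, p.2.1)) (by fun_prop)
      fun p hp => ⟨hp.1, mem_univ _⟩).mul (hΦ.comp (f := fun p : ℝ × X × X => (p.1, p.2.2))
      (by fun_prop) fun p hp => ⟨hp.1, mem_univ _⟩)).mul (by fun_prop)
  have hΨs : ∀ t ∈ Ioo 0 T, ∀ z ∉ S ×ˢ S, Ψ (t, z) = 0 := by
    intro t ht z hz
    by_cases h1 : z.1 ∈ S
    · have h2 : z.2 ∉ S := fun h2 => hz ⟨h1, h2⟩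
      simp [Ψ, hsupp t ht _ h2]
    · simp [Ψ, hsupp t ht _ h1]
  have h := hasDerivAt_integral_of_compact (μ := μ.prod μ) (hS.prod hS) hΨ hΨs ht
  refine h.congr_deriv ?_
  have hd : ∀ z : X × X, fderiv ℝ Ψ (t, z) (1, 0) =
      fderiv ℝ Φ (t, z.1) (1, 0) * (Φ (t, z.2) * k z) +
        fderiv ℝ Φ (t, z.2) (1, 0) * (Φ (t, z.1) * k z) := by
    intro z
    have h1 := hasDerivAt_slice (differentiableAt_of_contDiffOn hΨ ht z)
    have h2 := (((hasDerivAt_slice (differentiableAt_of_contDiffOn hΦ ht z.1)).mul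
      (hasDerivAt_slice (differentiableAt_of_contDiffOn hΦ ht z.2))).mul_const (k z))
    rw [h1.unique h2]; ring
  have hcd := continuous_fderiv_slice hΦ ht
  have hcΦ := (contDiff_slice hΦ ht).continuous
  have hzero : ∀ z ∉ S ×ˢ S, fderiv ℝ Φ (t, z.1) (1, 0) * (Φ (t, z.2) * k z) = 0 := by
    intro z hz
    by_cases h1 : z.1 ∈ S
    · have h2 : z.2 ∉ S := fun h2 => hz ⟨h1, h2⟩
      simp [hsupp t ht _ h2]
    · simp [fderiv_time_eq_zero hΦ hsupp ht h1]
  have i1 : Integrable (fun z : X × X => fderiv ℝ Φ (t, z.1) (1, 0) * (Φ (t, z.2) * k z))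
      (μ.prod μ) := by
    refine Continuous.integrable_of_hasCompactSupport ?_ (HasCompactSupport.intro (hS.prod hS) hzero)
    exact (hcd.comp continuous_fst).mul ((hcΦ.comp continuous_snd).mul hk.continuous)
  have hswap : (fun z : X × X => fderiv ℝ Φ (t, z.2) (1, 0) * (Φ (t, z.1) * k z)) =
      fun z => (fun z : X × X => fderiv ℝ Φ (t, z.1) (1, 0) * (Φ (t, z.2) * k z)) z.swap := by
    funext z; simp only [Prod.fst_swap, Prod.snd_swap]
    rw [show k z.swap = k z from hsymm _ _]
  have e1 : ∫ z : X × X, fderiv ℝ Φ (t, z.1) (1, 0) * (Φ (t, z.2) * k z) ∂(μ.prod μ) =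
      ∫ z, fderiv ℝ Φ (t, z) (1, 0) * ∫ w, Φ (t, w) * k (z, w) ∂μ ∂μ := by
    rw [integral_prod _ i1]
    simp only [integral_const_mul]
  simp only [hd]
  have e2 := integral_prod_swap (μ := μ) (ν := μ)
    (fun z : X × X => fderiv ℝ Φ (t, z.1) (1, 0) * (Φ (t, z.2) * k z))
  rw [integral_add i1 (by rw [hswap]; exact i1.swap), hswap, e2, e1]
  ring

/-! ### Softened Coulomb kernels -/

/-- The softened Coulomb potential `(|z|² + ε²)^{-1/2}`. -/
noncomputable def plummer (ε : ℝ) (z : E3) : ℝ := (‖z‖ ^ 2 + ε ^ 2) ^ (-(1 / 2) : ℝ)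

/-- The softened Coulomb field `z (|z|² + ε²)^{-3/2}`. -/
noncomputable def plummerField (ε : ℝ) (z : E3) : E3 := (‖z‖ ^ 2 + ε ^ 2) ^ (-(3 / 2) : ℝ) • z

section Kernel

variable {ε : ℝ}

theorem softened_pos (hε : 0 < ε) (z : E3) : 0 < ‖z‖ ^ 2 + ε ^ 2 := by positivity

theorem plummer_pos (hε : 0 < ε) (z : E3) : 0 < plummer ε z :=
  Real.rpow_pos_of_pos (softened_pos hε z) _

theorem contDiff_softened_rpow (hε : 0 < ε) (s : ℝ) {n : WithTop ℕ∞} :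
    ContDiff ℝ n fun z : E3 => (‖z‖ ^ 2 + ε ^ 2) ^ s :=
  ((contDiff_norm_sq ℝ).add contDiff_const).rpow_const_of_ne fun z => (softened_pos hε z).ne'

theorem contDiff_plummer (hε : 0 < ε) {n : WithTop ℕ∞} : ContDiff ℝ n (plummer ε) :=
  contDiff_softened_rpow hε _

theorem contDiff_plummerField (hε : 0 < ε) {n : WithTop ℕ∞} : ContDiff ℝ n (plummerField ε) :=
  (contDiff_softened_rpow hε _).smul contDiff_id

theorem hasFDerivAt_softened_rpow (hε : 0 < ε) (s : ℝ) (z : E3) :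
    HasFDerivAt (fun z : E3 => (‖z‖ ^ 2 + ε ^ 2) ^ s)
      ((s * (‖z‖ ^ 2 + ε ^ 2) ^ (s - 1)) • (2 • innerSL ℝ z)) z := by
  have h1 : HasFDerivAt (fun z : E3 => ‖z‖ ^ 2 + ε ^ 2) (2 • innerSL ℝ z) z :=
    (hasStrictFDerivAt_norm_sq z).hasFDerivAt.add_const _
  exact h1.rpow_const (Or.inl (softened_pos hε z).ne')

theorem fderiv_plummer (hε : 0 < ε) (z w : E3) :
    fderiv ℝ (plummer ε) z w = -inner ℝ (plummerField ε z) w := by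
  rw [show plummer ε = fun z : E3 => (‖z‖ ^ 2 + ε ^ 2) ^ (-(1 / 2) : ℝ) from rfl,
    (hasFDerivAt_softened_rpow hε _ z).fderiv, plummerField, real_inner_smul_left]
  simp only [smul_apply, innerSL_apply_apply, smul_eq_mul, nsmul_eq_mul]
  norm_num
  ring

theorem softened_rpow_neg_le (hε : 0 < ε) {s : ℝ} (hs : 0 ≤ s) (z : E3) :
    (‖z‖ ^ 2 + ε ^ 2) ^ (-s) ≤ ε ^ (-2 * s) := by
  have : (ε ^ 2 : ℝ) ^ (-s) = ε ^ (-2 * s) := by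
    rw [← Real.rpow_natCast, ← Real.rpow_mul hε.le]; congr 1; push_cast; ring
  rw [← this]
  exact Real.rpow_le_rpow_of_nonpos (by positivity) (by nlinarith [sq_nonneg ‖z‖]) (by linarith)

theorem softened_rpow_neg_le_norm {z : E3} (hz : z ≠ 0) {s : ℝ} (hs : 0 ≤ s) :
    (‖z‖ ^ 2 + ε ^ 2) ^ (-s) ≤ ‖z‖ ^ (-2 * s) := by
  have h0 : 0 < ‖z‖ := norm_pos_iff.2 hz
  have : (‖z‖ ^ 2 : ℝ) ^ (-s) = ‖z‖ ^ (-2 * s) := by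
    rw [← Real.rpow_natCast, ← Real.rpow_mul h0.le]; congr 1; push_cast; ring
  rw [← this]
  exact Real.rpow_le_rpow_of_nonpos (by positivity) (by nlinarith [sq_nonneg ε]) (by linarith)

theorem plummer_le_const (hε : 0 < ε) (z : E3) : plummer ε z ≤ ε ^ (-1 : ℝ) := by
  refine (softened_rpow_neg_le hε (by norm_num) z).trans_eq ?_
  norm_num

theorem plummer_le_norm {z : E3} (hz : z ≠ 0) : plummer ε z ≤ ‖z‖ ^ (-1 : ℝ) := by
  refine (softened_rpow_neg_le_norm hz (by norm_num)).trans_eq ?_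
  norm_num

theorem norm_le_softened_rpow (z : E3) : ‖z‖ ≤ (‖z‖ ^ 2 + ε ^ 2) ^ (1 / 2 : ℝ) := by
  rw [← Real.sqrt_eq_rpow]
  exact Real.le_sqrt_of_sq_le (by nlinarith [sq_nonneg ε])

theorem norm_plummerField_le_const (hε : 0 < ε) (z : E3) : ‖plummerField ε z‖ ≤ ε ^ (-2 : ℝ) := by
  have hs := softened_pos hε z
  rw [plummerField, norm_smul, Real.norm_of_nonneg (by positivity)]
  calc _ ≤ (‖z‖ ^ 2 + ε ^ 2) ^ (-(3 / 2) : ℝ) * (‖z‖ ^ 2 + ε ^ 2) ^ (1 / 2 : ℝ) := by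
        gcongr; exact norm_le_softened_rpow z
    _ = (‖z‖ ^ 2 + ε ^ 2) ^ (-1 : ℝ) := by rw [← Real.rpow_add hs]; norm_num
    _ ≤ _ := by simpa using softened_rpow_neg_le hε zero_le_one z

theorem norm_plummerField_le_norm (hε : 0 < ε) (z : E3) :
    ‖plummerField ε z‖ ≤ ‖z‖ ^ (-2 : ℝ) := by
  rcases eq_or_ne z 0 with rfl | hz
  · simp [plummerField]
  have h0 : 0 < ‖z‖ := norm_pos_iff.2 hz
  have hs := softened_pos hε z
  rw [plummerField, norm_smul, Real.norm_of_nonneg (by positivity)]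
  calc _ ≤ ‖z‖ ^ (-2 * (3 / 2) : ℝ) * ‖z‖ := by
        gcongr; exact softened_rpow_neg_le_norm hz (by norm_num)
    _ = ‖z‖ ^ (-2 * (3 / 2) : ℝ) * ‖z‖ ^ (1 : ℝ) := by rw [Real.rpow_one]
    _ = _ := by rw [← Real.rpow_add h0]; norm_num

theorem norm_fderiv_plummer_le (hε : 0 < ε) (z : E3) : ‖fderiv ℝ (plummer ε) z‖ ≤ ε ^ (-2 : ℝ) := by
  refine ContinuousLinearMap.opNorm_le_bound _ (by positivity) fun w => ?_
  rw [fderiv_plummer hε, norm_neg]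
  refine (norm_inner_le_norm _ _).trans ?_
  gcongr
  exact norm_plummerField_le_const hε z

theorem norm_fderiv_plummerField_le (hε : 0 < ε) (z : E3) :
    ‖fderiv ℝ (plummerField ε) z‖ ≤ 4 * (‖z‖ ^ 2 + ε ^ 2) ^ (-(3 / 2) : ℝ) := by
  have hs := softened_pos hε z
  have h := (hasFDerivAt_softened_rpow hε (-(3 / 2)) z).fun_smul (hasFDerivAt_id z)
  rw [show plummerField ε = fun z : E3 => (‖z‖ ^ 2 + ε ^ 2) ^ (-(3 / 2) : ℝ) • id z from rfl, h.fderiv]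
  refine ContinuousLinearMap.opNorm_le_bound _ (by positivity) fun w => ?_
  simp only [add_apply, smul_apply, ContinuousLinearMap.coe_id', id,
    ContinuousLinearMap.smulRight_apply, innerSL_apply_apply, smul_eq_mul, nsmul_eq_mul]
  refine (norm_add_le _ _).trans ?_
  rw [norm_smul, norm_smul, Real.norm_of_nonneg (by positivity)]
  -- The factor 4 is 3 + 1: differentiating the power gives 3 once |z|² is absorbed into |z|² + ε²,
  -- and differentiating z gives 1.
  have h1 : ‖-(3 / 2) * (‖z‖ ^ 2 + ε ^ 2) ^ (-(3 / 2) - 1 : ℝ) * (((2 : ℕ) : ℝ) * inner ℝ z w)‖ * ‖z‖ ≤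
      3 * (‖z‖ ^ 2 + ε ^ 2) ^ (-(3 / 2) : ℝ) * ‖w‖ := by
    rw [norm_mul, norm_mul, norm_mul, Real.norm_of_nonneg (by positivity : (0 : ℝ) ≤ (_ : ℝ) ^ (_ : ℝ))]
    have h2 : ‖inner ℝ z w‖ ≤ ‖z‖ * ‖w‖ := norm_inner_le_norm z w
    have h3 : (‖z‖ ^ 2 + ε ^ 2) ^ (-(3 / 2) - 1 : ℝ) * ‖z‖ ^ 2 ≤
        (‖z‖ ^ 2 + ε ^ 2) ^ (-(3 / 2) : ℝ) := by
      calc _ ≤ (‖z‖ ^ 2 + ε ^ 2) ^ (-(3 / 2) - 1 : ℝ) * (‖z‖ ^ 2 + ε ^ 2) := by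
            gcongr; nlinarith [sq_nonneg ε]
        _ = _ := by
            rw [Real.rpow_sub hs, Real.rpow_one]; field_simp
    calc _ ≤ ‖(-(3 / 2) : ℝ)‖ * (‖z‖ ^ 2 + ε ^ 2) ^ (-(3 / 2) - 1 : ℝ) *
          (‖((2 : ℕ) : ℝ)‖ * (‖z‖ * ‖w‖)) * ‖z‖ := by gcongr
      _ = 3 * ((‖z‖ ^ 2 + ε ^ 2) ^ (-(3 / 2) - 1 : ℝ) * ‖z‖ ^ 2) * ‖w‖ := by norm_num; ring
      _ ≤ _ := by gcongr
  linarith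

theorem tendsto_plummerField (z : E3) :
    Tendsto (fun ε => plummerField ε z) (𝓝 0) (𝓝 ((1 / ‖z‖ ^ 3) • z)) := by
  rcases eq_or_ne z 0 with rfl | hz
  · simp [plummerField]
  have h0 : 0 < ‖z‖ := norm_pos_iff.2 hz
  have h1 : Tendsto (fun ε : ℝ => ‖z‖ ^ 2 + ε ^ 2) (𝓝 0) (𝓝 (‖z‖ ^ 2 + 0 ^ 2)) :=
    (by fun_prop : Continuous fun ε : ℝ => ‖z‖ ^ 2 + ε ^ 2).tendsto 0
  have h2 := (h1.rpow_const (p := -(3 / 2)) (Or.inl (by positivity))).smul_const z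
  have h3 : (‖z‖ ^ 2 + 0 ^ 2 : ℝ) ^ (-(3 / 2) : ℝ) = 1 / ‖z‖ ^ 3 := by
    rw [zero_pow two_ne_zero, add_zero, ← Real.rpow_natCast, ← Real.rpow_mul h0.le, one_div,
      ← Real.rpow_natCast, ← Real.rpow_neg h0.le]
    norm_num
  rw [h3] at h2
  exact h2

end Kernel

/-! ### Positive definiteness -/

/-- Fubini for a superposition of nonnegative kernels: because m ≥ 0, absolute integrability of the
mixed kernel is the joint integrability. It reduces positivity for the softened Coulomb kernel to
Gaussians, and for Gaussians to squares. -/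
theorem integral_mul_mixture {P S : Type*} [MeasurableSpace P] [MeasurableSpace S] {μ : Measure P}
    {ν : Measure S} [SFinite μ] [SFinite ν] {Ψ : P → ℝ} {m : P → S → ℝ}
    (hΨ : AEStronglyMeasurable Ψ μ) (hm : Measurable (Function.uncurry m)) (hm0 : ∀ p s, 0 ≤ m p s)
    (hmi : ∀ p, Integrable (m p) ν) (hi : Integrable (fun p => Ψ p * ∫ s, m p s ∂ν) μ) :
    ∫ p, Ψ p * ∫ s, m p s ∂ν ∂μ = ∫ s, ∫ p, Ψ p * m p s ∂μ ∂ν := by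
  have hI : Integrable (fun x : P × S => Ψ x.1 * m x.1 x.2) (μ.prod ν) := by
    have hmeas : AEStronglyMeasurable (fun x : P × S => Ψ x.1 * m x.1 x.2) (μ.prod ν) :=
      hΨ.comp_fst.mul hm.aestronglyMeasurable
    rw [integrable_prod_iff hmeas]
    refine ⟨Eventually.of_forall fun p => (hmi p).const_mul (Ψ p), hi.norm.congr
      (Eventually.of_forall fun p => ?_)⟩
    simp only [norm_mul, integral_const_mul]
    congr 1
    rw [Real.norm_of_nonneg (integral_nonneg (hm0 p))]
    exact integral_congr_ae (Eventually.of_forall fun s => (Real.norm_of_nonneg (hm0 p s)).symm)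
  simp only [← integral_const_mul]
  exact integral_integral_swap hI

section PosDef

variable {X : Type*} [MeasurableSpace X] {μ : Measure X} {Φ : X → ℝ} {π : X → E3}

/-- By the parallelogram law, the product of two Gaussians in y separates into a Gaussian of a - b
and one centred at the midpoint of a and b. -/
theorem gaussian_mixture {s : ℝ} (a b : E3) :
    ∫ y : E3, Real.exp (-(2 * s) * ‖a - y‖ ^ 2) * Real.exp (-(2 * s) * ‖b - y‖ ^ 2) =
      Real.exp (-s * ‖a - b‖ ^ 2) * ∫ y : E3, Real.exp (-(4 * s) * ‖y‖ ^ 2) := by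
  rw [← integral_sub_right_eq_self (fun y : E3 => Real.exp (-(4 * s) * ‖y‖ ^ 2))
    ((1 / 2 : ℝ) • (a + b)), ← integral_const_mul]
  congr 1; funext y
  rw [← Real.exp_add, ← Real.exp_add]
  congr 1
  have h := parallelogram_law_with_norm ℝ (a - y) (b - y)
  have h1 : a - y + (b - y) = (-2 : ℝ) • (y - (1 / 2 : ℝ) • (a + b)) := by module
  have h2 : a - y - (b - y) = a - b := by abel
  rw [h1, h2, norm_smul, Real.norm_eq_abs, show |(-2 : ℝ)| = 2 by norm_num] at h
  linear_combination (s : ℝ) * h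

theorem integrable_gaussian {s : ℝ} (hs : 0 < s) :
    Integrable fun y : E3 => Real.exp (-s * ‖y‖ ^ 2) := by
  have := GaussianFourier.integrable_cexp_neg_mul_sq_norm_add (V := E3) (b := s) (by simpa using hs) 0 0
  have h := this.re
  refine h.congr (Eventually.of_forall fun y => ?_)
  simp only [zero_mul, add_zero]
  rw [show (-(s : ℂ) * (‖y‖ : ℂ) ^ 2) = ((-s * ‖y‖ ^ 2 : ℝ) : ℂ) by push_cast; ring]
  exact Complex.exp_ofReal_re _

theorem integral_gaussian_pos {s : ℝ} (hs : 0 < s) : 0 < ∫ y : E3, Real.exp (-s * ‖y‖ ^ 2) := by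
  rw [integral_pos_iff_support_of_nonneg (fun y => (Real.exp_pos _).le) (integrable_gaussian hs)]
  have : (Function.support fun y : E3 => Real.exp (-s * ‖y‖ ^ 2)) = univ := by
    ext y; simp
  rw [this]; simp

theorem integrable_prod_mul_of_bounded (hΦ : Integrable Φ μ) {k : X × X → ℝ} (hk : Measurable k)
    {C : ℝ} (hC : ∀ z, |k z| ≤ C) :
    Integrable (fun z : X × X => Φ z.1 * Φ z.2 * k z) (μ.prod μ) :=
  (hΦ.mul_prod hΦ).mul_bdd hk.aestronglyMeasurable (Eventually.of_forall hC)

/-- After the mixture over y the double integral factors, so up to the positive constant I the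
energy is the integral over y of the squares (∫ Φ exp(-2s|π - y|²))². -/
theorem gaussian_energy_nonneg [SFinite μ] (hΦ : Integrable Φ μ) (hπ : Measurable π) {s : ℝ} (hs : 0 < s) :
    0 ≤ ∫ z : X × X, Φ z.1 * Φ z.2 * Real.exp (-s * ‖π z.1 - π z.2‖ ^ 2) ∂(μ.prod μ) := by
  set I := ∫ y : E3, Real.exp (-(4 * s) * ‖y‖ ^ 2)
  have hI : 0 < I := integral_gaussian_pos (by positivity)
  set m : X × X → E3 → ℝ := fun z y =>
    Real.exp (-(2 * s) * ‖π z.1 - y‖ ^ 2) * Real.exp (-(2 * s) * ‖π z.2 - y‖ ^ 2)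
  have hmix : ∀ z : X × X, ∫ y, m z y = Real.exp (-s * ‖π z.1 - π z.2‖ ^ 2) * I := fun z =>
    gaussian_mixture _ _
  have hbd : ∀ z : X × X, |Real.exp (-s * ‖π z.1 - π z.2‖ ^ 2)| ≤ 1 := fun z => by
    rw [abs_of_pos (Real.exp_pos _), Real.exp_le_one_iff]
    nlinarith [sq_nonneg ‖π z.1 - π z.2‖]
  have hmeas : Measurable fun z : X × X => Real.exp (-s * ‖π z.1 - π z.2‖ ^ 2) := by fun_prop
  have key := integral_mul_mixture (μ := μ.prod μ) (ν := (volume : Measure E3))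
    (Ψ := fun z : X × X => Φ z.1 * Φ z.2) (m := m) (hΦ.mul_prod hΦ).aestronglyMeasurable
    (by simp only [m, Function.uncurry_def]; fun_prop) (fun p y => by positivity) (fun p => ?_) ?_
  · simp only [hmix, ← mul_assoc] at key
    rw [integral_mul_const] at key
    have h2 : 0 ≤ ∫ y : E3, ∫ p : X × X, Φ p.1 * Φ p.2 * m p y ∂(μ.prod μ) := by
      refine integral_nonneg fun y => ?_
      have : ∀ p : X × X, Φ p.1 * Φ p.2 * m p y =
          (Φ p.1 * Real.exp (-(2 * s) * ‖π p.1 - y‖ ^ 2)) *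
            (Φ p.2 * Real.exp (-(2 * s) * ‖π p.2 - y‖ ^ 2)) := fun p => by simp only [m]; ring
      simp only [this]
      rw [integral_prod_mul (fun x => Φ x * Real.exp (-(2 * s) * ‖π x - y‖ ^ 2))
        (fun x => Φ x * Real.exp (-(2 * s) * ‖π x - y‖ ^ 2))]
      exact mul_self_nonneg _
    rw [← key] at h2
    exact nonneg_of_mul_nonneg_left h2 hI
  · have h1 : Integrable fun y : E3 => Real.exp (-(2 * s) * ‖π p.1 - y‖ ^ 2) :=
      (integrable_gaussian (by positivity : 0 < 2 * s)).comp_sub_left (π p.1)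
    refine h1.mul_bdd (c := 1) (by fun_prop) (Eventually.of_forall fun y => ?_)
    rw [Real.norm_of_nonneg (Real.exp_pos _).le, Real.exp_le_one_iff]
    nlinarith [sq_nonneg ‖π p.2 - y‖]
  · simp only [hmix, ← mul_assoc]
    exact (integrable_prod_mul_of_bounded hΦ hmeas hbd).mul_const I

/-- The softened Coulomb kernel is positive definite. -/
theorem plummer_energy_nonneg [SFinite μ] (hΦ : Integrable Φ μ) (hπ : Measurable π) {ε : ℝ} (hε : 0 < ε) :
    0 ≤ ∫ z : X × X, Φ z.1 * Φ z.2 * plummer ε (π z.1 - π z.2) ∂(μ.prod μ) := by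
  -- Gamma integral: r^{-1/2} Γ(1/2) = ∫₀^∞ s^{-1/2} e^{-rs} ds with r = |z|² + ε². The absolute
  -- value only matters for s < 0, where the mixture lemma also demands m ≥ 0.
  set m : X × X → ℝ → ℝ := fun z s =>
    |s ^ (-(1 / 2) : ℝ)| * Real.exp (-(‖π z.1 - π z.2‖ ^ 2 + ε ^ 2) * s)
  set ν : Measure ℝ := volume.restrict (Ioi 0)
  set Γ := Real.Gamma (1 / 2) with hΓdef
  have hΓ : 0 < Γ := Real.Gamma_pos_of_pos (by norm_num)
  have hmix : ∀ z : X × X, ∫ s, m z s ∂ν = plummer ε (π z.1 - π z.2) * Γ := fun z => by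
    have := Real.integral_rpow_mul_exp_neg_mul_Ioi (a := 1 / 2)
      (r := ‖π z.1 - π z.2‖ ^ 2 + ε ^ 2) (by norm_num) (softened_pos hε _)
    rw [plummer, hΓdef, Real.rpow_neg (softened_pos hε _).le,
      ← Real.inv_rpow (softened_pos hε _).le, ← one_div (‖π z.1 - π z.2‖ ^ 2 + ε ^ 2), ← this]
    refine setIntegral_congr_fun measurableSet_Ioi fun s hs => ?_
    have hs' : (0 : ℝ) < s := hs
    simp only [m]
    rw [abs_of_nonneg (by positivity), neg_mul]
    norm_num
  have hbd : ∀ z : X × X, |plummer ε (π z.1 - π z.2)| ≤ ε ^ (-1 : ℝ) := fun z => by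
    rw [abs_of_pos (plummer_pos hε _)]; exact plummer_le_const hε _
  have hmeas : Measurable fun z : X × X => plummer ε (π z.1 - π z.2) :=
    (contDiff_plummer hε (n := 0)).continuous.measurable.comp (by fun_prop)
  have key := integral_mul_mixture (μ := μ.prod μ) (ν := ν)
    (Ψ := fun z : X × X => Φ z.1 * Φ z.2) (m := m) (hΦ.mul_prod hΦ).aestronglyMeasurable
    (by simp only [m, Function.uncurry_def]; fun_prop) (fun p y => by positivity) (fun p => ?_) ?_
  · simp only [hmix, ← mul_assoc] at key
    rw [integral_mul_const] at key
    have h2 : 0 ≤ ∫ s, ∫ p : X × X, Φ p.1 * Φ p.2 * m p s ∂(μ.prod μ) ∂ν := by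
      refine setIntegral_nonneg measurableSet_Ioi fun s hs => ?_
      have hg := gaussian_energy_nonneg hΦ hπ hs
      have : ∀ p : X × X, Φ p.1 * Φ p.2 * m p s = (|s ^ (-(1 / 2) : ℝ)| * Real.exp (-ε ^ 2 * s)) *
            (Φ p.1 * Φ p.2 * Real.exp (-s * ‖π p.1 - π p.2‖ ^ 2)) := fun p => by
        simp only [m]
        rw [show -(‖π p.1 - π p.2‖ ^ 2 + ε ^ 2) * s =
          -ε ^ 2 * s + -s * ‖π p.1 - π p.2‖ ^ 2 by ring, Real.exp_add]
        ring
      simp only [this]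
      rw [integral_const_mul]
      positivity
    rw [← key] at h2
    exact nonneg_of_mul_nonneg_left h2 hΓ
  · have h := integrableOn_rpow_mul_exp_neg_mul_rpow (p := 1) (s := -(1 / 2))
      (b := ‖π p.1 - π p.2‖ ^ 2 + ε ^ 2) (by norm_num) one_pos (softened_pos hε _)
    refine IntegrableOn.congr_fun h (fun s hs => ?_) measurableSet_Ioi
    have hs' : (0 : ℝ) < s := hs
    simp only [m, Real.rpow_one]
    rw [abs_of_nonneg (by positivity)]
  · simp only [hmix, ← mul_assoc]
    exact (integrable_prod_mul_of_bounded hΦ hmeas hbd).mul_const Γ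

end PosDef

/-! ### Potentials of integrable densities -/

section Convolution

variable {X : Type*} [MeasurableSpace X] {μ : Measure X} {Φ : X → ℝ} {π : X → E3}
  {V : Type*} [NormedAddCommGroup V] [NormedSpace ℝ V] {k : E3 → V} {B C : ℝ}

theorem integrable_smul_kernel (hΦ : Integrable Φ μ) (hπ : Measurable π) (hk : Continuous k)
    (hB : ∀ z, ‖k z‖ ≤ B) (x : E3) : Integrable (fun w => Φ w • k (x - π w)) μ := by
  have hm : AEStronglyMeasurable (fun w => k (x - π w)) μ :=
    (hk.stronglyMeasurable.comp_measurable (measurable_const.sub hπ)).aestronglyMeasurable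
  refine (hΦ.norm.mul_const B).mono' (hΦ.aestronglyMeasurable.smul hm)
    (Eventually.of_forall fun w => ?_)
  rw [norm_smul]
  exact mul_le_mul_of_nonneg_left (hB _) (norm_nonneg _)

theorem hasFDerivAt_integral_kernel (hΦ : Integrable Φ μ) (hπ : Measurable π)
    (hk : ContDiff ℝ 1 k) (hB : ∀ z, ‖k z‖ ≤ B) (hC : ∀ z, ‖fderiv ℝ k z‖ ≤ C) (x : E3) :
    HasFDerivAt (fun x => ∫ w, Φ w • k (x - π w) ∂μ) (∫ w, Φ w • fderiv ℝ k (x - π w) ∂μ) x := by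
  refine hasFDerivAt_integral_of_dominated_of_fderiv_le (s := univ)
    (bound := fun w => ‖Φ w‖ * C) (F' := fun x w => Φ w • fderiv ℝ k (x - π w)) univ_mem ?_ ?_ ?_ ?_ ?_ ?_
  · exact Eventually.of_forall fun x =>
      (integrable_smul_kernel hΦ hπ hk.continuous hB x).aestronglyMeasurable
  · exact integrable_smul_kernel hΦ hπ hk.continuous hB x
  · exact (integrable_smul_kernel hΦ hπ (hk.continuous_fderiv (by norm_num)) hC x).aestronglyMeasurable
  · refine Eventually.of_forall fun w y _ => ?_
    rw [norm_smul]
    exact mul_le_mul_of_nonneg_left (hC _) (norm_nonneg _)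
  · exact hΦ.norm.mul_const C
  · refine Eventually.of_forall fun w y _ => ?_
    have h1 := (hk.differentiable (by norm_num) (y - π w)).hasFDerivAt
    have h2 : HasFDerivAt (fun y : E3 => y - π w) (ContinuousLinearMap.id ℝ E3) y :=
      (hasFDerivAt_id y).sub_const _
    have h3 := HasFDerivAt.comp y h1 h2
    rw [ContinuousLinearMap.comp_id] at h3
    exact h3.const_smul (Φ w)

theorem contDiff_integral_kernel (hΦ : Integrable Φ μ) (hπ : Measurable π)
    (hk : ContDiff ℝ 1 k) (hB : ∀ z, ‖k z‖ ≤ B) (hC : ∀ z, ‖fderiv ℝ k z‖ ≤ C) :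
    ContDiff ℝ 1 fun x => ∫ w, Φ w • k (x - π w) ∂μ := by
  have h := hasFDerivAt_integral_kernel hΦ hπ hk hB hC
  rw [contDiff_one_iff_fderiv]
  refine ⟨fun x => (h x).differentiableAt, ?_⟩
  rw [show fderiv ℝ (fun x => ∫ w, Φ w • k (x - π w) ∂μ) = _ from funext fun x => (h x).fderiv]
  have hkc := hk.continuous_fderiv (by norm_num)
  refine continuous_of_dominated (bound := fun w => ‖Φ w‖ * C)
    (fun x => (integrable_smul_kernel hΦ hπ hkc hC x).aestronglyMeasurable)
    (fun x => Eventually.of_forall fun w => ?_) (hΦ.norm.mul_const C)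
    (Eventually.of_forall fun w => by fun_prop)
  rw [norm_smul]
  exact mul_le_mul_of_nonneg_left (hC _) (norm_nonneg _)

end Convolution

/-! ### A space-time cutoff decreasing along admissible characteristics -/

/-- A cutoff at distance `1/δ`, decreasing along curves of speed at most `P`. -/
noncomputable def cutoff (δ P : ℝ) (z : ℝ × E3) : ℝ :=
  Real.smoothTransition (2 - δ * (R z.2 + P * z.1))

section Cutoff

variable {δ P : ℝ}

theorem contDiff_cutoff : ContDiff ℝ 1 (cutoff δ P) := by
  have h1 : ContDiff ℝ 1 fun z : ℝ × E3 => R z.2 := contDiff_R.comp contDiff_snd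
  have h2 : ContDiff ℝ 1 fun z : ℝ × E3 => 2 - δ * (R z.2 + P * z.1) := by fun_prop
  exact (Real.smoothTransition.contDiff (n := 1)).comp h2

theorem cutoff_nonneg (z : ℝ × E3) : 0 ≤ cutoff δ P z := Real.smoothTransition.nonneg _

theorem cutoff_le_one (z : ℝ × E3) : cutoff δ P z ≤ 1 := Real.smoothTransition.le_one _

theorem cutoff_eq_one {z : ℝ × E3} (h : δ * (R z.2 + P * z.1) ≤ 1) : cutoff δ P z = 1 :=
  Real.smoothTransition.one_of_one_le (by linarith)

theorem cutoff_eq_zero {z : ℝ × E3} (h : 2 ≤ δ * (R z.2 + P * z.1)) : cutoff δ P z = 0 :=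
  Real.smoothTransition.zero_of_nonpos (by linarith)

theorem cutoff_eq_zero_of_norm (hδ : 0 < δ) (hP : 0 ≤ P) {t : ℝ} (ht : 0 ≤ t) {x : E3}
    (hx : x ∉ closedBall (0 : E3) (2 / δ)) : cutoff δ P (t, x) = 0 := by
  apply cutoff_eq_zero
  have h1 : 2 / δ < ‖x‖ := by simpa using hx
  have h2 : 2 < δ * ‖x‖ := by rwa [div_lt_iff₀' hδ] at h1
  have h3 := norm_le_R x
  have h4 : δ * ‖x‖ ≤ δ * (R x + P * t) := by gcongr; nlinarith [mul_nonneg hP ht]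
  linarith

theorem deriv_smoothTransition_nonneg (s : ℝ) : 0 ≤ deriv Real.smoothTransition s :=
  Real.smoothTransition.monotone.deriv_nonneg

/-- The derivative is bounded and lives on s ≤ 2, so it may be traded for s^{-1/2}. With s of order
δR, the prefactor δ of the cutoff derivative becomes δ^{1/2} R^{-1/2}: the first factor tends to 0
and the second lifts R^{-2} R^{-1} to the integrable R^{-7/2}. -/
theorem exists_deriv_smoothTransition_le :
    ∃ C : ℝ, 0 ≤ C ∧ ∀ s, 0 < s → deriv Real.smoothTransition (2 - s) ≤ C * s ^ (-(1 / 2) : ℝ) := by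
  have hc : Continuous (deriv Real.smoothTransition) :=
    (Real.smoothTransition.contDiff (n := 1)).continuous_deriv (by norm_num)
  obtain ⟨C, hC⟩ := (isCompact_Icc (a := (0 : ℝ)) (b := 2)).exists_bound_of_continuousOn
    hc.continuousOn
  have hC0 : 0 ≤ C := (norm_nonneg _).trans (hC 0 (by simp))
  refine ⟨C * 2 ^ (1 / 2 : ℝ), by positivity, fun s hs => ?_⟩
  rcases lt_or_ge s 2 with h | h
  · have h1 := (le_abs_self _).trans (hC (2 - s) ⟨by linarith, by linarith⟩)
    have h2 : 1 ≤ 2 ^ (1 / 2 : ℝ) * s ^ (-(1 / 2) : ℝ) := by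
      rw [Real.rpow_neg hs.le, ← div_eq_mul_inv, ← Real.div_rpow (by norm_num) hs.le]
      exact Real.one_le_rpow (by rw [le_div_iff₀ hs]; linarith) (by norm_num)
    nlinarith
  · have : deriv Real.smoothTransition (2 - s) = 0 := by
      apply IsLocalMin.deriv_eq_zero
      refine Eventually.of_forall fun u => ?_
      rw [Real.smoothTransition.zero_of_nonpos (by linarith : 2 - s ≤ 0)]
      exact Real.smoothTransition.nonneg u
    rw [this]; positivity

theorem fderiv_cutoff (z : ℝ × E3) (τ : ℝ) (w : E3) : fderiv ℝ (cutoff δ P) z (τ, w) =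
    -(δ * (fderiv ℝ R z.2 w + P * τ)) *
      deriv Real.smoothTransition (2 - δ * (R z.2 + P * z.1)) := by
  have h1 : HasFDerivAt (fun z : ℝ × E3 => R z.2)
      ((fderiv ℝ R z.2).comp (ContinuousLinearMap.snd ℝ ℝ E3)) z :=
    HasFDerivAt.comp z ((contDiff_R (n := 1)).differentiable (by norm_num) z.2).hasFDerivAt
      (ContinuousLinearMap.snd ℝ ℝ E3).hasFDerivAt
  have h2 : HasFDerivAt (fun z : ℝ × E3 => P * z.1) (P • ContinuousLinearMap.fst ℝ ℝ E3) z :=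
    (ContinuousLinearMap.fst ℝ ℝ E3).hasFDerivAt.const_mul P
  have h3 := ((h1.add h2).const_mul δ).const_sub 2
  have h4 : HasDerivAt Real.smoothTransition
      (deriv Real.smoothTransition (2 - δ * (R z.2 + P * z.1))) (2 - δ * (R z.2 + P * z.1)) :=
    ((Real.smoothTransition.contDiff (n := 1)).differentiable (by norm_num) _).hasDerivAt
  have h5 := h4.comp_hasFDerivAt z h3
  have h6 : HasFDerivAt (cutoff δ P) _ z := h5
  rw [h6.fderiv]
  simp
  ring

theorem abs_fderiv_R_le (x v : E3) : |fderiv ℝ R x v| ≤ ‖v‖ := by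
  refine ((fderiv ℝ R x).le_opNorm v).trans ?_
  have := norm_fderiv_R_le x
  nlinarith [norm_nonneg v]

/-- The cutoff contracts at speed P, at least the particle speed, while R is 1-Lipschitz. Hence the
entropy flux produced by the cutoff has a sign and is discarded without any decay of the entropy. -/
theorem fderiv_cutoff_nonpos (hδ : 0 < δ) (z : ℝ × E3) {v : E3} (hv : ‖v‖ ≤ P) :
    fderiv ℝ (cutoff δ P) z (1, v) ≤ 0 := by
  rw [fderiv_cutoff]
  have h1 := (abs_le.1 (abs_fderiv_R_le z.2 v)).1
  have h2 := deriv_smoothTransition_nonneg (2 - δ * (R z.2 + P * z.1))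
  have h3 : 0 ≤ δ * (fderiv ℝ R z.2 v + P * 1) := mul_nonneg hδ.le (by linarith)
  nlinarith

theorem exists_abs_fderiv_cutoff_le : ∃ C : ℝ, 0 ≤ C ∧ ∀ δ P t : ℝ, 0 < δ → 0 ≤ P → 0 ≤ t →
    ∀ x v : E3, ‖v‖ ≤ P →
      |fderiv ℝ (cutoff δ P) (t, x) (1, v)| ≤ C * P * δ ^ (1 / 2 : ℝ) * R x ^ (-(1 / 2) : ℝ) := by
  obtain ⟨C, hC0, hC⟩ := exists_deriv_smoothTransition_le
  refine ⟨2 * C, by positivity, fun δ P t hδ hP ht x v hv => ?_⟩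
  have hR := R_pos x
  have hPt := mul_nonneg hP ht
  rw [fderiv_cutoff, abs_mul, abs_neg, abs_mul, abs_of_pos hδ,
    abs_of_nonneg (deriv_smoothTransition_nonneg _)]
  have h1 : |fderiv ℝ R x v + P * 1| ≤ 2 * P := by
    have := abs_fderiv_R_le x v
    refine (abs_add_le _ _).trans ?_
    rw [mul_one, abs_of_nonneg hP]; linarith
  have h2 := hC (δ * (R x + P * t)) (by positivity)
  have h3 : (δ * (R x + P * t)) ^ (-(1 / 2) : ℝ) ≤ δ ^ (-(1 / 2) : ℝ) * R x ^ (-(1 / 2) : ℝ) := by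
    rw [← Real.mul_rpow hδ.le hR.le]
    exact Real.rpow_le_rpow_of_nonpos (by positivity) (by gcongr; linarith) (by norm_num)
  have h4 : δ * δ ^ (-(1 / 2) : ℝ) = δ ^ (1 / 2 : ℝ) := by
    nth_rewrite 1 [← Real.rpow_one δ]
    rw [← Real.rpow_add hδ]; norm_num
  calc _ ≤ δ * (2 * P) * (C * (δ ^ (-(1 / 2) : ℝ) * R x ^ (-(1 / 2) : ℝ))) := by
        gcongr
        · exact deriv_smoothTransition_nonneg _
        · exact h2.trans (by gcongr)
    _ = 2 * C * P * (δ * δ ^ (-(1 / 2) : ℝ)) * R x ^ (-(1 / 2) : ℝ) := by ring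
    _ = _ := by rw [h4]

end Cutoff

/-! ### Quantitative bounds of a solution -/

/-- Qualitative decay and support properties of a solution, with constants depending on it. -/
structure SolutionBounds (T p : ℝ) (F : E3 → ℝ) (A : ℝ → E3 → E3) (f : ℝ → E3 → E3 → ℝ)
    (P K : ℝ) : Prop where
  P_pos : 0 < P
  K_nonneg : 0 ≤ K
  support : ∀ t ∈ Icc 0 T, ∀ x v, P < ‖v‖ → F v = 0 ∧ f t x v = 0
  decay : ∀ t ∈ Icc 0 T, ∀ x v, |F v - f t x v| ≤ K * R x ^ (-2 : ℝ)
  density : ∀ t ∈ Icc 0 T, ∀ x, |density F f t x| ≤ K * R x ^ (-p)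
  force : ∀ t ∈ Icc 0 T, ∀ x, ‖field F f t x + A t x‖ ≤ K * R x ^ (-2 : ℝ)

/-- The constants P and K depend on the solution through its bound in ‖·‖_p. They justify
integrations and limits and enter error terms that vanish as δ → 0, but not the final constant. -/
theorem IsSolution.exists_bounds {T p : ℝ} {F : E3 → ℝ} {f₀ : E3 → E3 → ℝ} {A : ℝ → E3 → E3}
    {f : ℝ → E3 → E3 → ℝ} (hf : IsSolution T F f₀ A f) (hp : 3 < p) (hT : 0 < T)
    (hF : BackgroundCond F) (hf₀ : InitialCond f₀) (hA : ExternalFieldCond p T A)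
    (hFf₀ : PerturbationCond F f₀)
    (hK : ∃ K : ℝ≥0, ∀ t ∈ Icc 0 T, weightedNorm p (density F f t) ≤ K) :
    ∃ P K : ℝ, SolutionBounds T p F A f P K := by
  obtain ⟨K, hK⟩ := hK
  obtain ⟨C₀, P₀, hC₀, hP₀, hdec, hsupp⟩ := exists_initial_bounds hF hf₀ hFf₀
  obtain ⟨CA, hCA, hA'⟩ := hA.exists_bound
  obtain ⟨CE, hCE, hE⟩ := exists_field_bound hp
  have hρ : ∀ t ∈ Icc 0 T, ∀ x, |density F f t x| ≤ K * R x ^ (-p) := fun t ht =>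
    abs_le_of_weightedNorm_le (hK t ht)
  have hG : ∀ t ∈ Icc 0 T, ∀ x, ‖field F f t x + A t x‖ ≤ (K * CE + CA) * R x ^ (-2 : ℝ) := by
    intro t ht x
    refine (norm_add_le _ _).trans ?_
    rw [add_mul]
    exact add_le_add (hE F f t K K.2 (hρ t ht) x) (hA' t ht.1 x)
  have hCG : 0 ≤ K * CE + CA := by positivity
  obtain ⟨P, hP, hPs⟩ := hf.exists_velocity_support hT hP₀ hsupp hCG fun t ht x =>
    (hG t ht x).trans (mul_le_of_le_one_right hCG (R_rpow_neg_le_one x (by norm_num)))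
  obtain ⟨C, hC, hg⟩ := hf.exists_perturbation_decay hT hF hC₀ hCG hP hdec hG hPs
  refine ⟨P, max (max (K : ℝ) (K * CE + CA)) C, hP, le_max_of_le_right hC, hPs, ?_, ?_, ?_⟩
  · exact fun t ht x v => (hg t ht x v).trans
      (mul_le_mul_of_nonneg_right (le_max_right _ _) (R_rpow_pos x _).le)
  · exact fun t ht x => (hρ t ht x).trans (mul_le_mul_of_nonneg_right
      ((le_max_left _ _).trans (le_max_left _ _)) (R_rpow_pos x _).le)
  · exact fun t ht x => (hG t ht x).trans (mul_le_mul_of_nonneg_right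
      ((le_max_right _ _).trans (le_max_left _ _)) (R_rpow_pos x _).le)

/-! ### Localized perturbation and entropy -/

/-- The perturbation `F - f`, localized in space. -/
noncomputable def localPerturbation (δ P : ℝ) (F : E3 → ℝ) (f : ℝ → E3 → E3 → ℝ)
    (z : ℝ × E3 × E3) : ℝ :=
  cutoff δ P (z.1, z.2.1) * (F z.2.2 - uncurry3 f z)

/-- The relative entropy density of `f`, localized in space. -/
noncomputable def localEntropy (δ P : ℝ) (q : ℝ → ℝ) (F : E3 → ℝ) (f : ℝ → E3 → E3 → ℝ)
    (z : ℝ × E3 × E3) : ℝ :=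
  cutoff δ P (z.1, z.2.1) * relEntropy q F (uncurry3 f z) z.2.2

/-- A compact set carrying the localized quantities. -/
def phaseBox (δ P : ℝ) : Set (E3 × E3) := closedBall 0 (2 / δ) ×ˢ closedBall 0 P

theorem isCompact_phaseBox (δ P : ℝ) : IsCompact (phaseBox δ P) :=
  (isCompact_closedBall _ _).prod (isCompact_closedBall _ _)

section Local

variable {T p P K δ t : ℝ} {F : E3 → ℝ} {f₀ : E3 → E3 → ℝ} {A : ℝ → E3 → E3}
  {f : ℝ → E3 → E3 → ℝ} {q : ℝ → ℝ} {W κ : ℝ}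

theorem IsSolution.contDiffOn_Ioo (hf : IsSolution T F f₀ A f) :
    ContDiffOn ℝ 1 (uncurry3 f) (Ioo 0 T ×ˢ univ) :=
  hf.contDiffOn.mono (prod_mono Ioo_subset_Icc_self subset_rfl)

theorem contDiff_background_comp (hF : BackgroundCond F) :
    ContDiff ℝ 1 fun z : ℝ × E3 × E3 => F z.2.2 :=
  (hF.contDiff.of_le (by norm_num)).comp (contDiff_snd.comp contDiff_snd)

theorem contDiff_cutoff_comp : ContDiff ℝ 1 fun z : ℝ × E3 × E3 => cutoff δ P (z.1, z.2.1) :=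
  contDiff_cutoff.comp (by fun_prop)

theorem continuousOn_localPerturbation (hf : IsSolution T F f₀ A f) (hF : BackgroundCond F) :
    ContinuousOn (localPerturbation δ P F f) (Icc 0 T ×ˢ univ) :=
  contDiff_cutoff_comp.continuous.continuousOn.mul (continuousOn_perturbation hf hF)

theorem contDiffOn_localPerturbation (hf : IsSolution T F f₀ A f) (hF : BackgroundCond F) :
    ContDiffOn ℝ 1 (localPerturbation δ P F f) (Ioo 0 T ×ˢ univ) :=
  contDiff_cutoff_comp.contDiffOn.mul
    ((contDiff_background_comp hF).contDiffOn.sub hf.contDiffOn_Ioo)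

theorem continuous_primitive (hq : Continuous q) :
    Continuous (fun s => ∫ σ in (0 : ℝ)..s, q σ) := (contDiff_primitive hq).continuous

theorem continuousOn_localEntropy (hf : IsSolution T F f₀ A f) (hF : BackgroundCond F)
    (hq : Continuous q) : ContinuousOn (localEntropy δ P q F f) (Icc 0 T ×ˢ univ) := by
  have h1 := (contDiff_background_comp hF).continuous
  refine contDiff_cutoff_comp.continuous.continuousOn.mul ((ContinuousOn.sub ?_ ?_).add
    (ContinuousOn.mul ?_ (hf.continuousOn.sub h1.continuousOn)))
  · exact (continuous_primitive hq).comp_continuousOn hf.continuousOn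
  · exact ((continuous_primitive hq).comp h1).continuousOn
  · fun_prop

theorem contDiffOn_localEntropy (hf : IsSolution T F f₀ A f) (hF : BackgroundCond F)
    (hq : Continuous q) : ContDiffOn ℝ 1 (localEntropy δ P q F f) (Ioo 0 T ×ˢ univ) := by
  have h1 := contDiff_background_comp hF
  have hv : ContDiff ℝ 1 fun z : ℝ × E3 × E3 => ‖z.2.2‖ ^ 2 / 2 :=
    (((contDiff_snd.comp contDiff_snd).norm_sq ℝ).div_const 2)
  refine contDiff_cutoff_comp.contDiffOn.mul ((ContDiffOn.sub ?_ ?_).add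
    (hv.contDiffOn.mul (hf.contDiffOn_Ioo.sub h1.contDiffOn)))
  · exact (contDiff_primitive hq).comp_contDiffOn hf.contDiffOn_Ioo
  · exact ((contDiff_primitive hq).comp h1).contDiffOn

theorem localPerturbation_eq_zero (hb : SolutionBounds T p F A f P K) (hδ : 0 < δ)
    (ht : t ∈ Icc 0 T) {z : E3 × E3} (hz : z ∉ phaseBox δ P) :
    localPerturbation δ P F f (t, z) = 0 := by
  rw [localPerturbation]
  by_cases hx : z.1 ∈ closedBall (0 : E3) (2 / δ)
  · have hv : P < ‖z.2‖ := by
      by_contra h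
      exact hz ⟨hx, by simpa using h⟩
    obtain ⟨h1, h2⟩ := hb.support t ht z.1 z.2 hv
    simp only [uncurry3, h1, h2]; simp
  · rw [cutoff_eq_zero_of_norm hδ hb.P_pos.le ht.1 hx, zero_mul]

theorem localEntropy_eq_zero (hb : SolutionBounds T p F A f P K) (hδ : 0 < δ)
    (ht : t ∈ Icc 0 T) {z : E3 × E3} (hz : z ∉ phaseBox δ P) :
    localEntropy δ P q F f (t, z) = 0 := by
  rw [localEntropy]
  by_cases hx : z.1 ∈ closedBall (0 : E3) (2 / δ)
  · have hv : P < ‖z.2‖ := by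
      by_contra h
      exact hz ⟨hx, by simpa using h⟩
    obtain ⟨h1, h2⟩ := hb.support t ht z.1 z.2 hv
    simp only [uncurry3, relEntropy, h1, h2]; simp
  · rw [cutoff_eq_zero_of_norm hδ hb.P_pos.le ht.1 hx, zero_mul]

theorem hasFDerivAt_cutoff_comp (z : ℝ × E3 × E3) :
    HasFDerivAt (fun z : ℝ × E3 × E3 => cutoff δ P (z.1, z.2.1))
      ((fderiv ℝ (cutoff δ P) (z.1, z.2.1)).comp
        ((ContinuousLinearMap.fst ℝ ℝ (E3 × E3)).prod
          ((ContinuousLinearMap.fst ℝ E3 E3).comp (ContinuousLinearMap.snd ℝ ℝ (E3 × E3))))) z := by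
  have h1 : HasFDerivAt (cutoff δ P) (fderiv ℝ (cutoff δ P) (z.1, z.2.1)) (z.1, z.2.1) :=
    (contDiff_cutoff.differentiable (by norm_num) _).hasFDerivAt
  have h2 : HasFDerivAt (fun z : ℝ × E3 × E3 => (z.1, z.2.1))
      ((ContinuousLinearMap.fst ℝ ℝ (E3 × E3)).prod
          ((ContinuousLinearMap.fst ℝ E3 E3).comp (ContinuousLinearMap.snd ℝ ℝ (E3 × E3)))) z :=
    ((ContinuousLinearMap.fst ℝ ℝ (E3 × E3)).prod
          ((ContinuousLinearMap.fst ℝ E3 E3).comp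
            (ContinuousLinearMap.snd ℝ ℝ (E3 × E3)))).hasFDerivAt
  exact HasFDerivAt.comp z h1 h2

/-- The first factor vanishes on the support of F, the second outside it. This removes from the
entropy identity every term containing ∇F. -/
theorem entropy_derivative_cancel (hqF : ∀ v, ‖v‖ ≤ W → q (F v) = -(‖v‖ ^ 2 / 2)) (hFW : ∀ v, W ≤ ‖v‖ → F v = 0) (v w : E3) :
    (q (F v) + ‖v‖ ^ 2 / 2) * fderiv ℝ F v w = 0 := by
  rcases le_or_gt ‖v‖ W with h | h
  · rw [hqF v h]; ring
  · have : F =ᶠ[𝓝 v] fun _ => 0 := by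
      filter_upwards [(isOpen_lt continuous_const continuous_norm).mem_nhds h] with u hu
      exact hFW u (le_of_lt hu)
    rw [this.fderiv_eq]; simp

/-- Transport identity for the relative entropy. -/
theorem fderiv_localEntropy (hf : IsSolution T F f₀ A f) (hF : BackgroundCond F)
    (hq : Continuous q)
    (hqF : ∀ v, ‖v‖ ≤ W → q (F v) = -(‖v‖ ^ 2 / 2)) (hFW : ∀ v, W ≤ ‖v‖ → F v = 0)
    (ht : t ∈ Ioo 0 T) (x v : E3) :
    fderiv ℝ (localEntropy δ P q F f) (t, x, v) (1, v, -(field F f t x + A t x)) =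
      fderiv ℝ (cutoff δ P) (t, x) (1, v) * relEntropy q F (f t x v) v +
        cutoff δ P (t, x) * ((F v - f t x v) * inner ℝ v (field F f t x + A t x)) := by
  set G := field F f t x + A t x
  set z : ℝ × E3 × E3 := (t, x, v)
  have hfd : HasFDerivAt (uncurry3 f) (fderiv ℝ (uncurry3 f) z) z :=
    ((hf.contDiffAt (z := z) ht).differentiableAt (by norm_num)).hasFDerivAt
  have hFv : HasFDerivAt F (fderiv ℝ F v) v := (hF.contDiff.differentiable (by norm_num) _).hasFDerivAt
  have hsnd : HasFDerivAt (fun z : ℝ × E3 × E3 => z.2.2) ((ContinuousLinearMap.snd ℝ E3 E3).comp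
        (ContinuousLinearMap.snd ℝ ℝ (E3 × E3))) z :=
    ((ContinuousLinearMap.snd ℝ E3 E3).comp (ContinuousLinearMap.snd ℝ ℝ (E3 × E3))).hasFDerivAt
  have hFz : HasFDerivAt (fun z : ℝ × E3 × E3 => F z.2.2) _ z := HasFDerivAt.comp z hFv hsnd
  have h1 := (hasDerivAt_primitive hq (uncurry3 f z)).comp_hasFDerivAt z hfd
  have h2 := (hasDerivAt_primitive hq (F v)).comp_hasFDerivAt z hFz
  have h3 : HasFDerivAt (fun z : ℝ × E3 × E3 => ‖z.2.2‖ ^ 2 / 2) _ z :=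
    (HasFDerivAt.comp z (hasStrictFDerivAt_norm_sq v).hasFDerivAt hsnd).mul_const (1 / 2 : ℝ)
      |>.congr_of_eventuallyEq (Eventually.of_forall fun y => by
        simp only [Function.comp_apply]; ring)
  have hent := (h1.sub h2).add (h3.mul (hfd.sub hFz))
  have hall : HasFDerivAt (localEntropy δ P q F f) _ z := (hasFDerivAt_cutoff_comp z).mul hent
  rw [hall.fderiv]
  have htr := hf.fderiv_transport ht x v
  have hcan := entropy_derivative_cancel (q := q) hqF hFW v (-G)
  simp only [add_apply, smul_apply, sub_apply, ContinuousLinearMap.comp_apply, smul_eq_mul,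
    ContinuousLinearMap.prod_apply, ContinuousLinearMap.coe_fst', ContinuousLinearMap.coe_snd',
    nsmul_eq_mul, innerSL_apply_apply, inner_neg_right, Pi.sub_apply]
  rw [htr]
  simp only [uncurry3, relEntropy, z] at hcan ⊢
  push_cast
  linear_combination (-cutoff δ P (t, x)) * hcan

/-- Transport identity for the perturbation tested against a function of position. -/
theorem fderiv_localPerturbation_mul (hf : IsSolution T F f₀ A f) (hF : BackgroundCond F)
    {ψ : E3 → ℝ} (hψ : ContDiff ℝ 1 ψ) (ht : t ∈ Ioo 0 T) (x v : E3) :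
    fderiv ℝ (fun z : ℝ × E3 × E3 => localPerturbation δ P F f z * ψ z.2.1) (t, x, v)
        (1, v, -(field F f t x + A t x)) =
      (F v - f t x v) * (fderiv ℝ (cutoff δ P) (t, x) (1, v) * ψ x +
        cutoff δ P (t, x) * fderiv ℝ ψ x v) -
        fderiv ℝ (fun z : E3 × E3 => cutoff δ P (t, z.1) * ψ z.1 * F z.2) (x, v)
          (0, field F f t x + A t x) := by
  set G := field F f t x + A t x
  set z : ℝ × E3 × E3 := (t, x, v)
  have hψx : HasFDerivAt ψ (fderiv ℝ ψ x) x := (hψ.differentiable (by norm_num) _).hasFDerivAt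
  have hFv : HasFDerivAt F (fderiv ℝ F v) v := (hF.contDiff.differentiable (by norm_num) _).hasFDerivAt
  have hψz : HasFDerivAt (fun z : ℝ × E3 × E3 => ψ z.2.1) _ z :=
    HasFDerivAt.comp z hψx ((ContinuousLinearMap.fst ℝ E3 E3).comp
      (ContinuousLinearMap.snd ℝ ℝ (E3 × E3))).hasFDerivAt
  have hall : HasFDerivAt (fun z : ℝ × E3 × E3 => localPerturbation δ P F f z * ψ z.2.1) _ z :=
    ((hasFDerivAt_cutoff_comp z).mul (hf.hasFDerivAt_perturbation hF (z := z) ht)).mul hψz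
  have hcc : HasFDerivAt (cutoff δ P) (fderiv ℝ (cutoff δ P) (t, x)) (t, x) :=
    (contDiff_cutoff.differentiable (by norm_num) _).hasFDerivAt
  have hc : HasFDerivAt (fun y : E3 => cutoff δ P (t, y)) _ x :=
    HasFDerivAt.comp (g := cutoff δ P) (f := fun y : E3 => (t, y)) x hcc
      ((hasFDerivAt_const t x).prodMk (hasFDerivAt_id x))
  have hw : HasFDerivAt (fun z : E3 × E3 => cutoff δ P (t, z.1) * ψ z.1 * F z.2) _ (x, v) :=
    (HasFDerivAt.comp (x, v) (hc.mul hψx) (ContinuousLinearMap.fst ℝ E3 E3).hasFDerivAt).mul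
      (HasFDerivAt.comp (x, v) hFv (ContinuousLinearMap.snd ℝ E3 E3).hasFDerivAt)
  rw [hall.fderiv, hw.fderiv]
  have htr := hf.fderiv_transport ht x v
  simp only [add_apply, smul_apply, sub_apply, ContinuousLinearMap.comp_apply, smul_eq_mul,
    ContinuousLinearMap.prod_apply, ContinuousLinearMap.coe_fst', ContinuousLinearMap.coe_snd',
    Pi.mul_apply, map_zero, map_neg]
  have h0 : fderiv ℝ (uncurry3 f) z (1, v, -G) = 0 := htr
  rw [h0]
  simp only [uncurry3, z]
  ring

end Local

/-! ### The localized energy -/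

/-- The softened potential generated by the localized perturbation. -/
noncomputable def localPotential (δ P ε : ℝ) (F : E3 → ℝ) (f : ℝ → E3 → E3 → ℝ) (t : ℝ) (x : E3) :
    ℝ := ∫ w : E3 × E3, localPerturbation δ P F f (t, w) • plummer ε (x - w.1)

/-- The softened field generated by the localized perturbation. -/
noncomputable def localField (δ P ε : ℝ) (F : E3 → ℝ) (f : ℝ → E3 → E3 → ℝ) (t : ℝ) (x : E3) :
    E3 := ∫ w : E3 × E3, localPerturbation δ P F f (t, w) • plummerField ε (x - w.1)

/-- Localized relative entropy plus softened interaction energy. -/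
noncomputable def localEnergy (δ P ε : ℝ) (q : ℝ → ℝ) (F : E3 → ℝ) (f : ℝ → E3 → E3 → ℝ) (t : ℝ) :
    ℝ := (∫ z : E3 × E3, localEntropy δ P q F f (t, z)) +
  1 / 2 * ∫ z : (E3 × E3) × (E3 × E3), localPerturbation δ P F f (t, z.1) *
    localPerturbation δ P F f (t, z.2) * plummer ε (z.1.1 - z.2.1)

/-- The integrand of the time derivative of the localized energy. -/
noncomputable def energyRate (δ P ε : ℝ) (q : ℝ → ℝ) (F : E3 → ℝ) (A : ℝ → E3 → E3)
    (f : ℝ → E3 → E3 → ℝ) (t : ℝ) (z : E3 × E3) : ℝ :=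
  fderiv ℝ (cutoff δ P) (t, z.1) (1, z.2) * relEntropy q F (f t z.1 z.2) z.2 +
    cutoff δ P (t, z.1) * ((F z.2 - f t z.1 z.2) *
      inner ℝ z.2 (field F f t z.1 + A t z.1 - localField δ P ε F f t z.1)) +
    (F z.2 - f t z.1 z.2) * (fderiv ℝ (cutoff δ P) (t, z.1) (1, z.2) *
      localPotential δ P ε F f t z.1)

theorem integral_add_add {X : Type*} [MeasurableSpace X] {μ : Measure X} {a b c : X → ℝ}
    (ha : Integrable a μ) (hb : Integrable b μ) (hc : Integrable c μ) :
    ∫ z, (a z + (b z + c z)) ∂μ = ∫ z, a z ∂μ + (∫ z, b z ∂μ + ∫ z, c z ∂μ) :=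
  (integral_add ha (hb.add hc)).trans (congrArg _ (integral_add hb hc))

section Energy

variable {T p P K δ ε t : ℝ} {F : E3 → ℝ} {f₀ : E3 → E3 → ℝ} {A : ℝ → E3 → E3}
  {f : ℝ → E3 → E3 → ℝ} {q : ℝ → ℝ} {W κ : ℝ}

theorem integrable_localPerturbation (hf : IsSolution T F f₀ A f) (hF : BackgroundCond F)
    (hb : SolutionBounds T p F A f P K) (hδ : 0 < δ) (ht : t ∈ Icc 0 T) :
    Integrable fun z : E3 × E3 => localPerturbation δ P F f (t, z) := by
  refine Continuous.integrable_of_hasCompactSupport ?_ (HasCompactSupport.intro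
    (isCompact_phaseBox δ P) fun z hz => localPerturbation_eq_zero hb hδ ht hz)
  rw [← continuousOn_univ]
  exact (continuousOn_localPerturbation hf hF).comp (by fun_prop) fun z _ => ⟨ht, mem_univ _⟩

theorem integrable_localEntropy (hf : IsSolution T F f₀ A f) (hF : BackgroundCond F)
    (hq : Continuous q) (hb : SolutionBounds T p F A f P K) (hδ : 0 < δ) (ht : t ∈ Icc 0 T) :
    Integrable fun z : E3 × E3 => localEntropy δ P q F f (t, z) := by
  refine Continuous.integrable_of_hasCompactSupport ?_ (HasCompactSupport.intro
    (isCompact_phaseBox δ P) fun z hz => localEntropy_eq_zero hb hδ ht hz)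
  rw [← continuousOn_univ]
  exact (continuousOn_localEntropy hf hF hq).comp (by fun_prop) fun z _ => ⟨ht, mem_univ _⟩

theorem contDiff_localPotential (hf : IsSolution T F f₀ A f) (hF : BackgroundCond F)
    (hb : SolutionBounds T p F A f P K) (hδ : 0 < δ) (hε : 0 < ε) (ht : t ∈ Icc 0 T) :
    ContDiff ℝ 1 (localPotential δ P ε F f t) :=
  contDiff_integral_kernel (integrable_localPerturbation hf hF hb hδ ht) measurable_fst
    (contDiff_plummer hε)
    (fun z => by rw [Real.norm_of_nonneg (plummer_pos hε z).le]; exact plummer_le_const hε z)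
    (norm_fderiv_plummer_le hε)

theorem fderiv_localPotential (hf : IsSolution T F f₀ A f) (hF : BackgroundCond F)
    (hb : SolutionBounds T p F A f P K) (hδ : 0 < δ) (hε : 0 < ε) (ht : t ∈ Icc 0 T) (x v : E3) :
    fderiv ℝ (localPotential δ P ε F f t) x v = -inner ℝ v (localField δ P ε F f t x) := by
  have hΦ := integrable_localPerturbation hf hF hb hδ ht
  have h : HasFDerivAt (localPotential δ P ε F f t) _ x :=
    hasFDerivAt_integral_kernel hΦ measurable_fst (contDiff_plummer hε)
    (fun z => by rw [Real.norm_of_nonneg (plummer_pos hε z).le]; exact plummer_le_const hε z)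
    (norm_fderiv_plummer_le hε) x
  have hi := integrable_smul_kernel hΦ measurable_fst
    ((contDiff_plummer hε (n := 1)).continuous_fderiv (by norm_num)) (norm_fderiv_plummer_le hε) x
  have hi2 := integrable_smul_kernel hΦ measurable_fst
    (contDiff_plummerField hε (n := 0)).continuous (norm_plummerField_le_const hε) x
  rw [h.fderiv, ContinuousLinearMap.integral_apply hi, localField, ← integral_inner hi2,
    ← integral_neg]
  refine integral_congr_ae (Eventually.of_forall fun w => ?_)
  simp only [smul_apply, fderiv_plummer hε, inner_smul_right, smul_eq_mul]
  rw [real_inner_comm]; ring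

theorem stronglyMeasurable_force (hf : IsSolution T F f₀ A f) (hF : BackgroundCond F)
    (hA : ExternalFieldCond p T A) (ht : t ∈ Icc 0 T) :
    StronglyMeasurable fun x => field F f t x + A t x := by
  refine (measurable_field hf hF ht).add (Continuous.stronglyMeasurable ?_)
  rw [← continuousOn_univ]
  exact hA.contDiffOn.continuousOn.comp (f := fun x => (t, x)) (by fun_prop)
    fun x _ => ⟨ht.1, mem_univ _⟩

theorem SolutionBounds.norm_force_le (hb : SolutionBounds T p F A f P K) (ht : t ∈ Icc 0 T)
    (x : E3) : ‖field F f t x + A t x‖ ≤ K :=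
  (hb.force t ht x).trans (mul_le_of_le_one_right hb.K_nonneg (R_rpow_neg_le_one x (by norm_num)))

/-- The entropy changes by the work (F - f) v·(E + A), the interaction energy by -(F - f)
v·(localized field). The self-field thus cancels up to the localization error, leaving the work of A
and the terms where the cutoff is differentiated. -/
theorem hasDerivAt_localEnergy (hf : IsSolution T F f₀ A f) (hF : BackgroundCond F)
    (hA : ExternalFieldCond p T A) (hq : Continuous q)
    (hqF : ∀ v, ‖v‖ ≤ W → q (F v) = -(‖v‖ ^ 2 / 2)) (hFW : ∀ v, W ≤ ‖v‖ → F v = 0)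
    (hb : SolutionBounds T p F A f P K) (hδ : 0 < δ) (hε : 0 < ε) (ht : t ∈ Ioo 0 T) :
    Integrable (energyRate δ P ε q F A f t) ∧
    HasDerivAt (localEnergy δ P ε q F f) (∫ z, energyRate δ P ε q F A f t z) t := by
  have htI := Ioo_subset_Icc_self ht
  have hG := stronglyMeasurable_force hf hF hA htI
  have hB := hb.norm_force_le htI
  have hbox := isCompact_phaseBox δ P
  have hsE : ∀ t ∈ Ioo 0 T, ∀ z ∉ phaseBox δ P, localEntropy δ P q F f (t, z) = 0 :=
    fun t ht z hz => localEntropy_eq_zero hb hδ (Ioo_subset_Icc_self ht) hz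
  have hsΦ : ∀ t ∈ Ioo 0 T, ∀ z ∉ phaseBox δ P, localPerturbation δ P F f (t, z) = 0 :=
    fun t ht z hz => localPerturbation_eq_zero hb hδ (Ioo_subset_Icc_self ht) hz
  have hcE := contDiffOn_localEntropy (δ := δ) (P := P) hf hF hq
  have hcΦ := contDiffOn_localPerturbation (δ := δ) (P := P) hf hF
  -- The potential is frozen at time t: by symmetry of the kernel, the derivative of the quadratic
  -- energy only tests ∂ₜ of the perturbation against it.
  set ψ := localPotential δ P ε F f t
  have hψ : ContDiff ℝ 1 ψ := contDiff_localPotential hf hF hb hδ hε htI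
  have hE := hasDerivAt_integral_of_compact (μ := (volume : Measure (E3 × E3))) hbox hcE hsE ht
  obtain ⟨iE, eE⟩ := integral_time_deriv_eq hbox hcE hsE ht hG hB
  have hk : ContDiff ℝ 1 fun z : (E3 × E3) × (E3 × E3) => plummer ε (z.1.1 - z.2.1) :=
    (contDiff_plummer hε).comp (by fun_prop)
  have hU := hasDerivAt_quadratic (μ := (volume : Measure (E3 × E3))) hbox hcΦ hsΦ ht hk
    (fun z w => by simp only [plummer, norm_sub_rev])
  have hcΨ : ContDiffOn ℝ 1 (fun z : ℝ × E3 × E3 => localPerturbation δ P F f z * ψ z.2.1)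
      (Ioo 0 T ×ˢ univ) := hcΦ.mul (hψ.comp (by fun_prop)).contDiffOn
  obtain ⟨iΨ, eΨ⟩ := integral_time_deriv_eq hbox hcΨ
    (fun t ht z hz => by simp only [hsΦ t ht z hz, zero_mul]) ht hG hB
  have hU' : ∫ z : E3 × E3, fderiv ℝ (localPerturbation δ P F f) (t, z) (1, 0) *
      (∫ w, localPerturbation δ P F f (t, w) * plummer ε (z.1 - w.1)) =
      ∫ z : E3 × E3, fderiv ℝ (fun z : ℝ × E3 × E3 => localPerturbation δ P F f z * ψ z.2.1)
        (t, z) (1, 0) := by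
    refine integral_congr_ae (Eventually.of_forall fun z => ?_)
    have h1 := hasDerivAt_slice (differentiableAt_of_contDiffOn hcΨ ht z)
    have h2 := (hasDerivAt_slice (differentiableAt_of_contDiffOn hcΦ ht z)).mul_const (ψ z.1)
    exact h2.unique h1
  have hbg : ContDiff ℝ 1 fun z : E3 × E3 => cutoff δ P (t, z.1) * ψ z.1 * F z.2 :=
    ((contDiff_cutoff.comp (by fun_prop)).mul (hψ.comp contDiff_fst)).mul
      ((hF.contDiff.of_le (by norm_num)).comp contDiff_snd)
  have hbgc : HasCompactSupport fun z : E3 × E3 => cutoff δ P (t, z.1) * ψ z.1 * F z.2 := by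
    refine HasCompactSupport.intro hbox fun z hz => ?_
    by_cases hx : z.1 ∈ closedBall (0 : E3) (2 / δ)
    · have hv : P < ‖z.2‖ := by
        by_contra h
        exact hz ⟨hx, by simpa using h⟩
      rw [(hb.support t htI z.1 z.2 hv).1, mul_zero]
    · rw [cutoff_eq_zero_of_norm hδ hb.P_pos.le htI.1 hx]; ring
  have iF := integrable_fderiv_force hbg hbgc hG hB
  have eF := integral_fderiv_force hbg hbgc hG hB
  -- The last summand is a pure velocity derivative. It restores the term by which F fails to be
  -- transported by the force, and its integral vanishes.
  have hrate : energyRate δ P ε q F A f t = fun z : E3 × E3 =>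
      fderiv ℝ (localEntropy δ P q F f) (t, z) (1, z.2, -(field F f t z.1 + A t z.1)) +
      (fderiv ℝ (fun z : ℝ × E3 × E3 => localPerturbation δ P F f z * ψ z.2.1) (t, z)
        (1, z.2, -(field F f t z.1 + A t z.1)) +
       fderiv ℝ (fun z : E3 × E3 => cutoff δ P (t, z.1) * ψ z.1 * F z.2) z
        (0, field F f t z.1 + A t z.1)) := by
    funext z
    rw [fderiv_localEntropy hf hF hq hqF hFW ht, fderiv_localPerturbation_mul hf hF hψ ht,
      fderiv_localPotential hf hF hb hδ hε htI, energyRate, inner_sub_right]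
    ring
  rw [hrate]
  refine ⟨iE.add (iΨ.add iF), ?_⟩
  rw [integral_add_add iE iΨ iF, ← eE, ← eΨ, eF, add_zero, ← hU']
  have h := hE.add (hU.const_mul (1 / 2))
  refine h.congr_deriv ?_
  simp only
  ring

theorem continuousOn_localEnergy (hf : IsSolution T F f₀ A f) (hF : BackgroundCond F)
    (hq : Continuous q) (hb : SolutionBounds T p F A f P K) (hδ : 0 < δ) (hε : 0 < ε) :
    ContinuousOn (localEnergy δ P ε q F f) (Icc 0 T) := by
  have hbox := isCompact_phaseBox δ P
  refine ContinuousOn.add ?_ (continuousOn_const.mul ?_)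
  · exact continuousOn_integral_of_compact_support (f := fun t z => localEntropy δ P q F f (t, z))
      hbox (continuousOn_localEntropy hf hF hq) fun t z ht hz => localEntropy_eq_zero hb hδ ht hz
  · have hc := continuousOn_localPerturbation (δ := δ) (P := P) hf hF
    refine continuousOn_integral_of_compact_support
      (f := fun t (z : (E3 × E3) × (E3 × E3)) => localPerturbation δ P F f (t, z.1) *
        localPerturbation δ P F f (t, z.2) * plummer ε (z.1.1 - z.2.1)) (hbox.prod hbox) ?_ ?_
    · refine ((hc.comp (f := fun p : ℝ × (E3 × E3) × (E3 × E3) => (p.1, p.2.1)) (by fun_prop)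
        fun p hp => ⟨hp.1, mem_univ _⟩).mul (hc.comp
        (f := fun p : ℝ × (E3 × E3) × (E3 × E3) => (p.1, p.2.2)) (by fun_prop)
        fun p hp => ⟨hp.1, mem_univ _⟩)).mul (Continuous.continuousOn ?_)
      exact (contDiff_plummer hε (n := 0)).continuous.comp (by fun_prop)
    · intro t z ht hz
      by_cases h1 : z.1 ∈ phaseBox δ P
      · have h2 : z.2 ∉ phaseBox δ P := fun h2 => hz ⟨h1, h2⟩
        rw [localPerturbation_eq_zero hb hδ ht h2]; ring
      · rw [localPerturbation_eq_zero hb hδ ht h1]; ring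

/-- Positive definiteness of the softened kernel allows the interaction energy to be dropped. -/
theorem integral_localEntropy_le (hf : IsSolution T F f₀ A f) (hF : BackgroundCond F)
    (hb : SolutionBounds T p F A f P K) (hδ : 0 < δ) (hε : 0 < ε) (ht : t ∈ Icc 0 T) :
    ∫ z : E3 × E3, localEntropy δ P q F f (t, z) ≤ localEnergy δ P ε q F f t := by
  have := plummer_energy_nonneg (integrable_localPerturbation hf hF hb hδ ht) measurable_fst hε
  rw [← Measure.volume_eq_prod] at this
  rw [localEnergy]; linarith

end Energy

/-! ### Convergence of the localized field -/

/-- Bound for the error made by localizing and softening the Coulomb kernel. -/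
noncomputable def defectKernel (δ Q : ℝ) (x y : E3) : ℝ :=
  if δ * (R y + Q) ≤ 1 then ‖(1 / ‖x - y‖ ^ 3) • (x - y) - plummerField δ (x - y)‖
  else 2 * ‖x - y‖ ^ (-2 : ℝ)

/-- The defect of the localized field of a density bounded by `R ^ (-p)`. -/
noncomputable def fieldDefect (p δ Q : ℝ) (x : E3) : ℝ :=
  ∫ y, R y ^ (-p) * defectKernel δ Q x y

section Defect

variable {p δ Q : ℝ}

theorem defectKernel_nonneg (x y : E3) : 0 ≤ defectKernel δ Q x y := by
  unfold defectKernel; split_ifs <;> positivity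

theorem defectKernel_le (hδ : 0 < δ) (x y : E3) :
    defectKernel δ Q x y ≤ 2 * ‖x - y‖ ^ (-2 : ℝ) := by
  unfold defectKernel
  split_ifs
  · refine (norm_sub_le _ _).trans ?_
    have h1 := norm_coulomb_le 1 (x - y)
    have h2 := norm_plummerField_le_norm hδ (x - y)
    rw [abs_one, one_mul] at h1
    linarith
  · exact le_rfl

theorem measurable_defectKernel (hδ : 0 < δ) :
    Measurable fun z : E3 × E3 => defectKernel δ Q z.1 z.2 := by
  have hR : Measurable fun z : E3 × E3 => R z.2 := continuous_R.measurable.comp measurable_snd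
  have hpf : Measurable fun z : E3 × E3 => plummerField δ (z.1 - z.2) :=
    (contDiff_plummerField hδ (n := 0)).continuous.measurable.comp (by fun_prop)
  refine Measurable.ite ?_ ?_ ?_
  · exact measurableSet_le (by fun_prop) (by fun_prop)
  · fun_prop
  · fun_prop

theorem tendsto_defectKernel (x y : E3) :
    Tendsto (fun δ => defectKernel δ Q x y) (𝓝 0) (𝓝 0) := by
  have h1 : Tendsto (fun δ : ℝ => ‖(1 / ‖x - y‖ ^ 3) • (x - y) - plummerField δ (x - y)‖) (𝓝 0)
      (𝓝 0) := by
    have := ((tendsto_plummerField (x - y)).const_sub ((1 / ‖x - y‖ ^ 3) • (x - y))).norm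
    simpa using this
  refine h1.congr' ?_
  have h2 : Tendsto (fun δ : ℝ => δ * (R y + Q)) (𝓝 0) (𝓝 (0 * (R y + Q))) :=
    tendsto_id.mul_const _
  rw [zero_mul] at h2
  filter_upwards [h2.eventually (Iic_mem_nhds one_pos)] with δ hδ
  rw [defectKernel, if_pos hδ]

/-- The Riesz bound turns the y-integral into a multiple of R(x)^{-2}, and R^{-4} is integrable on
ℝ³. This is the dominating function for the field defect. -/
theorem integrable_weighted_riesz (hp : 3 < p) : Integrable fun z : E3 × E3 =>
    R z.1 ^ (-2 : ℝ) * (R z.2 ^ (-p) * (2 * ‖z.1 - z.2‖ ^ (-2 : ℝ))) := by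
  obtain ⟨C, hC, h⟩ := exists_riesz_bound (b := 2) hp (by norm_num) (by norm_num)
  have hm : Measurable fun z : E3 × E3 =>
      R z.1 ^ (-2 : ℝ) * (R z.2 ^ (-p) * (2 * ‖z.1 - z.2‖ ^ (-2 : ℝ))) := by
    have h1 : Measurable R := continuous_R.measurable
    fun_prop
  have hx : ∀ x : E3, (fun y : E3 => R x ^ (-2 : ℝ) * (R y ^ (-p) * (2 * ‖x - y‖ ^ (-2 : ℝ)))) =
      fun y => (2 * R x ^ (-2 : ℝ)) * (R y ^ (-p) * ‖x - y‖ ^ (-2 : ℝ)) := fun x => by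
    funext y; ring
  rw [Measure.volume_eq_prod, integrable_prod_iff hm.aestronglyMeasurable]
  refine ⟨Eventually.of_forall fun x => ?_, ?_⟩
  · simp only [hx]; exact (h x).1.const_mul _
  · refine ((integrable_R_rpow (s := 4) (by norm_num)).const_mul (2 * C)).mono'
      hm.norm.aestronglyMeasurable.integral_prod_right' (Eventually.of_forall fun x => ?_)
    have h0 : ∀ y : E3, ‖R x ^ (-2 : ℝ) * (R y ^ (-p) * (2 * ‖x - y‖ ^ (-2 : ℝ)))‖ =
        (2 * R x ^ (-2 : ℝ)) * (R y ^ (-p) * ‖x - y‖ ^ (-2 : ℝ)) := fun y => by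
      have := R_rpow_pos x (-2); have := R_rpow_pos y (-p)
      rw [Real.norm_of_nonneg (by positivity)]; ring
    simp only [h0]
    have hRx := R_rpow_pos x (-2)
    rw [integral_const_mul, Real.norm_of_nonneg (mul_nonneg (by positivity)
      (integral_nonneg fun y => by have := R_rpow_pos y (-p); positivity))]
    calc _ ≤ 2 * R x ^ (-2 : ℝ) * (C * R x ^ (-2 : ℝ)) := by gcongr; exact (h x).2
      _ = 2 * C * (R x ^ (-2 : ℝ) * R x ^ (-2 : ℝ)) := by ring
      _ = _ := by rw [← Real.rpow_add (R_pos x)]; norm_num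

theorem integrable_weighted_defect (hp : 3 < p) (hδ : 0 < δ) : Integrable fun z : E3 × E3 =>
    R z.1 ^ (-2 : ℝ) * (R z.2 ^ (-p) * defectKernel δ Q z.1 z.2) := by
  refine (integrable_weighted_riesz hp).mono' ?_ (Eventually.of_forall fun z => ?_)
  · have h1 : Measurable R := continuous_R.measurable
    have h2 := measurable_defectKernel (Q := Q) hδ
    have : Measurable fun z : E3 × E3 =>
      R z.1 ^ (-2 : ℝ) * (R z.2 ^ (-p) * defectKernel δ Q z.1 z.2) := by fun_prop
    exact this.aestronglyMeasurable
  · have h1 := R_rpow_pos z.1 (-2); have h2 := R_rpow_pos z.2 (-p)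
    have h3 := defectKernel_nonneg (δ := δ) (Q := Q) z.1 z.2
    rw [Real.norm_of_nonneg (by positivity)]
    gcongr
    exact defectKernel_le hδ _ _

theorem integrable_fieldDefect (hp : 3 < p) (hδ : 0 < δ) :
    Integrable fun x : E3 => R x ^ (-2 : ℝ) * fieldDefect p δ Q x := by
  have := (integrable_weighted_defect (Q := Q) hp hδ).integral_prod_left
  simpa only [integral_const_mul, fieldDefect] using this

theorem integrable_defectKernel (hp : 3 < p) (hδ : 0 < δ) (x : E3) :
    Integrable fun y : E3 => R y ^ (-p) * defectKernel δ Q x y := by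
  obtain ⟨C, hC, h⟩ := exists_riesz_bound (b := 2) hp (by norm_num) (by norm_num)
  refine ((h x).1.const_mul 2).mono' ?_ (Eventually.of_forall fun y => ?_)
  · have h2 := (measurable_defectKernel (Q := Q) hδ).comp (measurable_prodMk_left (x := x))
    exact ((continuous_R_rpow (-p)).measurable.mul h2).aestronglyMeasurable
  · have h2 := R_rpow_pos y (-p)
    have h3 := defectKernel_nonneg (δ := δ) (Q := Q) x y
    rw [Real.norm_of_nonneg (by positivity)]
    have := mul_le_mul_of_nonneg_left (defectKernel_le (Q := Q) hδ x y) h2.le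
    linarith

theorem fieldDefect_nonneg (x : E3) : 0 ≤ fieldDefect p δ Q x :=
  integral_nonneg fun y => mul_nonneg (R_rpow_pos y _).le (defectKernel_nonneg x y)

/-- Dominated convergence is applied on pairs (x, y), where the defect kernel tends to 0 pointwise,
and Fubini returns to the iterated form. -/
theorem tendsto_integral_fieldDefect (hp : 3 < p) (Q : ℝ) :
    Tendsto (fun δ => ∫ x : E3, R x ^ (-2 : ℝ) * fieldDefect p δ Q x) (𝓝[>] 0) (𝓝 0) := by
  have h1 : Tendsto (fun δ => ∫ z : E3 × E3,
      R z.1 ^ (-2 : ℝ) * (R z.2 ^ (-p) * defectKernel δ Q z.1 z.2)) (𝓝[>] 0)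
      (𝓝 (∫ z : E3 × E3, 0)) := by
    refine tendsto_integral_filter_of_dominated_convergence _ ?_ ?_ (integrable_weighted_riesz hp) ?_
    · filter_upwards [self_mem_nhdsWithin] with δ hδ
      exact (integrable_weighted_defect hp hδ).aestronglyMeasurable
    · filter_upwards [self_mem_nhdsWithin] with δ hδ
      refine Eventually.of_forall fun z => ?_
      have h1 := R_rpow_pos z.1 (-2); have h2 := R_rpow_pos z.2 (-p)
      have h3 := defectKernel_nonneg (δ := δ) (Q := Q) z.1 z.2
      rw [Real.norm_of_nonneg (by positivity)]
      gcongr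
      exact defectKernel_le hδ _ _
    · refine Eventually.of_forall fun z => ?_
      have := (((tendsto_defectKernel (Q := Q) z.1 z.2).const_mul (R z.2 ^ (-p))).const_mul
        (R z.1 ^ (-2 : ℝ))).mono_left (nhdsWithin_le_nhds (s := Ioi 0))
      simpa using this
  rw [integral_zero] at h1
  refine h1.congr' ?_
  filter_upwards [self_mem_nhdsWithin] with δ hδ
  rw [Measure.volume_eq_prod, integral_prod _ (integrable_weighted_defect hp hδ)]
  simp only [integral_const_mul, fieldDefect]

end Defect

section Solution

variable {T p P K δ ε t : ℝ} {F : E3 → ℝ} {f₀ : E3 → E3 → ℝ} {A : ℝ → E3 → E3}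
  {f : ℝ → E3 → E3 → ℝ}

theorem integral_localPerturbation (x : E3) :
    ∫ v, localPerturbation δ P F f (t, x, v) = cutoff δ P (t, x) * density F f t x := by
  simp only [localPerturbation, integral_const_mul, density, uncurry3]

theorem integral_localPerturbation_smul {V : Type*} [NormedAddCommGroup V] [NormedSpace ℝ V]
    [CompleteSpace V] (hf : IsSolution T F f₀ A f) (hF : BackgroundCond F)
    (hb : SolutionBounds T p F A f P K) (hδ : 0 < δ) (ht : t ∈ Icc 0 T) {k : E3 → V}
    (hk : Continuous k) {B : ℝ} (hB : ∀ z, ‖k z‖ ≤ B) (x : E3) :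
    Integrable (fun y => (cutoff δ P (t, y) * density F f t y) • k (x - y)) ∧
    ∫ w : E3 × E3, localPerturbation δ P F f (t, w) • k (x - w.1) =
      ∫ y, (cutoff δ P (t, y) * density F f t y) • k (x - y) := by
  have hi := integrable_smul_kernel (integrable_localPerturbation hf hF hb hδ ht) measurable_fst
    hk hB x
  have h1 := hi.integral_prod_left
  have h2 := integral_prod _ hi
  simp only [integral_smul_const, integral_localPerturbation] at h1 h2
  exact ⟨h1, h2⟩

/-- Where δ(R y + P T) ≤ 1 the cutoff equals 1 at all times up to T, so only the softening error is
left. Elsewhere both kernels are bounded by |x - y|^{-2}, whence the factor 2 in `defectKernel`. -/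
theorem norm_field_sub_localField_le (hp : 3 < p) (hf : IsSolution T F f₀ A f)
    (hF : BackgroundCond F) (hb : SolutionBounds T p F A f P K) (hδ : 0 < δ) (ht : t ∈ Icc 0 T)
    (x : E3) :
    ‖field F f t x - localField δ P δ F f t x‖ ≤ K * fieldDefect p δ (P * T) x := by
  obtain ⟨hi, he⟩ := integral_localPerturbation_smul hf hF hb hδ ht
    (contDiff_plummerField hδ (n := 0)).continuous (norm_plummerField_le_const hδ) x
  rw [localField, he, field, ← integral_sub (hf.integrable_field t ht x) hi, fieldDefect,
    ← integral_const_mul]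
  refine norm_integral_le_of_norm_le ((integrable_defectKernel hp hδ x).const_mul K)
    (Eventually.of_forall fun y => ?_)
  have h1 : (density F f t y / ‖x - y‖ ^ 3) • (x - y) -
      (cutoff δ P (t, y) * density F f t y) • plummerField δ (x - y) =
      density F f t y • ((1 / ‖x - y‖ ^ 3) • (x - y) - cutoff δ P (t, y) • plummerField δ (x - y)) := by
    module
  have hρ := hb.density t ht y
  rw [h1, norm_smul, Real.norm_eq_abs, ← mul_assoc]
  refine mul_le_mul hρ ?_ (norm_nonneg _) ((abs_nonneg _).trans hρ)
  unfold defectKernel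
  split_ifs with h
  · have : cutoff δ P (t, y) = 1 := by
      apply cutoff_eq_one
      refine le_trans ?_ h
      have := ht.2; have := hb.P_pos
      simp only
      gcongr
    rw [this, one_smul]
  · refine (norm_sub_le _ _).trans ?_
    have h1 := norm_coulomb_le 1 (x - y)
    have h2 := norm_plummerField_le_norm hδ (x - y)
    rw [abs_one, one_mul] at h1
    rw [norm_smul (cutoff δ P (t, y)), Real.norm_of_nonneg (cutoff_nonneg _)]
    have h3 := cutoff_le_one (δ := δ) (P := P) (t, y)
    nlinarith [norm_nonneg (plummerField δ (x - y))]

/-- The density bound K' is kept separate from the constant K of the solution: at time 0 it is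
supplied by the data alone, at later times by K. -/
theorem exists_localPotential_bound (hp : 3 < p) : ∃ C : ℝ, 0 ≤ C ∧
    ∀ {T r P K K' δ ε t : ℝ} {F : E3 → ℝ} {f₀ : E3 → E3 → ℝ} {A : ℝ → E3 → E3}
      {f : ℝ → E3 → E3 → ℝ}, IsSolution T F f₀ A f → BackgroundCond F →
      SolutionBounds T r F A f P K → 0 < δ → 0 < ε → t ∈ Icc 0 T → 0 ≤ K' →
      (∀ x, |density F f t x| ≤ K' * R x ^ (-p)) → ∀ x,
      |localPotential δ P ε F f t x| ≤ K' * C * R x ^ (-1 : ℝ) := by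
  obtain ⟨C, hC, h⟩ := exists_riesz_bound (b := 1) hp (by norm_num) (by norm_num)
  refine ⟨C, hC, fun {T r P K K' δ ε t F f₀ A f} hf hF hb hδ hε ht hK hρ x => ?_⟩
  obtain ⟨-, he⟩ := integral_localPerturbation_smul hf hF hb hδ ht
    (contDiff_plummer hε (n := 0)).continuous
    (fun z => by rw [Real.norm_of_nonneg (plummer_pos hε z).le]; exact plummer_le_const hε z) x
  rw [localPotential, he]
  have h1 : ‖∫ y, (cutoff δ P (t, y) * density F f t y) • plummer ε (x - y)‖ ≤
      ∫ y, K' * (R y ^ (-p) * ‖x - y‖ ^ (-1 : ℝ)) := by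
    refine norm_integral_le_of_norm_le ((h x).1.const_mul K') ?_
    have hne : ∀ᵐ y : E3, y ≠ x := by
      simp [ae_iff]
    filter_upwards [hne] with y hy
    rw [norm_smul, norm_mul, Real.norm_of_nonneg (cutoff_nonneg _),
      Real.norm_of_nonneg (plummer_pos hε _).le, Real.norm_eq_abs, ← mul_assoc]
    have h3 : cutoff δ P (t, y) * |density F f t y| ≤ K' * R y ^ (-p) :=
      (mul_le_of_le_one_left (abs_nonneg _) (cutoff_le_one _)).trans (hρ y)
    exact mul_le_mul h3 (plummer_le_norm (sub_ne_zero.2 hy.symm)) (plummer_pos hε _).le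
      ((abs_nonneg _).trans (hρ y))
  rw [integral_const_mul] at h1
  calc _ ≤ _ := h1
    _ ≤ K' * (C * R x ^ (-1 : ℝ)) := by gcongr; exact (h x).2
    _ = _ := by ring

end Solution

/-! ### The energy inequality -/

/-- Indicator of a ball in velocity space. -/
noncomputable def ballInd (r : ℝ) : E3 → ℝ := (closedBall (0 : E3) r).indicator fun _ => 1

theorem ballInd_of_le {r : ℝ} {v : E3} (h : ‖v‖ ≤ r) : ballInd r v = 1 :=
  indicator_of_mem (by simpa using h) _

theorem ballInd_nonneg (r : ℝ) (v : E3) : 0 ≤ ballInd r v :=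
  indicator_nonneg (fun _ _ => zero_le_one) _

theorem integrable_ballInd (r : ℝ) : Integrable (ballInd r) :=
  (integrable_indicator_iff measurableSet_closedBall).2
    (integrableOn_const measure_closedBall_lt_top.ne)

section Rate

variable {T p P K δ ε t : ℝ} {F : E3 → ℝ} {f₀ : E3 → E3 → ℝ} {A : ℝ → E3 → E3}
  {f : ℝ → E3 → E3 → ℝ} {q : ℝ → ℝ} {W κ : ℝ}

/-- The work of the external field is controlled by the relative entropy. -/
theorem work_le_relEntropy (hq : Continuous q) (hW : 0 < W) (hκ : 0 < κ)
    (hmono : ∀ s r, s ≤ r → κ * (r - s) ≤ q r - q s)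
    (hqF : ∀ v, ‖v‖ ≤ W → q (F v) = -(‖v‖ ^ 2 / 2)) (hFW : ∀ v, W ≤ ‖v‖ → F v = 0)
    {CA α β : ℝ} (hα0 : 0 ≤ α) (hαβ : α ≤ CA * β) (hα : α ≤ CA) {s : ℝ} (hs : 0 ≤ s) (v : E3) :
    |F v - s| * ‖v‖ * α ≤ (2 * W / κ + 4 * CA / (3 * W)) * relEntropy q F s v +
      W * CA ^ 2 * β ^ 2 * ballInd (2 * W) v := by
  have hCA : 0 ≤ CA := hα0.trans hα
  have hnn := relEntropy_nonneg hq hW hκ hmono hqF hFW hs v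
  rcases le_or_gt ‖v‖ (2 * W) with h | h
  · rw [ballInd_of_le h, mul_one]
    have h1 := sq_le_relEntropy hq hW hmono hqF hFW hs v
    have h2 : (F v - s) ^ 2 ≤ 2 / κ * relEntropy q F s v := by
      rw [div_mul_eq_mul_div, le_div_iff₀ hκ]; nlinarith
    have h3 : |F v - s| * ‖v‖ * α ≤ |F v - s| * (2 * W) * α := by gcongr
    have h4 : |F v - s| * (2 * W) * α ≤ W * ((F v - s) ^ 2 + α ^ 2) := by
      have : 2 * |F v - s| * α ≤ (F v - s) ^ 2 + α ^ 2 := by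
        rw [← sq_abs (F v - s)]; nlinarith [sq_nonneg (|F v - s| - α)]
      nlinarith
    have h5 : α ^ 2 ≤ CA ^ 2 * β ^ 2 := by rw [← mul_pow]; gcongr
    have h6 : 0 ≤ 4 * CA / (3 * W) * relEntropy q F s v := by positivity
    have h7 : W * (F v - s) ^ 2 ≤ 2 * W / κ * relEntropy q F s v := by
      calc _ ≤ W * (2 / κ * relEntropy q F s v) := by gcongr
        _ = _ := by ring
    nlinarith
  -- For fast velocities F = 0, and one power of |v| ≥ 2W turns s|v| into the s|v|² controlled by
  -- the entropy.
  · have h1 := mul_le_relEntropy hq hW hκ hmono hqF hFW hs h.le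
    rw [hFW v (by linarith), zero_sub, abs_neg, abs_of_nonneg hs]
    have h2 : s * ‖v‖ * α ≤ s * ‖v‖ * CA := by gcongr
    have h3 : s * ‖v‖ * CA ≤ 4 * CA / (3 * W) * (3 / 8 * ‖v‖ ^ 2 * s) := by
      rw [div_mul_eq_mul_div, le_div_iff₀ (by positivity)]
      have : 0 ≤ s * ‖v‖ * CA := by positivity
      nlinarith
    have h4 : 4 * CA / (3 * W) * (3 / 8 * ‖v‖ ^ 2 * s) ≤ 4 * CA / (3 * W) * relEntropy q F s v := by
      gcongr
    have h5 : 0 ≤ 2 * W / κ * relEntropy q F s v := by positivity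
    have h6 : 0 ≤ W * CA ^ 2 * β ^ 2 * ballInd (2 * W) v := by
      have := ballInd_nonneg (2 * W) v; positivity
    linarith

/-- The cutoff term on the entropy is nonpositive; the work of A yields the Gronwall term and an
R^{-4} source depending on data only; the field defect and the cutoff term on the potential yield
the two errors with K, which vanish with δ after integration. -/
theorem energyRate_le (hp : 3 < p) (hf : IsSolution T F f₀ A f) (hF : BackgroundCond F)
    (hq : Continuous q) (hW : 0 < W) (hκ : 0 < κ)
    (hmono : ∀ s r, s ≤ r → κ * (r - s) ≤ q r - q s)
    (hqF : ∀ v, ‖v‖ ≤ W → q (F v) = -(‖v‖ ^ 2 / 2)) (hFW : ∀ v, W ≤ ‖v‖ → F v = 0)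
    (hb : SolutionBounds T p F A f P K) (hδ : 0 < δ) (ht : t ∈ Icc 0 T)
    {CA : ℝ} (hCA : 0 ≤ CA) (hA : ∀ t, 0 ≤ t → ∀ x, ‖A t x‖ ≤ CA * R x ^ (-2 : ℝ))
    {Cχ Cψ : ℝ} (hχ : ∀ δ P t : ℝ, 0 < δ → 0 ≤ P → 0 ≤ t → ∀ x v : E3, ‖v‖ ≤ P →
      |fderiv ℝ (cutoff δ P) (t, x) (1, v)| ≤ Cχ * P * δ ^ (1 / 2 : ℝ) * R x ^ (-(1 / 2) : ℝ))
    (hψ : ∀ x, |localPotential δ P δ F f t x| ≤ K * Cψ * R x ^ (-1 : ℝ)) (z : E3 × E3) :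
    energyRate δ P δ q F A f t z ≤
      (2 * W / κ + 4 * CA / (3 * W)) * localEntropy δ P q F f (t, z) +
      (W * CA ^ 2 * (R z.1 ^ (-4 : ℝ) * ballInd (2 * W) z.2) +
      (K * P * K * (R z.1 ^ (-2 : ℝ) * fieldDefect p δ (P * T) z.1 * ballInd P z.2) +
      K * Cχ * P * (K * Cψ) * δ ^ (1 / 2 : ℝ) * (R z.1 ^ (-(7 / 2) : ℝ) * ballInd P z.2))) := by
  obtain ⟨x, v⟩ := z
  simp only
  have hR := R_pos x
  have hs := hf.nonneg t ht x v
  have hnn := relEntropy_nonneg hq hW hκ hmono hqF hFW hs v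
  have hχ0 := cutoff_nonneg (δ := δ) (P := P) (t, x)
  have hχ1 := cutoff_le_one (δ := δ) (P := P) (t, x)
  have hD := fieldDefect_nonneg (p := p) (δ := δ) (Q := P * T) x
  have hK := hb.K_nonneg
  have hP := hb.P_pos
  have hC1 : 0 ≤ 2 * W / κ + 4 * CA / (3 * W) := by positivity
  have hi1 := ballInd_nonneg (2 * W) v
  have hent : 0 ≤ localEntropy δ P q F f (t, x, v) := mul_nonneg hχ0 hnn
  have h4 : 0 ≤ W * CA ^ 2 * (R x ^ (-4 : ℝ) * ballInd (2 * W) v) := by positivity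
  rcases lt_or_ge P ‖v‖ with hv | hv
  · obtain ⟨h1, h2⟩ := hb.support t ht x v hv
    have hz : energyRate δ P δ q F A f t (x, v) = 0 := by
      simp [energyRate, relEntropy, h1, h2]
    have hi2 := ballInd_nonneg P v
    -- The signs of these constants are not assumed; they follow from the bounds in which the
    -- constants occur.
    have hCψ : 0 ≤ K * Cψ := by
      by_contra hcon
      have := (abs_nonneg _).trans (hψ x)
      have h' := R_rpow_pos x (-1)
      nlinarith
    have hCχ : 0 ≤ Cχ := by
      have := (abs_nonneg _).trans (hχ 1 1 0 one_pos zero_le_one le_rfl 0 0 (by simp))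
      have h' := R_rpow_pos 0 (-(1 / 2))
      rw [mul_one, Real.one_rpow, mul_one] at this
      by_contra hcon
      nlinarith
    rw [hz]; positivity
  rw [ballInd_of_le hv, mul_one, mul_one]
  have hg := hb.decay t ht x v
  have hdef := norm_field_sub_localField_le hp hf hF hb hδ ht x
  have hA' := hA t ht.1 x
  have t1 : fderiv ℝ (cutoff δ P) (t, x) (1, v) * relEntropy q F (f t x v) v ≤ 0 :=
    mul_nonpos_of_nonpos_of_nonneg (fderiv_cutoff_nonpos hδ (t, x) hv) hnn
  have t2 : |F v - f t x v| * ‖v‖ * ‖A t x‖ ≤ (2 * W / κ + 4 * CA / (3 * W)) *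
      relEntropy q F (f t x v) v + W * CA ^ 2 * (R x ^ (-2 : ℝ)) ^ 2 * ballInd (2 * W) v :=
    work_le_relEntropy hq hW hκ hmono hqF hFW (norm_nonneg _) hA'
      (hA'.trans (mul_le_of_le_one_right hCA (R_rpow_neg_le_one x (by norm_num)))) hs v
  have hR4 : (R x ^ (-2 : ℝ)) ^ 2 = R x ^ (-4 : ℝ) := by
    rw [← Real.rpow_natCast, ← Real.rpow_mul hR.le]; norm_num
  rw [hR4] at t2
  have t3 : (F v - f t x v) * inner ℝ v (field F f t x + A t x - localField δ P δ F f t x) ≤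
      |F v - f t x v| * ‖v‖ * ‖A t x‖ +
        K * P * K * (R x ^ (-2 : ℝ) * fieldDefect p δ (P * T) x) := by
    refine (le_abs_self _).trans ?_
    rw [abs_mul]
    have h1 : |inner ℝ v (field F f t x + A t x - localField δ P δ F f t x)| ≤
        ‖v‖ * (‖A t x‖ + K * fieldDefect p δ (P * T) x) := by
      refine (abs_real_inner_le_norm _ _).trans ?_
      gcongr
      rw [show field F f t x + A t x - localField δ P δ F f t x =
        A t x + (field F f t x - localField δ P δ F f t x) by abel]
      exact (norm_add_le _ _).trans (by gcongr)
    calc _ ≤ |F v - f t x v| * (‖v‖ * (‖A t x‖ + K * fieldDefect p δ (P * T) x)) := by gcongr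
      _ = |F v - f t x v| * ‖v‖ * ‖A t x‖ +
          |F v - f t x v| * (‖v‖ * (K * fieldDefect p δ (P * T) x)) := by ring
      _ ≤ |F v - f t x v| * ‖v‖ * ‖A t x‖ +
          K * R x ^ (-2 : ℝ) * (P * (K * fieldDefect p δ (P * T) x)) := by gcongr
      _ = _ := by ring
  have t4 : cutoff δ P (t, x) * ((F v - f t x v) *
      inner ℝ v (field F f t x + A t x - localField δ P δ F f t x)) ≤
      (2 * W / κ + 4 * CA / (3 * W)) * localEntropy δ P q F f (t, x, v) +
      (W * CA ^ 2 * (R x ^ (-4 : ℝ) * ballInd (2 * W) v) +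
        K * P * K * (R x ^ (-2 : ℝ) * fieldDefect p δ (P * T) x)) := by
    have hB : 0 ≤ W * CA ^ 2 * (R x ^ (-4 : ℝ) * ballInd (2 * W) v) +
        K * P * K * (R x ^ (-2 : ℝ) * fieldDefect p δ (P * T) x) := by positivity
    calc _ ≤ cutoff δ P (t, x) * ((2 * W / κ + 4 * CA / (3 * W)) * relEntropy q F (f t x v) v +
          (W * CA ^ 2 * (R x ^ (-4 : ℝ) * ballInd (2 * W) v) +
          K * P * K * (R x ^ (-2 : ℝ) * fieldDefect p δ (P * T) x))) := by
          gcongr; linarith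
      _ = (2 * W / κ + 4 * CA / (3 * W)) * localEntropy δ P q F f (t, x, v) +
          cutoff δ P (t, x) * (W * CA ^ 2 * (R x ^ (-4 : ℝ) * ballInd (2 * W) v) +
          K * P * K * (R x ^ (-2 : ℝ) * fieldDefect p δ (P * T) x)) := by
          simp only [localEntropy, uncurry3]; ring
      _ ≤ _ := by gcongr; exact mul_le_of_le_one_left hB hχ1
  have t5 : (F v - f t x v) * (fderiv ℝ (cutoff δ P) (t, x) (1, v) * localPotential δ P δ F f t x) ≤
      K * Cχ * P * (K * Cψ) * δ ^ (1 / 2 : ℝ) * R x ^ (-(7 / 2) : ℝ) := by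
    refine (le_abs_self _).trans ?_
    rw [abs_mul, abs_mul]
    have h1 := hχ δ P t hδ hP.le ht.1 x v hv
    have h0 := (abs_nonneg _).trans h1
    have hRR : R x ^ (-(7 / 2) : ℝ) = R x ^ (-2 : ℝ) * (R x ^ (-(1 / 2) : ℝ) * R x ^ (-1 : ℝ)) := by
      rw [← Real.rpow_add hR, ← Real.rpow_add hR]; norm_num
    calc _ ≤ K * R x ^ (-2 : ℝ) * ((Cχ * P * δ ^ (1 / 2 : ℝ) * R x ^ (-(1 / 2) : ℝ)) *
          (K * Cψ * R x ^ (-1 : ℝ))) := by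
          gcongr
          exact hψ x
      _ = _ := by rw [hRR]; ring
  rw [energyRate]
  simp only
  linarith

end Rate

/-! ### Gronwall's argument -/

/-- The function e^{-at} y - Bt is nonincreasing, using e^{-at} ≤ 1; no sign of y is needed. -/
theorem le_of_deriv_le_linear {T a B : ℝ} (ha : 0 ≤ a) (hB : 0 ≤ B) {y : ℝ → ℝ} {y' : ℝ → ℝ}
    (hc : ContinuousOn y (Icc 0 T)) (hd : ∀ t ∈ Ioo 0 T, HasDerivAt y (y' t) t)
    (hle : ∀ t ∈ Ioo 0 T, y' t ≤ a * y t + B) {t : ℝ} (ht : t ∈ Icc 0 T) :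
    y t ≤ Real.exp (a * t) * (y 0 + B * t) := by
  have hT : 0 ≤ T := ht.1.trans ht.2
  have hder : ∀ t ∈ Ioo 0 T, HasDerivAt (fun t => Real.exp (-(a * t)) * y t - B * t)
      (Real.exp (-(a * t)) * (-a) * y t + Real.exp (-(a * t)) * y' t - B) t := by
    intro t ht
    have h1 : HasDerivAt (fun t => Real.exp (-(a * t))) (Real.exp (-(a * t)) * (-a)) t := by
      have : HasDerivAt (fun t => -(a * t)) (-a) t := by
        simpa using ((hasDerivAt_id' t).const_mul a).fun_neg
      exact this.exp
    have h2 : HasDerivAt (fun t => B * t) B t := by simpa using (hasDerivAt_id t).const_mul B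
    exact (h1.mul (hd t ht)).sub h2
  have hanti : AntitoneOn (fun t => Real.exp (-(a * t)) * y t - B * t) (Icc 0 T) := by
    refine antitoneOn_of_deriv_nonpos (convex_Icc 0 T) ?_ ?_ ?_
    · exact (ContinuousOn.mul (by fun_prop) hc).sub (by fun_prop)
    · rw [interior_Icc]
      exact fun t ht => (hder t ht).differentiableAt.differentiableWithinAt
    · rw [interior_Icc]
      intro t ht
      rw [(hder t ht).deriv]
      have h1 := hle t ht
      have h2 : Real.exp (-(a * t)) ≤ 1 := by
        rw [Real.exp_le_one_iff]; have := ht.1; have : 0 ≤ a * t := by positivity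
        linarith
      have h3 := Real.exp_pos (-(a * t))
      nlinarith
  have h := hanti (left_mem_Icc.2 hT) ht ht.1
  simp only [mul_zero, neg_zero, Real.exp_zero, one_mul, sub_zero] at h
  have h1 : Real.exp (-(a * t)) * y t ≤ y 0 + B * t := by linarith
  calc y t = Real.exp (a * t) * (Real.exp (-(a * t)) * y t) := by
        rw [← mul_assoc, ← Real.exp_add]; simp
    _ ≤ _ := by gcongr

theorem integral_mul_ballInd (g : E3 → ℝ) (r : ℝ) :
    ∫ z : E3 × E3, g z.1 * ballInd r z.2 = (∫ x, g x) * ∫ v, ballInd r v :=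
  integral_prod_mul g (ballInd r)

theorem integrable_mul_ballInd {g : E3 → ℝ} (hg : Integrable g) (r : ℝ) :
    Integrable fun z : E3 × E3 => g z.1 * ballInd r z.2 :=
  hg.mul_prod (integrable_ballInd r)

section Bounds

variable {T p P K δ ε t : ℝ} {F : E3 → ℝ} {f₀ : E3 → E3 → ℝ} {A : ℝ → E3 → E3}
  {f : ℝ → E3 → E3 → ℝ} {q : ℝ → ℝ} {W κ : ℝ}

/-- The energy inequality with an error that disappears as the localization is removed. -/
theorem exists_localEnergy_le (hp : 3 < p) (hf : IsSolution T F f₀ A f) (hF : BackgroundCond F)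
    (hA : ExternalFieldCond p T A)
    (hq : Continuous q) (hW : 0 < W) (hκ : 0 < κ)
    (hmono : ∀ s r, s ≤ r → κ * (r - s) ≤ q r - q s)
    (hqF : ∀ v, ‖v‖ ≤ W → q (F v) = -(‖v‖ ^ 2 / 2)) (hFW : ∀ v, W ≤ ‖v‖ → F v = 0)
    (hb : SolutionBounds T p F A f P K)
    {CA : ℝ} (hCA : 0 ≤ CA) (hA' : ∀ t, 0 ≤ t → ∀ x, ‖A t x‖ ≤ CA * R x ^ (-2 : ℝ)) :
    ∃ err : ℝ → ℝ, Tendsto err (𝓝[>] 0) (𝓝 0) ∧ ∀ δ, 0 < δ → ∀ t ∈ Icc 0 T,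
      localEnergy δ P δ q F f t ≤ Real.exp ((2 * W / κ + 4 * CA / (3 * W)) * t) *
        (localEnergy δ P δ q F f 0 + (W * CA ^ 2 * ((∫ x : E3, R x ^ (-4 : ℝ)) *
          ∫ v, ballInd (2 * W) v) + err δ) * t) := by
  obtain ⟨Cχ, hCχ, hχ⟩ := exists_abs_fderiv_cutoff_le
  obtain ⟨Cψ, hCψ, hψ⟩ := exists_localPotential_bound hp
  have hK := hb.K_nonneg
  have hP := hb.P_pos
  set VP := ∫ v, ballInd P v
  have hVP : 0 ≤ VP := integral_nonneg (ballInd_nonneg P)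
  set err : ℝ → ℝ := fun δ => K * P * K *
      ((∫ x : E3, R x ^ (-2 : ℝ) * fieldDefect p δ (P * T) x) * VP) +
      K * Cχ * P * (K * Cψ) * δ ^ (1 / 2 : ℝ) * ((∫ x : E3, R x ^ (-(7 / 2) : ℝ)) * VP)
  refine ⟨err, ?_, fun δ hδ t ht => ?_⟩
  · have h1 := ((tendsto_integral_fieldDefect hp (P * T)).mul_const VP).const_mul (K * P * K)
    have h2 : Tendsto (fun δ : ℝ => δ ^ (1 / 2 : ℝ)) (𝓝[>] 0) (𝓝 0) := by
      have : Tendsto (fun δ : ℝ => δ ^ (1 / 2 : ℝ)) (𝓝 0) (𝓝 (0 ^ (1 / 2 : ℝ))) :=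
        (Real.continuous_rpow_const (by norm_num)).tendsto 0
      rw [Real.zero_rpow (by norm_num)] at this
      exact this.mono_left nhdsWithin_le_nhds
    have h3 := (h2.const_mul (K * Cχ * P * (K * Cψ))).mul_const
      ((∫ x : E3, R x ^ (-(7 / 2) : ℝ)) * VP)
    have h4 := h1.add h3
    simp only [zero_mul, mul_zero, add_zero] at h4
    exact h4
  · have herr : 0 ≤ err δ := by
      have h1 : 0 ≤ ∫ x : E3, R x ^ (-2 : ℝ) * fieldDefect p δ (P * T) x :=
        integral_nonneg fun x => mul_nonneg (R_rpow_pos x _).le (fieldDefect_nonneg x)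
      have h2 : 0 ≤ ∫ x : E3, R x ^ (-(7 / 2) : ℝ) := integral_nonneg fun x => (R_rpow_pos x _).le
      positivity
    have hR4 : 0 ≤ ∫ x : E3, R x ^ (-4 : ℝ) := integral_nonneg fun x => (R_rpow_pos x _).le
    have hV2 : 0 ≤ ∫ v, ballInd (2 * W) v := integral_nonneg (ballInd_nonneg _)
    refine le_of_deriv_le_linear (y' := fun t => ∫ z, energyRate δ P δ q F A f t z)
      (by positivity) (by positivity) (continuousOn_localEnergy hf hF hq hb hδ hδ)
      (fun t ht => (hasDerivAt_localEnergy hf hF hA hq hqF hFW hb hδ hδ ht).2)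
      (fun t ht => ?_) ht
    have htI := Ioo_subset_Icc_self ht
    have i0 := (hasDerivAt_localEnergy hf hF hA hq hqF hFW hb hδ hδ ht).1
    have i1 := (integrable_localEntropy (q := q) hf hF hq hb hδ htI).const_mul
      (2 * W / κ + 4 * CA / (3 * W))
    have i2 := (integrable_mul_ballInd (integrable_R_rpow (s := 4) (by norm_num)) (2 * W)).const_mul
      (W * CA ^ 2)
    have i3 := (integrable_mul_ballInd (integrable_fieldDefect (Q := P * T) hp hδ) P).const_mul
      (K * P * K)
    have i4 := (integrable_mul_ballInd (integrable_R_rpow (s := 7 / 2) (by norm_num)) P).const_mul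
      (K * Cχ * P * (K * Cψ) * δ ^ (1 / 2 : ℝ))
    have hle := integral_mono i0 (i1.add (i2.add (i3.add i4))) fun z =>
      energyRate_le hp hf hF hq hW hκ hmono hqF hFW hb hδ htI hCA hA' hχ
        (hψ hf hF hb hδ hδ htI hK (hb.density t htI)) z
    refine hle.trans ?_
    have e1 := integral_add_add i1 i2 (i3.add i4)
    have e2 := integral_add i3 i4
    simp only [Pi.add_apply] at e1 ⊢
    rw [e1, e2]
    simp only [integral_const_mul]
    rw [integral_mul_ballInd (fun x => R x ^ (-4 : ℝ)),
      integral_mul_ballInd (fun x => R x ^ (-2 : ℝ) * fieldDefect p δ (P * T) x),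
      integral_mul_ballInd (fun x => R x ^ (-(7 / 2) : ℝ))]
    have h1 := integral_localEntropy_le (q := q) hf hF hb hδ hδ htI
    have h2 : (2 * W / κ + 4 * CA / (3 * W)) * ∫ z : E3 × E3, localEntropy δ P q F f (t, z) ≤
      (2 * W / κ + 4 * CA / (3 * W)) * localEnergy δ P δ q F f t := by gcongr
    simp only [err]
    linarith

/-- The initial energy is bounded in terms of the data. -/
theorem exists_initial_energy_bound (hp : 3 < p) (hp6 : p ≤ 6) (hT : 0 ≤ T) (hF : BackgroundCond F)
    (hf₀ : InitialCond f₀) (hFf₀ : PerturbationCond F f₀) (hq : Continuous q) (hW : 0 < W)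
    (hκ : 0 < κ) (hmono : ∀ s r, s ≤ r → κ * (r - s) ≤ q r - q s)
    (hqF : ∀ v, ‖v‖ ≤ W → q (F v) = -(‖v‖ ^ 2 / 2)) (hFW : ∀ v, W ≤ ‖v‖ → F v = 0) :
    ∃ C : ℝ, 0 ≤ C ∧ ∀ {A : ℝ → E3 → E3} {f : ℝ → E3 → E3 → ℝ} {P K δ : ℝ},
      IsSolution T F f₀ A f → SolutionBounds T p F A f P K → 0 < δ →
      localEnergy δ P δ q F f 0 ≤ C := by
  obtain ⟨C₀, P₀, hC₀, hP₀, hdec, hsupp⟩ := exists_initial_bounds hF hf₀ hFf₀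
  obtain ⟨m, hm⟩ := hF.hasCompactSupport.exists_bound_of_continuous hF.contDiff.continuous
  obtain ⟨Ce, hCe, he⟩ := exists_relEntropy_le (F := F) hq (m + C₀) P₀
  obtain ⟨Cψ, hCψ, hψ⟩ := exists_localPotential_bound hp
  set V := ∫ v, ballInd P₀ v
  have hV : 0 ≤ V := integral_nonneg (ballInd_nonneg _)
  set I := ∫ x : E3, R x ^ (-6 : ℝ)
  have hI : 0 ≤ I := integral_nonneg fun x => (R_rpow_pos x _).le
  have i6 := integrable_mul_ballInd (integrable_R_rpow (s := 6) (by norm_num)) P₀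
  have e6 : ∫ z : E3 × E3, R z.1 ^ (-6 : ℝ) * ballInd P₀ z.2 = I * V :=
    integral_mul_ballInd (fun x => R x ^ (-6 : ℝ)) P₀
  refine ⟨Ce * C₀ * (I * V) + 1 / 2 * (C₀ * V * Cψ * (C₀ * (I * V))), by positivity,
    fun {A f P K δ} hf hb hδ => ?_⟩
  have h0 : (0 : ℝ) ∈ Icc 0 T := left_mem_Icc.2 hT
  have hg : ∀ x v, |F v - f 0 x v| ≤ C₀ * (R x ^ (-6 : ℝ) * ballInd P₀ v) := fun x v => by
    rw [hf.initial]
    rcases le_or_gt ‖v‖ P₀ with h | h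
    · rw [ballInd_of_le h, mul_one]; exact hdec x v
    · rw [(hsupp x v h).1, (hsupp x v h).2, sub_zero, abs_zero]
      have := ballInd_nonneg P₀ v; have := R_rpow_pos x (-6); positivity
  have hent : ∀ z : E3 × E3, localEntropy δ P q F f (0, z) ≤
      Ce * C₀ * (R z.1 ^ (-6 : ℝ) * ballInd P₀ z.2) := by
    rintro ⟨x, v⟩
    have hs : 0 ≤ f 0 x v := hf.nonneg 0 h0 x v
    have hnn := relEntropy_nonneg hq hW hκ hmono hqF hFW hs v
    have h1 : localEntropy δ P q F f (0, x, v) ≤ relEntropy q F (f 0 x v) v :=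
      mul_le_of_le_one_left hnn (cutoff_le_one _)
    refine h1.trans ?_
    rcases le_or_gt ‖v‖ P₀ with h | h
    · have hFm : F v ≤ m := (le_abs_self _).trans (hm v)
      have hfm : f 0 x v ≤ m + C₀ := by
        have h2 := (abs_le.1 (hdec x v)).1
        have h3 : C₀ * R x ^ (-6 : ℝ) ≤ C₀ :=
          mul_le_of_le_one_right hC₀ (R_rpow_neg_le_one x (by norm_num))
        rw [hf.initial]; linarith
      refine (he (f 0 x v) v ⟨hs, hfm⟩ ⟨hF.nonneg v, by linarith⟩ h).trans ?_
      rw [abs_sub_comm, mul_assoc]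
      exact mul_le_mul_of_nonneg_left (hg x v) hCe
    · have hz : relEntropy q F (f 0 x v) v = 0 := by
        rw [hf.initial, relEntropy, (hsupp x v h).1, (hsupp x v h).2]; simp
      rw [hz]
      have := ballInd_nonneg P₀ v; have := R_rpow_pos x (-6); positivity
  have hΦ : ∀ z : E3 × E3, |localPerturbation δ P F f (0, z)| ≤
      C₀ * (R z.1 ^ (-6 : ℝ) * ballInd P₀ z.2) := by
    rintro ⟨x, v⟩
    rw [localPerturbation, abs_mul, abs_of_nonneg (cutoff_nonneg _)]
    exact (mul_le_of_le_one_left (abs_nonneg _) (cutoff_le_one _)).trans (hg x v)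
  -- The initial decay R^{-6} is stronger than R^{-p} because p ≤ 6, so the potential at time 0 is
  -- bounded by constants of the data.
  have hρ : ∀ x, |density F f 0 x| ≤ C₀ * V * R x ^ (-p) := fun x => by
    have h1 : ‖density F f 0 x‖ ≤ ∫ v, C₀ * R x ^ (-6 : ℝ) * ballInd P₀ v :=
      norm_integral_le_of_norm_le ((integrable_ballInd P₀).const_mul _)
        (Eventually.of_forall fun v => (hg x v).trans_eq (by ring))
    rw [integral_const_mul] at h1
    calc _ ≤ _ := h1
      _ = C₀ * V * R x ^ (-6 : ℝ) := by ring
      _ ≤ _ := mul_le_mul_of_nonneg_left (R_rpow_neg_mono x hp6) (by positivity)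
  have hpot : ∀ x, |localPotential δ P δ F f 0 x| ≤ C₀ * V * Cψ := fun x =>
    (hψ hf hF hb hδ hδ h0 (by positivity) hρ x).trans
      (mul_le_of_le_one_right (by positivity) (R_rpow_neg_le_one x zero_le_one))
  have hΦi := integrable_localPerturbation hf hF hb hδ h0
  have b1 : ∫ z : E3 × E3, localEntropy δ P q F f (0, z) ≤ Ce * C₀ * (I * V) := by
    rw [← e6, ← integral_const_mul]
    exact integral_mono (integrable_localEntropy hf hF hq hb hδ h0) (i6.const_mul _) hent
  have hk : Measurable fun z : (E3 × E3) × (E3 × E3) => plummer δ (z.1.1 - z.2.1) :=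
    (contDiff_plummer hδ (n := 0)).continuous.measurable.comp (by fun_prop)
  have hii := integrable_prod_mul_of_bounded hΦi hk (C := δ ^ (-1 : ℝ)) (fun z => by
    rw [abs_of_pos (plummer_pos hδ _)]; exact plummer_le_const hδ _)
  have b2 : ∫ z : (E3 × E3) × (E3 × E3), localPerturbation δ P F f (0, z.1) *
      localPerturbation δ P F f (0, z.2) * plummer δ (z.1.1 - z.2.1) ≤
      C₀ * V * Cψ * (C₀ * (I * V)) := by
    rw [Measure.volume_eq_prod, integral_prod _ hii]
    have e1 : ∀ z : E3 × E3, ∫ w : E3 × E3, localPerturbation δ P F f (0, z) *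
        localPerturbation δ P F f (0, w) * plummer δ (z.1 - w.1) =
        localPerturbation δ P F f (0, z) * localPotential δ P δ F f 0 z.1 := fun z => by
      simp only [mul_assoc, integral_const_mul, localPotential, smul_eq_mul]
    simp only [e1]
    have e2 : C₀ * V * Cψ * (C₀ * (I * V)) = ∫ z : E3 × E3,
        C₀ * V * Cψ * (C₀ * (R z.1 ^ (-6 : ℝ) * ballInd P₀ z.2)) := by
      rw [integral_const_mul, integral_const_mul, e6]
    rw [e2]
    refine (le_abs_self _).trans ?_
    rw [← Real.norm_eq_abs]
    refine norm_integral_le_of_norm_le ((i6.const_mul _).const_mul _)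
      (Eventually.of_forall fun z => ?_)
    rw [norm_mul, mul_comm]
    exact mul_le_mul (hpot z.1) (hΦ z) (norm_nonneg _) (by positivity)
  rw [localEnergy]
  linarith

end Bounds

/-! ### The mean-square bound of the density -/

section Bounds

variable {T p P K δ ε t : ℝ} {F : E3 → ℝ} {f₀ : E3 → E3 → ℝ} {A : ℝ → E3 → E3}
  {f : ℝ → E3 → E3 → ℝ} {q : ℝ → ℝ} {W κ : ℝ}

theorem integral_ballInd_pos {r : ℝ} (hr : 0 < r) : 0 < ∫ v, ballInd r v := by
  rw [ballInd, integral_indicator measurableSet_closedBall, setIntegral_const, smul_eq_mul,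
    mul_one]
  exact ENNReal.toReal_pos (measure_closedBall_pos _ _ hr).ne' measure_closedBall_lt_top.ne

/-- To be integrated in v with D = |ρ(x)|. For |v| ≤ 2W it is Young's inequality with parameter V
and the quadratic entropy bound. For |v| > 2W, D ≤ M and the linear bound give entropy at least
(3/2) W² s. The dependence on M is why sup |ρ| enters the mean-square estimate. -/
theorem mul_abs_le_relEntropy (hq : Continuous q) (hW : 0 < W) (hκ : 0 < κ)
    (hmono : ∀ s r, s ≤ r → κ * (r - s) ≤ q r - q s)
    (hqF : ∀ v, ‖v‖ ≤ W → q (F v) = -(‖v‖ ^ 2 / 2)) (hFW : ∀ v, W ≤ ‖v‖ → F v = 0)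
    {D M V : ℝ} (hV : 0 < V) (hD : 0 ≤ D) (hDM : D ≤ M) {s : ℝ} (hs : 0 ≤ s) (v : E3) :
    D * |F v - s| ≤ D ^ 2 / (2 * V) * ballInd (2 * W) v +
      (V / κ + 2 * M / (3 * W ^ 2)) * relEntropy q F s v := by
  have hM : 0 ≤ M := hD.trans hDM
  have hnn := relEntropy_nonneg hq hW hκ hmono hqF hFW hs v
  rw [add_mul]
  rcases le_or_gt ‖v‖ (2 * W) with h | h
  · rw [ballInd_of_le h, mul_one]
    have h1 := sq_le_relEntropy hq hW hmono hqF hFW hs v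
    have h2 : V / 2 * (F v - s) ^ 2 ≤ V / κ * relEntropy q F s v := by
      have : V / 2 * (F v - s) ^ 2 = V / κ * (κ / 2 * (s - F v) ^ 2) := by field_simp; ring
      rw [this]; gcongr
    have h3 : D * |F v - s| ≤ D ^ 2 / (2 * V) + V / 2 * (F v - s) ^ 2 := by
      rw [← sq_abs (F v - s)]
      have : D ^ 2 / (2 * V) + V / 2 * |F v - s| ^ 2 - D * |F v - s| =
        (D - V * |F v - s|) ^ 2 / (2 * V) := by field_simp; ring
      have h4 : 0 ≤ (D - V * |F v - s|) ^ 2 / (2 * V) := by positivity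
      linarith
    have h6 : 0 ≤ 2 * M / (3 * W ^ 2) * relEntropy q F s v := by positivity
    linarith
  · have h1 := mul_le_relEntropy hq hW hκ hmono hqF hFW hs h.le
    rw [hFW v (by linarith), zero_sub, abs_neg, abs_of_nonneg hs]
    have h2 : D * s ≤ M * s := by gcongr
    have h3 : M * s = 2 * M / (3 * W ^ 2) * (3 / 8 * (2 * W) ^ 2 * s) := by field_simp; ring
    have h4 : 2 * M / (3 * W ^ 2) * (3 / 8 * (2 * W) ^ 2 * s) ≤
        2 * M / (3 * W ^ 2) * relEntropy q F s v := by
      gcongr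
      exact le_trans (by gcongr) h1
    have h5 := ballInd_nonneg (2 * W) v
    have h6 : 0 ≤ D ^ 2 / (2 * V) * ballInd (2 * W) v := by positivity
    have h7 : 0 ≤ V / κ * relEntropy q F s v := by positivity
    linarith

theorem integral_cutoff_mul_density_sq_le (hf : IsSolution T F f₀ A f) (hF : BackgroundCond F)
    (hq : Continuous q) (hW : 0 < W) (hκ : 0 < κ)
    (hmono : ∀ s r, s ≤ r → κ * (r - s) ≤ q r - q s)
    (hqF : ∀ v, ‖v‖ ≤ W → q (F v) = -(‖v‖ ^ 2 / 2)) (hFW : ∀ v, W ≤ ‖v‖ → F v = 0)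
    (hb : SolutionBounds T p F A f P K) (hδ : 0 < δ) (ht : t ∈ Icc 0 T) {M : ℝ}
    (hM : ∀ x, |density F f t x| ≤ M) :
    ∫ x, cutoff δ P (t, x) * density F f t x ^ 2 ≤
      2 * ((∫ v, ballInd (2 * W) v) / κ + 2 * M / (3 * W ^ 2)) *
        ∫ z : E3 × E3, localEntropy δ P q F f (t, z) := by
  have hV := integral_ballInd_pos (r := 2 * W) (by positivity)
  set V := ∫ v, ballInd (2 * W) v with hVdef
  set B := V / κ + 2 * M / (3 * W ^ 2)
  have hint := integrable_localEntropy (q := q) hf hF hq hb hδ ht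
  have hx : ∀ x, cutoff δ P (t, x) * density F f t x ^ 2 ≤
      2 * B * ∫ v, localEntropy δ P q F f (t, x, v) := fun x => by
    have hc : Integrable fun v => localEntropy δ P q F f (t, x, v) := by
      refine Continuous.integrable_of_hasCompactSupport ?_ (HasCompactSupport.intro
        (isCompact_closedBall (0 : E3) P) fun v hv =>
          localEntropy_eq_zero hb hδ ht fun h => hv h.2)
      rw [← continuousOn_univ]
      exact (continuousOn_localEntropy hf hF hq).comp (by fun_prop) fun z _ => ⟨ht, mem_univ _⟩
    set χ := cutoff δ P (t, x)
    have hχ : 0 ≤ χ := cutoff_nonneg _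
    have h1 : ‖∫ v, χ * (|density F f t x| * (F v - f t x v))‖ ≤
        ∫ v, (χ * (|density F f t x| ^ 2 / (2 * V)) * ballInd (2 * W) v +
          B * localEntropy δ P q F f (t, x, v)) := by
      refine norm_integral_le_of_norm_le
        (((integrable_ballInd _).const_mul _).add (hc.const_mul _)) (Eventually.of_forall fun v => ?_)
      rw [norm_mul, norm_mul, Real.norm_of_nonneg hχ, Real.norm_of_nonneg (abs_nonneg _),
        Real.norm_eq_abs]
      have := mul_abs_le_relEntropy hq hW hκ hmono hqF hFW hV (abs_nonneg _) (hM x)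
        (hf.nonneg t ht x v) v
      refine (mul_le_mul_of_nonneg_left this hχ).trans_eq ?_
      change _ = _ + B * (χ * relEntropy q F (f t x v) v)
      ring
    rw [integral_const_mul, integral_const_mul, integral_add ((integrable_ballInd _).const_mul _)
      (hc.const_mul _), integral_const_mul, integral_const_mul, ← hVdef] at h1
    change ‖χ * (|density F f t x| * density F f t x)‖ ≤ _ at h1
    rw [norm_mul, norm_mul, Real.norm_of_nonneg hχ, Real.norm_of_nonneg (abs_nonneg _),
      Real.norm_eq_abs, abs_mul_abs_self] at h1
    -- V is the volume of the ball of radius 2W, so this term is exactly half of the left-hand side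
    -- and is absorbed.
    have h2 : χ * (|density F f t x| ^ 2 / (2 * V)) * V = χ * density F f t x ^ 2 / 2 := by
      rw [sq_abs]; field_simp
    rw [h2] at h1
    nlinarith
  have hprod : ∫ z : E3 × E3, localEntropy δ P q F f (t, z) =
      ∫ x, ∫ v, localEntropy δ P q F f (t, x, v) := integral_prod _ hint
  rw [hprod, ← integral_const_mul]
  refine integral_mono_of_nonneg (Eventually.of_forall fun x =>
    mul_nonneg (cutoff_nonneg _) (sq_nonneg _)) ?_ (Eventually.of_forall hx)
  exact (Integrable.integral_prod_left hint).const_mul _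

theorem tendsto_cutoff (P t : ℝ) (x : E3) :
    Tendsto (fun δ => cutoff δ P (t, x)) (𝓝[>] 0) (𝓝 1) := by
  have h1 : Continuous fun δ => cutoff δ P (t, x) := by
    have : Continuous Real.smoothTransition := Real.smoothTransition.continuous
    unfold cutoff; fun_prop
  have h2 := h1.tendsto 0
  rw [cutoff_eq_one (by simp)] at h2
  exact h2.mono_left nhdsWithin_le_nhds

/-- The density is bounded in mean square in terms of its supremum and the data. -/
theorem exists_density_sq_bound (hp : p ∈ Ioo (3 : ℝ) 4) (hT : 0 < T) (hF : BackgroundCond F)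
    (hf₀ : InitialCond f₀) (hA : ExternalFieldCond p T A) (hFf₀ : PerturbationCond F f₀)
    {M : ℝ} (hM : 0 ≤ M) :
    ∃ L : ℝ, 0 ≤ L ∧ ∀ {f : ℝ → E3 → E3 → ℝ} {P K : ℝ}, IsSolution T F f₀ A f →
      SolutionBounds T p F A f P K → ∀ t ∈ Icc 0 T, (∀ x, |density F f t x| ≤ M) →
      Integrable (fun x => density F f t x ^ 2) ∧ ∫ x, density F f t x ^ 2 ≤ L := by
  obtain ⟨q, W, κ, hq, hW, hκ, hmono, hqF, hFW⟩ := hF.exists_entropy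
  obtain ⟨CA, hCA, hA'⟩ := hA.exists_bound
  obtain ⟨Ci, hCi, hinit⟩ := exists_initial_energy_bound hp.1 (hp.2.le.trans (by norm_num)) hT.le
    hF hf₀ hFf₀ hq hW hκ hmono hqF hFW
  set B := (∫ v, ballInd (2 * W) v) / κ + 2 * M / (3 * W ^ 2)
  set a := 2 * W / κ + 4 * CA / (3 * W)
  set b := W * CA ^ 2 * ((∫ x : E3, R x ^ (-4 : ℝ)) * ∫ v, ballInd (2 * W) v)
  have hV := integral_ballInd_pos (r := 2 * W) (by positivity)
  have hR4 : 0 ≤ ∫ x : E3, R x ^ (-4 : ℝ) := integral_nonneg fun x => (R_rpow_pos x _).le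
  have hB : 0 ≤ B := by positivity
  have ha : 0 ≤ a := by positivity
  have hb0 : 0 ≤ b := by positivity
  -- L is built from the data and M alone and is fixed before the solution; `err` depends on the
  -- solution but disappears in the limit.
  refine ⟨2 * B * (Real.exp (a * T) * (Ci + b * T)), by positivity,
    fun {f P K} hf hb t ht hMt => ?_⟩
  obtain ⟨err, herr, hen⟩ := exists_localEnergy_le hp.1 hf hF hA hq hW hκ hmono hqF hFW hb hCA hA'
  have hmeas := (measurable_density hf hF ht).aestronglyMeasurable (μ := volume)
  have hbd : ∀ x, density F f t x ^ 2 ≤ K ^ 2 * R x ^ (-(2 * p)) := fun x => by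
    have h1 := hb.density t ht x
    rw [show -(2 * p) = -p * (2 : ℕ) by push_cast; ring, Real.rpow_mul_natCast (R_pos x).le,
      ← mul_pow, ← sq_abs]
    gcongr
  have hdom : Integrable fun x : E3 => K ^ 2 * R x ^ (-(2 * p)) :=
    (integrable_R_rpow (by linarith [hp.1])).const_mul _
  have hsq : Integrable fun x => density F f t x ^ 2 :=
    hdom.mono' (hmeas.pow 2) (Eventually.of_forall fun x => by
      rw [Real.norm_of_nonneg (sq_nonneg _)]; exact hbd x)
  refine ⟨hsq, ?_⟩
  have hlim : Tendsto (fun δ => ∫ x, cutoff δ P (t, x) * density F f t x ^ 2) (𝓝[>] 0)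
      (𝓝 (∫ x, density F f t x ^ 2)) := by
    refine tendsto_integral_filter_of_dominated_convergence _ (Eventually.of_forall fun δ => ?_)
      (Eventually.of_forall fun δ => Eventually.of_forall fun x => ?_) hsq
      (Eventually.of_forall fun x => ?_)
    · have h1 : Continuous fun x => cutoff δ P (t, x) :=
        contDiff_cutoff.continuous.comp (by fun_prop)
      exact h1.aestronglyMeasurable.mul (hmeas.pow 2)
    · rw [norm_mul, Real.norm_of_nonneg (cutoff_nonneg _), Real.norm_of_nonneg (sq_nonneg _)]
      exact mul_le_of_le_one_left (sq_nonneg _) (cutoff_le_one _)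
    · simpa using (tendsto_cutoff P t x).mul_const (density F f t x ^ 2)
  -- The absolute value makes the source nonnegative, which allows t to be replaced by T.
  have hlim2 : Tendsto (fun δ => 2 * B * (Real.exp (a * T) * (Ci + (b + |err δ|) * T))) (𝓝[>] 0)
      (𝓝 (2 * B * (Real.exp (a * T) * (Ci + (b + |0|) * T)))) :=
    (((((herr.abs).const_add b).mul_const T).const_add Ci).const_mul _).const_mul _
  rw [abs_zero, add_zero] at hlim2
  refine le_of_tendsto_of_tendsto hlim hlim2 ?_
  filter_upwards [self_mem_nhdsWithin] with δ hδ
  have hδ : 0 < δ := hδ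
  refine (integral_cutoff_mul_density_sq_le hf hF hq hW hκ hmono hqF hFW hb hδ ht hMt).trans ?_
  refine mul_le_mul_of_nonneg_left ?_ (by positivity)
  refine (integral_localEntropy_le hf hF hb hδ hδ ht).trans ((hen δ hδ t ht).trans ?_)
  have h1 : (b + err δ) * t ≤ (b + |err δ|) * T := by
    have := le_abs_self (err δ)
    calc _ ≤ (b + |err δ|) * t := mul_le_mul_of_nonneg_right (by linarith) ht.1
      _ ≤ _ := mul_le_mul_of_nonneg_left ht.2 (by positivity)
  have h2 : localEnergy δ P δ q F f 0 + (b + err δ) * t ≤ Ci + (b + |err δ|) * T :=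
    add_le_add (hinit hf hb hδ) h1
  have h3 : 0 ≤ Ci + (b + |err δ|) * T := by have := hT.le; positivity
  calc _ ≤ Real.exp (a * t) * (Ci + (b + |err δ|) * T) := by gcongr
    _ ≤ _ := by gcongr; exact ht.2

end Bounds

/-! ### Differentiability of the field -/

theorem IsSolution.differentiable_density {T p P K t : ℝ} {F : E3 → ℝ} {f₀ : E3 → E3 → ℝ}
    {A : ℝ → E3 → E3} {f : ℝ → E3 → E3 → ℝ} (hf : IsSolution T F f₀ A f) (hF : BackgroundCond F)
    (hb : SolutionBounds T p F A f P K) (ht : t ∈ Icc 0 T) :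
    Differentiable ℝ (density F f t) := by
  set g : E3 × E3 → ℝ := fun z => F z.2 - f t z.1 z.2
  have hg : ContDiff ℝ 1 g :=
    ((hF.contDiff.of_le (by norm_num)).comp contDiff_snd).sub (hf.contDiff_slice ht)
  have hslice : ∀ x v, HasFDerivAt (fun x => g (x, v))
      ((fderiv ℝ g (x, v)).comp (ContinuousLinearMap.inl ℝ E3 E3)) x := fun x v => by
    have h1 : HasFDerivAt (fun x : E3 => (x, v)) (ContinuousLinearMap.inl ℝ E3 E3) x :=
      (hasFDerivAt_id x).prodMk (hasFDerivAt_const v x)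
    exact HasFDerivAt.comp x (hg.differentiable (by norm_num) (x, v)).hasFDerivAt h1
  have hcont : Continuous fun z : E3 × E3 =>
      (fderiv ℝ g z).comp (ContinuousLinearMap.inl ℝ E3 E3) :=
    (hg.continuous_fderiv (by norm_num)).clm_comp continuous_const
  have hzero : ∀ x v, P < ‖v‖ → g (x, v) = 0 := fun x v hv => by
    obtain ⟨h1, h2⟩ := hb.support t ht x v hv
    simp only [g, h1, h2, sub_zero]
  intro x₀
  obtain ⟨C, hC⟩ := ((isCompact_closedBall x₀ 1).prod
    (isCompact_closedBall (0 : E3) P)).exists_bound_of_continuousOn hcont.continuousOn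
  refine (hasFDerivAt_integral_of_dominated_of_fderiv_le (s := ball x₀ 1)
    (bound := fun v => C * ballInd P v) (F := fun x v => F v - f t x v)
    (F' := fun x v => (fderiv ℝ g (x, v)).comp (ContinuousLinearMap.inl ℝ E3 E3))
    (ball_mem_nhds x₀ one_pos) ?_ ?_ ?_ ?_ ((integrable_ballInd P).const_mul C) ?_).differentiableAt
  · exact Eventually.of_forall fun x => (hf.integrable_density t ht x).aestronglyMeasurable
  · exact hf.integrable_density t ht x₀
  · exact (hcont.comp (by fun_prop : Continuous fun v : E3 => (x₀, v))).aestronglyMeasurable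
  · refine Eventually.of_forall fun v x hx => ?_
    rcases le_or_gt ‖v‖ P with h | h
    · rw [ballInd_of_le h, mul_one]
      exact hC (x, v) ⟨ball_subset_closedBall hx, by simpa using h⟩
    · have h1 := hslice x v
      rw [show (fun x => g (x, v)) = fun _ => 0 from funext fun x => hzero x v h] at h1
      rw [h1.unique (hasFDerivAt_const 0 x), norm_zero]
      have h2 : 0 ≤ C := (norm_nonneg _).trans
        (hC (x₀, 0) ⟨by simp, by simpa using hb.P_pos.le⟩)
      exact mul_nonneg h2 (ballInd_nonneg P v)
  · exact Eventually.of_forall fun v x _ => hslice x v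

/-- The difference between the Coulomb field and its softened version. -/
noncomputable def coulombDefect (d : ℝ) (z : E3) : E3 := (1 / ‖z‖ ^ 3) • z - plummerField d z

theorem measurable_coulombDefect {d : ℝ} (hd : 0 < d) : Measurable (coulombDefect d) := by
  have := (contDiff_plummerField hd (n := 0)).continuous.measurable
  unfold coulombDefect; fun_prop

/-- With b² = r² + 1 one has (b - r) b ≤ 1, so 1/r³ - 1/b³ gains two powers of r over 1/r³. The
Coulomb tail r^{-2} cancels to the integrable r^{-4}. -/
theorem norm_coulombDefect_one_le {z : E3} (hz : 1 ≤ ‖z‖) :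
    ‖coulombDefect 1 z‖ ≤ 3 * ‖z‖ ^ (-4 : ℝ) := by
  set r := ‖z‖ with hr
  have hr0 : 0 < r := by linarith
  set b := (r ^ 2 + 1) ^ (1 / 2 : ℝ) with hb
  have hb2 : b ^ 2 = r ^ 2 + 1 := by
    rw [hb, ← Real.rpow_natCast, ← Real.rpow_mul (by positivity)]; norm_num
  have hb0 : 0 < b := by positivity
  have hrb : r < b := by nlinarith
  have hb3 : (r ^ 2 + 1 ^ 2) ^ (-(3 / 2) : ℝ) = 1 / b ^ 3 := by
    rw [hb, ← Real.rpow_mul_natCast (by positivity), one_div, ← Real.rpow_neg (by positivity)]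
    norm_num
  rw [coulombDefect, plummerField, ← hr, hb3, ← sub_smul, norm_smul, ← hr, Real.norm_of_nonneg
    (sub_nonneg.2 (one_div_le_one_div_of_le (by positivity) (by gcongr)))]
  have h4 : r ^ (-4 : ℝ) = 1 / r ^ 4 := by
    rw [Real.rpow_neg hr0.le, one_div]; norm_cast
  rw [h4]
  have key : (1 / r ^ 3 - 1 / b ^ 3) * r = (b ^ 3 - r ^ 3) / (r ^ 2 * b ^ 3) := by
    field_simp
  rw [key, mul_one_div, div_le_div_iff₀ (by positivity) (by positivity)]
  have h5 : (b - r) * b ≤ 1 := by nlinarith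
  have h6 : b ^ 3 - r ^ 3 ≤ 3 * b := by
    have : b ^ 3 - r ^ 3 = (b - r) * (b ^ 2 + b * r + r ^ 2) := by ring
    have h7 : b ^ 2 + b * r + r ^ 2 ≤ 3 * b ^ 2 := by nlinarith
    rw [this]
    calc _ ≤ (b - r) * (3 * b ^ 2) := mul_le_mul_of_nonneg_left h7 (by linarith)
      _ = (b - r) * b * (3 * b) := by ring
      _ ≤ 1 * (3 * b) := by gcongr
      _ = _ := one_mul _
  calc (b ^ 3 - r ^ 3) * r ^ 4 ≤ 3 * b * r ^ 4 := by gcongr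
    _ = 3 * (r ^ 2 * (b * r ^ 2)) := by ring
    _ ≤ 3 * (r ^ 2 * (b * b ^ 2)) := by gcongr
    _ = _ := by ring

theorem norm_coulombDefect_le {d : ℝ} (hd : 0 < d) (z : E3) :
    ‖coulombDefect d z‖ ≤ 2 * ‖z‖ ^ (-2 : ℝ) := by
  refine (norm_sub_le _ _).trans ?_
  have h1 := norm_coulomb_le 1 z
  have h2 := norm_plummerField_le_norm hd z
  rw [abs_one, one_mul] at h1
  linarith

theorem integrable_coulombDefect_one : Integrable (coulombDefect 1) := by
  rw [← integrableOn_univ, ← union_compl_self (ball (0 : E3) 1)]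
  have hm := (measurable_coulombDefect one_pos).aestronglyMeasurable (μ := volume)
  refine IntegrableOn.union ?_ ?_
  · exact ((integrableOn_ball_norm_rpow (s := 2) (by norm_num) 1).const_mul 2).mono' hm.restrict
      (Eventually.of_forall fun z => norm_coulombDefect_le one_pos z)
  · refine ((integrableOn_compl_ball_norm_rpow (s := 4) (by norm_num)).const_mul 3).mono'
      hm.restrict ((ae_restrict_iff' measurableSet_ball.compl).2 (Eventually.of_forall fun z hz => ?_))
    exact norm_coulombDefect_one_le (by simpa using hz)

theorem coulombDefect_smul {d : ℝ} (hd : 0 < d) (w : E3) :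
    coulombDefect d (d • w) = (d ^ 2)⁻¹ • coulombDefect 1 w := by
  have h1 : (‖d • w‖ ^ 2 + d ^ 2) ^ (-(3 / 2) : ℝ) = (d ^ 3)⁻¹ * (‖w‖ ^ 2 + 1 ^ 2) ^ (-(3 / 2) : ℝ) := by
    rw [norm_smul, Real.norm_of_nonneg hd.le,
      show (d * ‖w‖) ^ 2 + d ^ 2 = d ^ 2 * (‖w‖ ^ 2 + 1 ^ 2) by ring,
      Real.mul_rpow (by positivity) (by positivity), ← Real.rpow_natCast d 2, ← Real.rpow_mul hd.le,
      ← Real.rpow_natCast d 3, ← Real.rpow_neg hd.le]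
    norm_num
  rw [coulombDefect, coulombDefect, plummerField, plummerField, h1, norm_smul,
    Real.norm_of_nonneg hd.le, smul_sub, smul_smul, smul_smul, smul_smul, smul_smul]
  congr 2
  · field_simp
  · field_simp

theorem integrable_coulombDefect {d : ℝ} (hd : 0 < d) : Integrable (coulombDefect d) := by
  rw [← integrable_comp_smul_iff volume _ hd.ne']
  simp only [coulombDefect_smul hd]
  exact Integrable.smul (d ^ 2)⁻¹ integrable_coulombDefect_one

/-- Scaling: the volume gives d³ and the homogeneity of the kernel d^{-2}. The remaining factor d
makes the short-range part of the gradient proportional to the splitting length. -/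
theorem integral_norm_coulombDefect {d : ℝ} (hd : 0 < d) :
    ∫ z, ‖coulombDefect d z‖ = d * ∫ z, ‖coulombDefect 1 z‖ := by
  have h := Measure.integral_comp_smul (volume : Measure E3) (fun z => ‖coulombDefect d z‖) d
  simp only [coulombDefect_smul hd, norm_smul, integral_const_mul] at h
  rw [finrank_euclideanSpace, Fintype.card_fin, abs_of_pos (by positivity), smul_eq_mul,
    Real.norm_of_nonneg (by positivity)] at h
  field_simp at h
  linarith

section Convolution

variable {ρ : E3 → ℝ} {M M' d : ℝ}

/-- After the change of variables the derivative acts on ρ, which has bounded gradient, so the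
defect kernel need only be integrable. -/
theorem hasFDerivAt_integral_coulombDefect (hρ : Differentiable ℝ ρ) (hM : ∀ x, |ρ x| ≤ M)
    (hM' : ∀ x, ‖fderiv ℝ ρ x‖ ≤ M') (hd : 0 < d) (x : E3) :
    HasFDerivAt (fun x => ∫ z, ρ (x - z) • coulombDefect d z)
      (∫ z, (fderiv ℝ ρ (x - z)).smulRight (coulombDefect d z)) x := by
  have hi := integrable_coulombDefect hd
  have hc := hρ.continuous
  have hm : ∀ x, AEStronglyMeasurable (fun z => ρ (x - z) • coulombDefect d z) := fun x =>
    (hc.comp (continuous_sub_left x)).aestronglyMeasurable.smul hi.aestronglyMeasurable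
  refine hasFDerivAt_integral_of_dominated_of_fderiv_le (s := univ)
    (bound := fun z => M' * ‖coulombDefect d z‖)
    (F' := fun x z => (fderiv ℝ ρ (x - z)).smulRight (coulombDefect d z)) univ_mem
    (Eventually.of_forall hm) ?_ ?_ ?_ (hi.norm.const_mul M') ?_
  · refine (hi.norm.const_mul M).mono' (hm x) (Eventually.of_forall fun z => ?_)
    rw [norm_smul]
    exact mul_le_mul_of_nonneg_right (hM _) (norm_nonneg _)
  · have h1 : Measurable fun z => fderiv ℝ ρ (x - z) :=
      (measurable_fderiv ℝ ρ).comp (measurable_const.sub measurable_id)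
    exact (ContinuousLinearMap.smulRightL ℝ E3 E3).continuous₂.comp_aestronglyMeasurable
      (h1.aestronglyMeasurable.prodMk hi.aestronglyMeasurable)
  · refine Eventually.of_forall fun z y _ => ?_
    rw [ContinuousLinearMap.norm_smulRight_apply]
    exact mul_le_mul_of_nonneg_right (hM' _) (norm_nonneg _)
  · refine Eventually.of_forall fun z y _ => ?_
    have h1 : HasFDerivAt (fun y => ρ (y - z)) (fderiv ℝ ρ (y - z)) y := by
      have := HasFDerivAt.comp y (hρ (y - z)).hasFDerivAt ((hasFDerivAt_id y).sub_const z)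
      rwa [ContinuousLinearMap.comp_id] at this
    exact h1.smul_const (coulombDefect d z)

/-- Gradient bound for a Coulomb field, split at the length scale `d`. -/
theorem differentiableAt_coulomb (hρ : Differentiable ℝ ρ) (hi : Integrable ρ)
    (hM : ∀ x, |ρ x| ≤ M) (hM' : ∀ x, ‖fderiv ℝ ρ x‖ ≤ M') (hd : 0 < d) (x : E3) :
    DifferentiableAt ℝ (fun x => ∫ y, (ρ y / ‖x - y‖ ^ 3) • (x - y)) x ∧
      ‖fderiv ℝ (fun x => ∫ y, (ρ y / ‖x - y‖ ^ 3) • (x - y)) x‖ ≤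
        M' * (∫ z, ‖coulombDefect 1 z‖) * d +
          4 * ∫ y, |ρ y| * (‖x - y‖ ^ 2 + d ^ 2) ^ (-(3 / 2) : ℝ) := by
  have hdi := integrable_coulombDefect hd
  have hk := contDiff_plummerField hd (n := 1)
  have hkb := norm_plummerField_le_const hd
  have hkd : ∀ z, ‖fderiv ℝ (plummerField d) z‖ ≤ 4 * d ^ (-3 : ℝ) := fun z => by
    refine (norm_fderiv_plummerField_le hd z).trans ?_
    have := softened_rpow_neg_le hd (s := 3 / 2) (by norm_num) z
    norm_num at this ⊢
    exact this
  have hsplit : (fun x => ∫ y, (ρ y / ‖x - y‖ ^ 3) • (x - y)) =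
      fun x => (∫ z, ρ (x - z) • coulombDefect d z) + ∫ y, ρ y • plummerField d (x - y) := by
    funext x
    have h1 : Integrable fun y => ρ y • coulombDefect d (x - y) := by
      have h2 := hdi.comp_sub_left x
      refine (h2.norm.const_mul M).mono' (hi.aestronglyMeasurable.smul h2.aestronglyMeasurable)
        (Eventually.of_forall fun z => ?_)
      rw [norm_smul]
      exact mul_le_mul_of_nonneg_right (hM _) (norm_nonneg _)
    have h2 : ∫ z, ρ (x - z) • coulombDefect d z = ∫ y, ρ y • coulombDefect d (x - y) := by
      rw [← integral_sub_left_eq_self (fun z => ρ (x - z) • coulombDefect d z) volume x]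
      simp only [sub_sub_cancel]
    have h3 : Integrable fun y => ρ y • plummerField d (x - y) :=
      integrable_smul_kernel hi measurable_id hk.continuous hkb x
    rw [h2, ← integral_add h1 h3]
    congr 1; funext y
    simp only [coulombDefect]
    module
  have h1 := hasFDerivAt_integral_coulombDefect hρ hM hM' hd x
  have h2 := hasFDerivAt_integral_kernel hi measurable_id hk hkb hkd x
  have h3 := h1.add h2
  rw [hsplit]
  refine ⟨h3.differentiableAt, ?_⟩
  have h4 := h3.fderiv
  change fderiv ℝ (fun x => (∫ z, ρ (x - z) • coulombDefect d z) +
    ∫ y, ρ y • plummerField d (x - y)) x = _ at h4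
  rw [h4]
  refine (norm_add_le _ _).trans (add_le_add ?_ ?_)
  · rw [mul_assoc, mul_comm _ d, ← integral_norm_coulombDefect hd, ← integral_const_mul]
    refine norm_integral_le_of_norm_le (hdi.norm.const_mul M') (Eventually.of_forall fun z => ?_)
    rw [ContinuousLinearMap.norm_smulRight_apply]
    exact mul_le_mul_of_nonneg_right (hM' _) (norm_nonneg _)
  · rw [← integral_const_mul]
    have hs : ∀ z : E3, (‖z‖ ^ 2 + d ^ 2) ^ (-(3 / 2) : ℝ) ≤ d ^ (-3 : ℝ) := fun z => by
      have := softened_rpow_neg_le hd (s := 3 / 2) (by norm_num) z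
      norm_num at this ⊢
      exact this
    have hint : Integrable fun y => |ρ y| * (‖x - y‖ ^ 2 + d ^ 2) ^ (-(3 / 2) : ℝ) :=
      integrable_smul_kernel hi.abs measurable_id (contDiff_softened_rpow hd _ (n := 0)).continuous
        (fun z => by rw [Real.norm_of_nonneg (by positivity)]; exact hs z) x
    refine norm_integral_le_of_norm_le (hint.const_mul 4) (Eventually.of_forall fun y => ?_)
    rw [norm_smul, Real.norm_eq_abs]
    calc _ ≤ |ρ y| * (4 * (‖x - y‖ ^ 2 + d ^ 2) ^ (-(3 / 2) : ℝ)) := by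
          gcongr; exact norm_fderiv_plummerField_le hd _
      _ = _ := by ring

end Convolution

/-! ### Estimates of singular integrals -/

section Singular

variable {a q M N L : ℝ}

theorem ae_norm_pos : ∀ᵐ y : E3, 0 < ‖y‖ := by
  have : ∀ᵐ y : E3, y ≠ 0 := by simp [ae_iff]
  exact this.mono fun y hy => norm_pos_iff.2 hy

theorem norm_rpow_le_R {y : E3} (hy : 0 < ‖y‖) {s : ℝ} (hs : 0 ≤ s) : R y ^ (-s) ≤ ‖y‖ ^ (-s) :=
  Real.rpow_le_rpow_of_nonpos hy (norm_le_R y) (by linarith)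

theorem le_interpolation (ha : a ∈ Icc (0 : ℝ) 1) {b c r : ℝ} (hr : 0 ≤ r) (hb : r ≤ b)
    (hc : r ≤ c) : r ≤ b ^ (1 - a) * c ^ a := by
  calc r = r ^ (1 - a) * r ^ a := by
        rw [← Real.rpow_add' hr (by norm_num)]; norm_num
    _ ≤ _ := by
        have h1 : 0 ≤ 1 - a := by linarith [ha.2]
        have h2 := ha.1
        have h3 := hr.trans hb
        gcongr

/-- Interpolating the two bounds gives |ρ| ≤ M^{1-a} N^a |y|^{-qa}, locally integrable as qa < 3.
The ball contributes |x|^{3-qa}, and R^{-3} turns this into R^{-qa}. -/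
theorem exists_setIntegral_bound_of_lt (hq : 0 < q) (ha : a ∈ Ico (0 : ℝ) 1) (haq : q * a < 3)
    (hM : 0 ≤ M) : ∃ C : ℝ, 0 ≤ C ∧ ∀ {ρ : E3 → ℝ} {N : ℝ}, (∀ x, |ρ x| ≤ M) → 0 < N →
      (∀ x, |ρ x| ≤ N * R x ^ (-q)) → ∀ x : E3, 1 ≤ ‖x‖ →
      R x ^ (-3 : ℝ) * ∫ y in ball 0 (‖x‖ / 2), |ρ y| ≤ C * (N * R x ^ (-q)) ^ a := by
  set J := ∫ z in ball (0 : E3) 1, ‖z‖ ^ (-(q * a))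
  have hJ : 0 ≤ J := integral_nonneg fun y => by positivity
  refine ⟨M ^ (1 - a) * J, by positivity, fun {ρ N} hρM hN hρN x hx => ?_⟩
  have hqa : 0 ≤ q * a := mul_nonneg hq.le ha.1
  have hRx := R_pos x
  have h1 : ∫ y in ball 0 (‖x‖ / 2), |ρ y| ≤
      ∫ y in ball (0 : E3) (‖x‖ / 2), M ^ (1 - a) * N ^ a * ‖y‖ ^ (-(q * a)) := by
    refine integral_mono_of_nonneg (Eventually.of_forall fun y => abs_nonneg _)
      ((integrableOn_ball_norm_rpow haq _).const_mul _) (ae_restrict_of_ae ?_)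
    filter_upwards [ae_norm_pos] with y hy
    have h2 := le_interpolation (Ico_subset_Icc_self ha) (abs_nonneg _) (hρM y) (hρN y)
    rw [Real.mul_rpow hN.le (R_rpow_pos y _).le, ← Real.rpow_mul (R_pos y).le, neg_mul,
      ← mul_assoc] at h2
    exact h2.trans (mul_le_mul_of_nonneg_left (norm_rpow_le_R hy hqa) (by positivity))
  rw [integral_const_mul, setIntegral_ball_norm_rpow _ (by positivity)] at h1
  have h3 : (‖x‖ / 2) ^ (3 - q * a) ≤ R x ^ (3 - q * a) :=
    Real.rpow_le_rpow (by positivity) (by linarith [norm_le_R x]) (by linarith)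
  have h4 : R x ^ (-3 : ℝ) * R x ^ (3 - q * a) = (R x ^ (-q)) ^ a := by
    rw [← Real.rpow_add hRx, ← Real.rpow_mul hRx.le]; congr 1; ring
  calc _ ≤ R x ^ (-3 : ℝ) * (M ^ (1 - a) * N ^ a * (R x ^ (3 - q * a) * J)) := by
        exact mul_le_mul_of_nonneg_left (h1.trans (mul_le_mul_of_nonneg_left
          (mul_le_mul_of_nonneg_right h3 hJ) (by positivity))) (R_rpow_pos x _).le
    _ = M ^ (1 - a) * J * (N ^ a * (R x ^ (-3 : ℝ) * R x ^ (3 - q * a))) := by ring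
    _ = _ := by rw [h4, Real.mul_rpow hN.le (R_rpow_pos x _).le]

/-- At the endpoint interpolation would lose a logarithm. Instead min(M, N|y|^{-q}), which is
integrable on ℝ³ because q > 3, is rescaled by l = N^{1/q}; the Jacobian l³ equals N^a. -/
theorem exists_setIntegral_bound_of_eq (hq : 3 < q) (haq : q * a = 3)
    (hM : 0 ≤ M) : ∃ C : ℝ, 0 ≤ C ∧ ∀ {ρ : E3 → ℝ} {N : ℝ}, (∀ x, |ρ x| ≤ M) → 0 < N →
      (∀ x, |ρ x| ≤ N * R x ^ (-q)) → ∀ x : E3,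
      R x ^ (-3 : ℝ) * ∫ y in ball 0 (‖x‖ / 2), |ρ y| ≤ C * (N * R x ^ (-q)) ^ a := by
  set h : E3 → ℝ := fun w => min M (‖w‖ ^ (-q)) with hh
  have hnn : ∀ w, 0 ≤ h w := fun w => le_min hM (by positivity)
  have hhm : Measurable h := by fun_prop
  have hhi : Integrable h := by
    rw [← integrableOn_univ, ← union_compl_self (ball (0 : E3) 1)]
    refine IntegrableOn.union ?_ ?_
    · refine (integrableOn_const (C := M) measure_ball_lt_top.ne).mono' hhm.aestronglyMeasurable
        (Eventually.of_forall fun w => ?_)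
      rw [Real.norm_of_nonneg (hnn w)]; exact min_le_left _ _
    · refine (integrableOn_compl_ball_norm_rpow hq).mono' hhm.aestronglyMeasurable
        (Eventually.of_forall fun w => ?_)
      rw [Real.norm_of_nonneg (hnn w)]; exact min_le_right _ _
  have hq0 : 0 < q := by linarith
  refine ⟨∫ w, h w, integral_nonneg hnn, fun {ρ N} hρM hN hρN x => ?_⟩
  set l := N ^ q⁻¹
  have hl : 0 < l := by positivity
  have hlq : l ^ q = N := Real.rpow_inv_rpow hN.le hq0.ne'
  have hscale : Integrable fun y => h (l⁻¹ • y) := hhi.comp_smul (by positivity)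
  have h1 : ∫ y in ball 0 (‖x‖ / 2), |ρ y| ≤ ∫ y, h (l⁻¹ • y) := by
    calc _ ≤ ∫ y in ball 0 (‖x‖ / 2), h (l⁻¹ • y) := by
          refine integral_mono_of_nonneg (Eventually.of_forall fun y => abs_nonneg _)
            hscale.integrableOn (ae_restrict_of_ae ?_)
          filter_upwards [ae_norm_pos] with y hy
          refine le_min (hρM y) ((hρN y).trans ?_)
          rw [norm_smul, Real.norm_of_nonneg (by positivity), Real.mul_rpow (by positivity)
            (norm_nonneg y), Real.inv_rpow hl.le, Real.rpow_neg hl.le, inv_inv, hlq]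
          exact mul_le_mul_of_nonneg_left (norm_rpow_le_R hy hq0.le) hN.le
      _ ≤ _ := setIntegral_le_integral hscale (Eventually.of_forall fun y => hnn _)
  rw [Measure.integral_comp_inv_smul, finrank_euclideanSpace, Fintype.card_fin,
    abs_of_pos (by positivity), smul_eq_mul] at h1
  have h2 : l ^ 3 = N ^ a := by
    rw [← Real.rpow_natCast, ← Real.rpow_mul hN.le]; congr 1; field_simp; push_cast; linarith
  have h3 : R x ^ (-3 : ℝ) = (R x ^ (-q)) ^ a := by
    rw [← Real.rpow_mul (R_pos x).le, neg_mul, haq]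
  rw [h2] at h1
  rw [Real.mul_rpow hN.le (R_rpow_pos x _).le, ← h3]
  calc _ ≤ R x ^ (-3 : ℝ) * (N ^ a * ∫ w, h w) := by
        have := R_rpow_pos x (-3); gcongr
    _ = _ := by ring

theorem softened_rpow_le_inner {x y : E3} (hx : 1 ≤ ‖x‖) (hy : ‖y‖ < ‖x‖ / 2) (d : ℝ) :
    (‖x - y‖ ^ 2 + d ^ 2) ^ (-(3 / 2) : ℝ) ≤ 64 * R x ^ (-3 : ℝ) := by
  have h1 : R x / 4 ≤ ‖x - y‖ := by
    have := norm_sub_norm_le x y; have := R_le_two_mul_norm hx; linarith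
  have hR := R_pos x
  have h2 : x - y ≠ 0 := norm_pos_iff.1 (by linarith)
  refine (softened_rpow_neg_le_norm h2 (by norm_num)).trans ?_
  rw [show (-2 * (3 / 2) : ℝ) = -3 by norm_num]
  calc ‖x - y‖ ^ (-3 : ℝ) ≤ (R x / 4) ^ (-3 : ℝ) :=
        Real.rpow_le_rpow_of_nonpos (by positivity) h1 (by norm_num)
    _ = _ := by
        rw [Real.div_rpow hR.le (by norm_num), div_eq_mul_inv, ← Real.rpow_neg (by norm_num),
          mul_comm]
        norm_num

/-- The exponent splits as 3/2 = (2+a)/2 + (1-a)/2: the first part is spent on |z|, leaving a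
locally integrable singularity since 2 + a < 3, the second on the softening length S. -/
theorem softened_rpow_le_near (ha : a ∈ Ico (0 : ℝ) 1) {z : E3} (hz : 0 < ‖z‖) {S : ℝ}
    (hS : 0 < S) :
    S * (‖z‖ ^ 2 + S ^ 2) ^ (-(3 / 2) : ℝ) ≤ S ^ a * ‖z‖ ^ (-(2 + a)) := by
  have hu := softened_pos hS z
  have h1 : (‖z‖ ^ 2 + S ^ 2) ^ (-(3 / 2) : ℝ) =
      (‖z‖ ^ 2 + S ^ 2) ^ (-((2 + a) / 2)) * (‖z‖ ^ 2 + S ^ 2) ^ (-((1 - a) / 2)) := by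
    rw [← Real.rpow_add hu]; congr 1; ring
  have h2 := softened_rpow_neg_le_norm (ε := S) (norm_pos_iff.1 hz) (s := (2 + a) / 2)
    (by linarith [ha.1])
  have h3 := softened_rpow_neg_le hS (s := (1 - a) / 2) (by linarith [ha.2]) z
  rw [show -2 * ((2 + a) / 2) = -(2 + a) by ring] at h2
  rw [show -2 * ((1 - a) / 2) = a - 1 by ring] at h3
  have h4 : S * S ^ (a - 1) = S ^ a := by
    nth_rewrite 1 [← Real.rpow_one S]; rw [← Real.rpow_add hS]; congr 1; ring
  rw [h1]
  calc _ ≤ S * (‖z‖ ^ (-(2 + a)) * S ^ (a - 1)) := by gcongr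
    _ = S * S ^ (a - 1) * ‖z‖ ^ (-(2 + a)) := by ring
    _ = _ := by rw [h4]

/-- After |r| ≤ |r|^{1-a} B^a, Young's inequality with weights (1-a)/2 and (1+a)/2 separates r² from
a power of |z| with exponent 6/(1+a) > 3. This is where square integrability of the density is used.
-/
theorem mul_softened_rpow_le_far (ha : a ∈ Ico (0 : ℝ) 1) {z : E3} (hz : 0 < ‖z‖) (d : ℝ) {r B : ℝ}
    (hr : |r| ≤ B) : |r| * (‖z‖ ^ 2 + d ^ 2) ^ (-(3 / 2) : ℝ) ≤
      B ^ a * (r ^ 2 + ‖z‖ ^ (-(6 / (1 + a)))) := by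
  have ha0 := ha.1
  have hB := (abs_nonneg r).trans hr
  have h1 := softened_rpow_neg_le_norm (ε := d) (norm_pos_iff.1 hz) (s := 3 / 2) (by norm_num)
  rw [show (-2 * (3 / 2) : ℝ) = -3 by norm_num] at h1
  have h2 : |r| ≤ |r| ^ (1 - a) * B ^ a :=
    le_interpolation (Ico_subset_Icc_self ha) (abs_nonneg r) le_rfl hr
  have h3 := Real.geom_mean_le_arith_mean2_weighted (w₁ := (1 - a) / 2) (w₂ := (1 + a) / 2)
    (p₁ := r ^ 2) (p₂ := ‖z‖ ^ (-(6 / (1 + a)))) (by linarith [ha.2]) (by linarith)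
    (sq_nonneg r) (by positivity) (by ring)
  have h4 : (r ^ 2) ^ ((1 - a) / 2) = |r| ^ (1 - a) := by
    rw [← sq_abs, ← Real.rpow_natCast, ← Real.rpow_mul (abs_nonneg r)]; congr 1; push_cast; ring
  have h5 : (‖z‖ ^ (-(6 / (1 + a)))) ^ ((1 + a) / 2) = ‖z‖ ^ (-3 : ℝ) := by
    rw [← Real.rpow_mul hz.le]; congr 1; field_simp; norm_num
  rw [h4, h5] at h3
  have h6 : (1 - a) / 2 * r ^ 2 ≤ r ^ 2 := by nlinarith [sq_nonneg r]
  have h7 : (1 + a) / 2 * ‖z‖ ^ (-(6 / (1 + a))) ≤ ‖z‖ ^ (-(6 / (1 + a))) :=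
    mul_le_of_le_one_left (by positivity) (by linarith [ha.2])
  calc _ ≤ |r| ^ (1 - a) * B ^ a * ‖z‖ ^ (-3 : ℝ) := by gcongr
    _ = B ^ a * (|r| ^ (1 - a) * ‖z‖ ^ (-3 : ℝ)) := by ring
    _ ≤ _ := by gcongr; linarith

theorem exists_softened_bound (hq : 0 < q) (ha : a ∈ Ico (0 : ℝ) 1) (haq : q * a ≤ 3)
    (hM : 0 ≤ M) (hL : 0 ≤ L) : ∃ C : ℝ, 0 ≤ C ∧ ∀ {ρ : E3 → ℝ} {N : ℝ}, Integrable ρ →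
      Integrable (fun x => ρ x ^ 2) → ∫ x, ρ x ^ 2 ≤ L → (∀ x, |ρ x| ≤ M) → 0 < N →
      (∀ x, |ρ x| ≤ N * R x ^ (-q)) → ∀ x : E3, 1 ≤ ‖x‖ →
      ∫ y, |ρ y| * (‖x - y‖ ^ 2 + (N * R x ^ (-q)) ^ 2) ^ (-(3 / 2) : ℝ) ≤
        C * (N * R x ^ (-q)) ^ a := by
  obtain ⟨C₁, hC₁, hin⟩ : ∃ C : ℝ, 0 ≤ C ∧ ∀ {ρ : E3 → ℝ} {N : ℝ}, (∀ x, |ρ x| ≤ M) → 0 < N →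
      (∀ x, |ρ x| ≤ N * R x ^ (-q)) → ∀ x : E3, 1 ≤ ‖x‖ →
      R x ^ (-3 : ℝ) * ∫ y in ball 0 (‖x‖ / 2), |ρ y| ≤ C * (N * R x ^ (-q)) ^ a := by
    rcases haq.lt_or_eq with h | h
    · exact exists_setIntegral_bound_of_lt hq ha h hM
    -- Here q a = 3 together with a < 1 forces q > 3.
    · obtain ⟨C, hC, h'⟩ := exists_setIntegral_bound_of_eq (q := q) (a := a)
        (by nlinarith [ha.1, ha.2]) h hM
      exact ⟨C, hC, fun h1 h2 h3 x _ => h' h1 h2 h3 x⟩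
  have ha0 := ha.1
  have ha1 := ha.2
  set J₁ := ∫ z in ball (0 : E3) 1, ‖z‖ ^ (-(2 + a))
  set J₂ := ∫ z in (ball (0 : E3) 1)ᶜ, ‖z‖ ^ (-(6 / (1 + a)))
  have hJ₁ : 0 ≤ J₁ := integral_nonneg fun y => by positivity
  have hJ₂ : 0 ≤ J₂ := integral_nonneg fun y => by positivity
  refine ⟨64 * C₁ + 2 ^ q * J₁ + (2 ^ q) ^ a * (L + J₂), by positivity,
    fun {ρ N} hρi hsq hsqL hρM hN hρN x hx => ?_⟩
  set S := N * R x ^ (-q)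
  have hRx := R_pos x
  have hS : 0 < S := mul_pos hN (R_rpow_pos x _)
  have i1 : Integrable fun y => 64 * R x ^ (-3 : ℝ) * (ball (0 : E3) (‖x‖ / 2)).indicator
      (fun y => |ρ y|) y :=
    ((hρi.abs.integrableOn).integrable_indicator measurableSet_ball).const_mul _
  have j2 : Integrable fun z => (ball (0 : E3) 1).indicator (fun z => ‖z‖ ^ (-(2 + a))) z :=
    (integrableOn_ball_norm_rpow (by linarith) _).integrable_indicator measurableSet_ball
  have i2 : Integrable fun y => 2 ^ q * S ^ a * (ball (0 : E3) 1).indicator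
      (fun z => ‖z‖ ^ (-(2 + a))) (x - y) := (j2.comp_sub_left x).const_mul _
  have j3 : Integrable fun z => ((ball (0 : E3) 1)ᶜ).indicator (fun z => ‖z‖ ^ (-(6 / (1 + a)))) z :=
    (integrableOn_compl_ball_norm_rpow (by rw [lt_div_iff₀ (by linarith)]; linarith)).integrable_indicator
      measurableSet_ball.compl
  have i3 : Integrable fun y => (2 ^ q * S) ^ a * (ρ y ^ 2 + ((ball (0 : E3) 1)ᶜ).indicator
      (fun z => ‖z‖ ^ (-(6 / (1 + a)))) (x - y)) := (hsq.add (j3.comp_sub_left x)).const_mul _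
  have hle : ∀ᵐ y : E3, |ρ y| * (‖x - y‖ ^ 2 + S ^ 2) ^ (-(3 / 2) : ℝ) ≤
      64 * R x ^ (-3 : ℝ) * (ball (0 : E3) (‖x‖ / 2)).indicator (fun y => |ρ y|) y +
      (2 ^ q * S ^ a * (ball (0 : E3) 1).indicator (fun z => ‖z‖ ^ (-(2 + a))) (x - y) +
      (2 ^ q * S) ^ a * (ρ y ^ 2 + ((ball (0 : E3) 1)ᶜ).indicator
        (fun z => ‖z‖ ^ (-(6 / (1 + a)))) (x - y))) := by
    have hne : ∀ᵐ y : E3, y ≠ x := by simp [ae_iff]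
    filter_upwards [hne] with y hy
    have hz : 0 < ‖x - y‖ := norm_pos_iff.2 (sub_ne_zero.2 hy.symm)
    have n1 : 0 ≤ 64 * R x ^ (-3 : ℝ) * (ball (0 : E3) (‖x‖ / 2)).indicator (fun y => |ρ y|) y :=
      mul_nonneg (by positivity) (indicator_nonneg (fun _ _ => abs_nonneg _) _)
    have n2 : 0 ≤ 2 ^ q * S ^ a * (ball (0 : E3) 1).indicator (fun z => ‖z‖ ^ (-(2 + a))) (x - y) :=
      mul_nonneg (by positivity) (indicator_nonneg (fun _ _ => by positivity) _)
    have n3 : 0 ≤ (2 ^ q * S) ^ a * (ρ y ^ 2 + ((ball (0 : E3) 1)ᶜ).indicator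
        (fun z => ‖z‖ ^ (-(6 / (1 + a)))) (x - y)) :=
      mul_nonneg (by positivity) (add_nonneg (sq_nonneg _)
        (indicator_nonneg (fun _ _ => by positivity) _))
    rcases lt_or_ge ‖y‖ (‖x‖ / 2) with h | h
    · have h1 : |ρ y| * (‖x - y‖ ^ 2 + S ^ 2) ^ (-(3 / 2) : ℝ) ≤
          |ρ y| * (64 * R x ^ (-3 : ℝ)) :=
        mul_le_mul_of_nonneg_left (softened_rpow_le_inner hx h S) (abs_nonneg _)
      rw [indicator_of_mem (by simpa using h)]
      linarith
    · have h1 : |ρ y| ≤ 2 ^ q * S := by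
        refine (hρN y).trans ?_
        have h2 : R x / 2 ≤ R y := by
          have e1 : (R x / 2) ^ 2 ≤ R y ^ 2 := by
            rw [div_pow, R_sq, R_sq]; nlinarith [norm_nonneg x]
          exact le_of_sq_le_sq e1 (R_pos y).le
        have h3 : R y ^ (-q) ≤ (R x / 2) ^ (-q) :=
          Real.rpow_le_rpow_of_nonpos (by positivity) h2 (by linarith)
        have h4 : (R x / 2) ^ (-q) = 2 ^ q * R x ^ (-q) := by
          rw [Real.div_rpow hRx.le (by norm_num), Real.rpow_neg (by norm_num : (0:ℝ) ≤ 2),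
            div_inv_eq_mul, mul_comm]
        calc _ ≤ N * (2 ^ q * R x ^ (-q)) := by rw [← h4]; gcongr
          _ = _ := by simp only [S]; ring
      rcases lt_or_ge ‖x - y‖ 1 with h' | h'
      · have h2 := softened_rpow_le_near ha hz hS
        rw [indicator_of_mem (s := ball (0 : E3) 1) (by simpa using h')] at n2 ⊢
        have h3 : |ρ y| * (‖x - y‖ ^ 2 + S ^ 2) ^ (-(3 / 2) : ℝ) ≤
            2 ^ q * S ^ a * ‖x - y‖ ^ (-(2 + a)) := by
          calc _ ≤ 2 ^ q * S * (‖x - y‖ ^ 2 + S ^ 2) ^ (-(3 / 2) : ℝ) := by gcongr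
            _ = 2 ^ q * (S * (‖x - y‖ ^ 2 + S ^ 2) ^ (-(3 / 2) : ℝ)) := by ring
            _ ≤ 2 ^ q * (S ^ a * ‖x - y‖ ^ (-(2 + a))) := by gcongr
            _ = _ := by ring
        linarith
      · have h2 := mul_softened_rpow_le_far ha hz S h1
        rw [indicator_of_mem (s := (ball (0 : E3) 1)ᶜ) (by simpa using h')] at n3 ⊢
        linarith
  refine (integral_mono_of_nonneg (Eventually.of_forall fun y => by positivity)
    (i1.add (i2.add i3)) hle).trans ?_
  have e1 := integral_add i1 (i2.add i3)
  have e2 := integral_add i2 i3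
  have e3 := integral_add hsq (j3.comp_sub_left x)
  simp only [Pi.add_apply] at e1 e2 ⊢
  rw [e1, e2, integral_const_mul, integral_const_mul, integral_const_mul, e3,
    integral_indicator measurableSet_ball,
    integral_sub_left_eq_self (fun z => (ball (0 : E3) 1).indicator
      (fun z => ‖z‖ ^ (-(2 + a))) z) volume x,
    integral_sub_left_eq_self (fun z => ((ball (0 : E3) 1)ᶜ).indicator
      (fun z => ‖z‖ ^ (-(6 / (1 + a)))) z) volume x,
    integral_indicator measurableSet_ball, integral_indicator measurableSet_ball.compl,
    Real.mul_rpow (by positivity) hS.le]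
  have h1 := hin hρM hN hρN x hx
  have h2 : (2 ^ q) ^ a * S ^ a * ((∫ x, ρ x ^ 2) + J₂) ≤ (2 ^ q) ^ a * S ^ a * (L + J₂) := by
    gcongr
  calc _ ≤ 64 * (C₁ * S ^ a) + (2 ^ q * S ^ a * J₁ + (2 ^ q) ^ a * S ^ a * (L + J₂)) := by
        rw [mul_assoc 64]; gcongr
    _ = _ := by ring

/-- At softening length 1 the kernel is R^{-3}, which is square integrable. The resulting bound does
not involve the weighted norm and serves when that norm is large or infinite. -/
theorem integral_mul_softened_one_le {ρ : E3 → ℝ} (hsq : Integrable fun x => ρ x ^ 2) (x : E3) :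
    ∫ y, |ρ y| * (‖x - y‖ ^ 2 + 1 ^ 2) ^ (-(3 / 2) : ℝ) ≤
      (∫ y, ρ y ^ 2) + ∫ z : E3, R z ^ (-6 : ℝ) := by
  have hi := integrable_R_rpow (s := 6) (by norm_num)
  rw [← integral_sub_left_eq_self (fun z : E3 => R z ^ (-6 : ℝ)) volume x,
    ← integral_add hsq (hi.comp_sub_left x)]
  refine integral_mono_of_nonneg (Eventually.of_forall fun y => by positivity)
    (hsq.add (hi.comp_sub_left x)) (Eventually.of_forall fun y => ?_)
  have h1 : R (x - y) ^ (-6 : ℝ) = ((‖x - y‖ ^ 2 + 1 ^ 2) ^ (-(3 / 2) : ℝ)) ^ 2 := by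
    rw [R, ← Real.rpow_mul (by positivity), ← Real.rpow_mul_natCast (by positivity), add_comm]
    norm_num
  beta_reduce
  rw [h1, ← sq_abs (ρ y)]
  have : 0 ≤ (‖x - y‖ ^ 2 + 1 ^ 2) ^ (-(3 / 2) : ℝ) := by positivity
  nlinarith [sq_nonneg (|ρ y| - (‖x - y‖ ^ 2 + 1 ^ 2) ^ (-(3 / 2) : ℝ)), abs_nonneg (ρ y)]

/-- Gradient bound for a Coulomb field in terms of weighted bounds of the density. -/
theorem exists_coulomb_gradient_bound {M' : ℝ} (hq : 0 < q) (ha : a ∈ Ico (0 : ℝ) 1)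
    (haq : q * a ≤ 3) (hM : 0 ≤ M) (hM' : 0 ≤ M') (hL : 0 ≤ L) :
    ∃ C : ℝ, 0 < C ∧ ∀ {ρ : E3 → ℝ}, Differentiable ℝ ρ → Integrable ρ →
      Integrable (fun x => ρ x ^ 2) → ∫ x, ρ x ^ 2 ≤ L → (∀ x, |ρ x| ≤ M) →
      (∀ x, ‖fderiv ℝ ρ x‖ ≤ M') → ∀ x : E3, 1 ≤ ‖x‖ →
      ‖fderiv ℝ (fun x => ∫ y, (ρ y / ‖x - y‖ ^ 3) • (x - y)) x‖ ≤ C ∧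
      ∀ N, 0 ≤ N → (∀ x, |ρ x| ≤ N * R x ^ (-q)) →
        ‖fderiv ℝ (fun x => ∫ y, (ρ y / ‖x - y‖ ^ 3) • (x - y)) x‖ ≤
          C * (N * R x ^ (-q)) ^ a := by
  obtain ⟨C₁, hC₁, h⟩ := exists_softened_bound (L := L) hq ha haq hM hL
  obtain ⟨J, hJe⟩ : ∃ J, ∫ z, ‖coulombDefect 1 z‖ = J := ⟨_, rfl⟩
  obtain ⟨I, hIe⟩ : ∃ I, ∫ z : E3, R z ^ (-6 : ℝ) = I := ⟨_, rfl⟩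
  have hJ : 0 ≤ J := hJe ▸ integral_nonneg fun z => norm_nonneg _
  have hI : 0 ≤ I := hIe ▸ integral_nonneg fun z => (R_rpow_pos z _).le
  have hpos : 0 < M' * J + 4 * (L + I) + 4 * C₁ + 1 := by positivity
  -- The summand 1 keeps the constant strictly positive, so that its product with an infinite
  -- right-hand side is infinite.
  refine ⟨M' * J + 4 * (L + I) + 4 * C₁ + 1, hpos,
    fun {ρ} hρ hρi hsq hsqL hρM hρM' x hx => ?_⟩
  have hconst : ‖fderiv ℝ (fun x => ∫ y, (ρ y / ‖x - y‖ ^ 3) • (x - y)) x‖ ≤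
      M' * J + 4 * (L + I) + 4 * C₁ + 1 := by
    have h1 := (differentiableAt_coulomb hρ hρi hρM hρM' one_pos x).2
    have h2 := integral_mul_softened_one_le hsq x
    rw [hJe, mul_one] at h1
    rw [hIe] at h2
    linarith
  refine ⟨hconst, fun N hN hρN => ?_⟩
  have hRx := R_rpow_pos x (-q)
  rcases hN.eq_or_lt with rfl | hN
  · have h0 : ∀ y, ρ y = 0 := fun y => abs_nonpos_iff.1 (by simpa using hρN y)
    simp only [h0, zero_div, zero_smul, integral_zero, fderiv_fun_const, Pi.zero_apply, norm_zero, zero_mul]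
    exact mul_nonneg hpos.le (Real.rpow_nonneg le_rfl _)
  · have hS : 0 < N * R x ^ (-q) := mul_pos hN hRx
    have h1 := (differentiableAt_coulomb hρ hρi hρM hρM' hS x).2
    have h2 := h hρi hsq hsqL hρM hN hρN x hx
    rw [hJe] at h1
    generalize N * R x ^ (-q) = S at hS h1 h2 ⊢
    -- For S < 1 the splitting length S satisfies S ≤ S^a; for S ≥ 1 the factor S^a is at least 1
    -- and the uniform bound is enough.
    rcases lt_or_ge S 1 with hS1 | hS1
    · have h3 : S ≤ S ^ a := by
        have := Real.rpow_le_rpow_of_exponent_ge hS hS1.le ha.2.le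
        rwa [Real.rpow_one] at this
      have h4 : M' * J * S ≤ M' * J * S ^ a := mul_le_mul_of_nonneg_left h3 (by positivity)
      have h5 : 0 ≤ (4 * (L + I) + 1) * S ^ a := by positivity
      refine h1.trans ?_
      linarith
    · exact hconst.trans (le_mul_of_one_le_right hpos.le (Real.one_le_rpow hS1 ha.1))

end Singular

end VlasovPoisson

/-! ### Assembly of the gradient estimate -/

theorem lemma3 (p T : ℝ) (hp : p ∈ Ioo (3 : ℝ) 4) (hT : 0 < T)
    (F : E3 → ℝ) (f₀ : E3 → E3 → ℝ) (A : ℝ → E3 → E3)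
    (hF : BackgroundCond F) (hf₀ : InitialCond f₀) (hA : ExternalFieldCond p T A)
    (hFf₀ : PerturbationCond F f₀)
    (q a : ℝ) (hq : 0 < q) (ha : a ∈ Ico (0 : ℝ) 1) (haq : a ≤ 3 / q) (M₀ M₁ : ℝ≥0) :
    ∃ C : ℝ≥0, ∀ f : ℝ → E3 → E3 → ℝ, IsSolution T F f₀ A f →
      (∃ K : ℝ≥0, ∀ t ∈ Icc 0 T, weightedNorm p (density F f t) ≤ K) →
      ∀ t ∈ Icc 0 T, supNorm (density F f t) ≤ M₀ →
        supNorm (fderiv ℝ (density F f t)) ≤ M₁ →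
        ∀ x : E3, 1 ≤ ‖x‖ →
          DifferentiableAt ℝ (field F f t) x ∧
          ‖fderiv ℝ (field F f t) x‖ₑ ≤
            C * (weightedNorm q (density F f t) * ENNReal.ofReal (R x ^ (-q))) ^ a := by
  obtain ⟨L, hL, hsq⟩ := exists_density_sq_bound hp hT hF hf₀ hA hFf₀ M₀.2
  have hqa : q * a ≤ 3 := by rwa [le_div_iff₀' hq] at haq
  obtain ⟨C, hC, hgrad⟩ := exists_coulomb_gradient_bound hq ha hqa M₀.2 M₁.2 hL
  lift C to ℝ≥0 using hC.le
  refine ⟨C, fun f hf hK t ht hM₀ hM₁ x hx => ?_⟩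
  obtain ⟨P, K, hb⟩ := hf.exists_bounds hp.1 hT hF hf₀ hA hFf₀ hK
  have hρM : ∀ x, |density F f t x| ≤ M₀ := norm_le_of_supNorm_le hM₀
  have hρM' : ∀ x, ‖fderiv ℝ (density F f t) x‖ ≤ M₁ := norm_le_of_supNorm_le hM₁
  have hdiff := hf.differentiable_density hF hb ht
  have hint : Integrable (density F f t) :=
    ((integrable_R_rpow hp.1).const_mul K).mono' hdiff.continuous.aestronglyMeasurable
      (.of_forall fun x => hb.density t ht x)
  obtain ⟨hsqi, hsqL⟩ := hsq hf hb t ht hρM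
  obtain ⟨hconst, hweight⟩ := hgrad hdiff hint hsqi hsqL hρM hρM' x hx
  refine ⟨(differentiableAt_coulomb hdiff hint hρM hρM' one_pos x).1, ?_⟩
  have hcoe : (C : ℝ≥0∞) = ENNReal.ofReal C := ENNReal.ofReal_coe_nnreal.symm
  have hRpos : 0 < R x ^ (-q) := R_rpow_pos x (-q)
  rw [hcoe, ← ofReal_norm]
  -- For an infinite weighted norm only a = 0 has content, and there the uniform bound applies; for
  -- a > 0 the right-hand side is infinite because R x ^ (-q) and C are positive.
  rcases eq_or_ne (weightedNorm q (density F f t)) ⊤ with htop | hfin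
  · rcases ha.1.eq_or_lt with rfl | ha0
    · rw [ENNReal.rpow_zero, mul_one]
      exact ENNReal.ofReal_le_ofReal hconst
    · rw [htop, ENNReal.top_mul (ENNReal.ofReal_pos.2 hRpos).ne', ENNReal.top_rpow_of_pos ha0,
        ENNReal.mul_top (ENNReal.ofReal_pos.2 hC).ne']
      exact le_top
  · lift weightedNorm q (density F f t) to ℝ≥0 using hfin with N hN
    have h := hweight N N.coe_nonneg (abs_le_of_weightedNorm_le hN.ge)
    rw [← ENNReal.ofReal_coe_nnreal (p := N), ← ENNReal.ofReal_mul N.coe_nonneg,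
      ENNReal.ofReal_rpow_of_nonneg (mul_nonneg N.coe_nonneg hRpos.le) ha.1, ← ENNReal.ofReal_mul hC.le]
    exact ENNReal.ofReal_le_ofReal h
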